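/- Let $k$ be a field and let $\mathcal P$ be a $k$-linear (cohomologically graded) dg-category such that $\mathrm{Ob}(\mathcal P)$ is finite, every $\mathcal P^i(E,F)$ is a finite-dimensional $k$-vector space, and there is $m>0$ with $\mathcal P^i(E,F)=0$ for all $E,F$ and all $i<-m$. For a commutative $k$-algebra $B$ let $R(B)=MC(\mathcal P\otimes_k B)$ be the dg-category whose objects are the pairs $(E,\eta)$ with $E\in \mathrm{Ob}(\mathcal P)$, $\eta\in \mathcal P^1(E,E)\otimes_k B$ and $d\eta+\eta^2=0$, and whose complex of morphisms $(E,\eta)\to(F,\zeta)$ is $\mathcal P(E,F)\otimes_kB$ with the differential $f\mapsto df+\zeta f-(-1)^{|f|}f\eta$. For a dg-category $\mathcal A$, the coherent nerve $NC(\mathcal A)$ is the simplicial set whose $n$-simplices consist of objects $X_0,\dots,X_n$ of $\mathcal A$ and elements $\alpha(i_0,\dots,i_r)\in\mathcal A^{1-r}(X_{i_0},X_{i_r})$ for all $r\ge 1$ and $0\le i_0\le\dots\le i_r\le n$, such that $\alpha(i,i)=1_{X_i}$, such that $\alpha(i_0,\dots,i_r)=0$ if $r\ge2$ and $i_j=i_{j+1}$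 for some $j$, and such that $$d\,\alpha(i_0,\dots,i_r)=\sum_{j=1}^{r-1}(-1)^{r-1-j}\bigl(\alpha(i_j,\dots,i_r)\,\alpha(i_0,\dots,i_j)-\alpha(i_0,\dots,\widehat{i_j},\dots,i_r)\bigr);$$ weakly increasing maps act by reindexing. Let $NC^*(\mathcal A)\subset NC(\mathcal A)$ be the simplicial subset of those simplices for which every $\alpha(i_0,i_1)$ is an equivalence (closed of degree $0$ and invertible in $H^0$). Then $B\mapsto NC^*(R(B))$ is given by a simplicial $k$-scheme $X_\bullet$, in the following sense: there are a simplicial $k$-scheme $X_\bullet$ and maps of simplicial sets $NC^*(R(B))\to \mathrm{Hom}_k(\mathrm{Spec}\,B,X_\bullet)$, natural in $B$, which in every simplicial degree $n$ are Zariski-locally on $\mathrm{Spec}\,B$ injective and surjective; that is, $X_n$ represents the Zariski sheaf associated with $B\mapsto NC^*_n(R(B))$. Moreover $X_\bullet$ satisfies the Grothendieck–Pridham condition $G.P_{n,l}$ for all $n\ge1$ and $0\le l\le n$: the morphism of schemes $$X_n\longrightarrow \mathrm{Match}_{\Lambda^l_n}(X)=\bigl\{(f_i)_{0\le i\le n,\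 i\ne l}\ :\ f_i\in X_{n-1},\ \partial_if_j=\partial_{j-1}f_i \text{ in } X_{n-2}\text{ for } i<j\bigr\},\qquad x\mapsto(\partial_ix)_{i\neq l},$$ is smooth and surjective (for $n=1$ there is no condition and $\mathrm{Match}_{\Lambda^l_1}(X)=X_0$). -/

import Mathlib

open CategoryTheory CategoryTheory.Limits AlgebraicGeometry
open scoped TensorProduct

universe u

noncomputable section

/-- A (small, cohomologically graded) dg-category over a commutative ring `R`.  The composition of
`f` of degree `i` and `g` of degree `j` is available in any degree `n` with `i + j = n`, and the
differential out of degree `i` lands in any degree `j` with `i + 1 = j`.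
`comp h f g` is the composite `f ∘ g`. -/
structure DGCat (R : Type u) [CommRing R] where
  Obj : Type u
  Hom : Obj → Obj → ℤ → Type u
  [addCommGroup : ∀ X Y i, AddCommGroup (Hom X Y i)]
  [module : ∀ X Y i, Module R (Hom X Y i)]
  d : ∀ {X Y : Obj} {i j : ℤ}, i + 1 = j → (Hom X Y i →ₗ[R] Hom X Y j)
  comp : ∀ {X Y Z : Obj} {i j n : ℤ}, i + j = n → (Hom Y Z i →ₗ[R] Hom X Y j →ₗ[R] Hom X Z n)
  one : ∀ X : Obj, Hom X X 0
  d_d : ∀ {X Y : Obj} {i j l : ℤ} (h : i + 1 = j) (h' : j + 1 = l) (f : Hom X Y i),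
    d h' (d h f) = 0
  /-- The graded Leibniz rule `d(fg) = (df)g + (-1)^{|f|} f(dg)`. -/
  d_comp : ∀ {X Y Z : Obj} {i j n i' j' n' : ℤ} (h : i + j = n) (hn : n + 1 = n')
    (hi : i + 1 = i') (hj : j + 1 = j') (h₁ : i' + j = n') (h₂ : i + j' = n')
    (f : Hom Y Z i) (g : Hom X Y j),
    d hn (comp h f g) = comp h₁ (d hi f) g + i.negOnePow • comp h₂ f (d hj g)
  assoc : ∀ {W X Y Z : Obj} {i j l ij jl n : ℤ} (h₁ : i + j = ij) (h₂ : ij + l = n)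
    (h₃ : j + l = jl) (h₄ : i + jl = n) (f : Hom Y Z i) (g : Hom X Y j) (e : Hom W X l),
    comp h₂ (comp h₁ f g) e = comp h₄ f (comp h₃ g e)
  one_comp : ∀ {X Y : Obj} {i : ℤ} (h : 0 + i = i) (f : Hom X Y i), comp h (one Y) f = f
  comp_one : ∀ {X Y : Obj} {i : ℤ} (h : i + 0 = i) (f : Hom X Y i), comp h f (one X) = f

namespace DGCat

attribute [instance] DGCat.addCommGroup DGCat.module

variable {R : Type u} [CommRing R]

/-- A closed morphism of degree `0` is an equivalence if it is invertible up to homotopy, i.e. if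
its class in `H⁰` is an isomorphism. -/
def IsEquivalence (A : DGCat R) {X Y : A.Obj} (f : A.Hom X Y 0) : Prop :=
  A.d (zero_add 1) f = 0 ∧
    ∃ g : A.Hom Y X 0, A.d (zero_add 1) g = 0 ∧
      (∃ h : A.Hom X X (-1), A.comp (add_zero 0) g f = A.one X + A.d (by norm_num) h) ∧
      (∃ h : A.Hom Y Y (-1), A.comp (add_zero 0) f g = A.one Y + A.d (by norm_num) h)

/-- A (strict) dg-functor, additive on morphisms; the base rings of source and target are allowed
to differ, so that extension of scalars is an instance. -/
@[ext]
structure Functor {S T : Type u} [CommRing S] [CommRing T] (A : DGCat S) (A' : DGCat T) where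
  obj : A.Obj → A'.Obj
  map : ∀ {X Y : A.Obj} {i : ℤ}, A.Hom X Y i →+ A'.Hom (obj X) (obj Y) i
  map_d : ∀ {X Y : A.Obj} {i j : ℤ} (h : i + 1 = j) (f : A.Hom X Y i),
    map (A.d h f) = A'.d h (map f)
  map_comp : ∀ {X Y Z : A.Obj} {i j n : ℤ} (h : i + j = n) (f : A.Hom Y Z i) (g : A.Hom X Y j),
    map (A.comp h f g) = A'.comp h (map f) (map g)
  map_one : ∀ X : A.Obj, map (A.one X) = A'.one (obj X)

/-- The identity dg-functor. -/
def Functor.id (A : DGCat R) : Functor A A where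
  obj X := X
  map := AddMonoidHom.id _
  map_d _ _ := rfl
  map_comp _ _ _ := rfl
  map_one _ := rfl

/-- Composition of dg-functors, in diagrammatic order. -/
def Functor.trans {S T U : Type u} [CommRing S] [CommRing T] [CommRing U] {A : DGCat S}
    {A' : DGCat T} {A'' : DGCat U} (F : Functor A A') (G : Functor A' A'') : Functor A A'' where
  obj X := G.obj (F.obj X)
  map := G.map.comp F.map
  map_d h f := by simp [F.map_d, G.map_d]
  map_comp h f g := by simp [F.map_comp, G.map_comp]
  map_one X := by simp [F.map_one, G.map_one]

lemma Functor.map_isEquivalence {S T : Type u} [CommRing S] [CommRing T] {A : DGCat S}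
    {A' : DGCat T} (F : Functor A A') {X Y : A.Obj} {f : A.Hom X Y 0} (hf : A.IsEquivalence f) :
    A'.IsEquivalence (F.map f) := by
  obtain ⟨hd, g, hg, ⟨h, hh⟩, ⟨h', hh'⟩⟩ := hf
  refine ⟨by rw [← F.map_d, hd, map_zero], F.map g, by rw [← F.map_d, hg, map_zero],
    ⟨F.map h, ?_⟩, ⟨F.map h', ?_⟩⟩
  · rw [← F.map_comp, hh, map_add, F.map_one, F.map_d]
  · rw [← F.map_comp, hh', map_add, F.map_one, F.map_d]

/-! ### Extension of scalars -/

section BaseChange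

/-- The `B`-bilinear extension of an `R`-bilinear map. -/
def bilinBaseChange (B : Type u) [CommRing B] [Algebra R B] {M N L : Type u} [AddCommGroup M] [AddCommGroup N] [AddCommGroup L]
    [Module R M] [Module R N] [Module R L] (f : M →ₗ[R] N →ₗ[R] L) :
    B ⊗[R] M →ₗ[B] B ⊗[R] N →ₗ[B] B ⊗[R] L :=
  ((LinearMap.baseChangeHom R B N L) ∘ₗ f).liftBaseChange B

@[simp]
lemma bilinBaseChange_tmul (B : Type u) [CommRing B] [Algebra R B] {M N L : Type u} [AddCommGroup M] [AddCommGroup N] [AddCommGroup L]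
    [Module R M] [Module R N] [Module R L] (f : M →ₗ[R] N →ₗ[R] L) (b c : B) (x : M) (y : N) :
    bilinBaseChange B f (b ⊗ₜ x) (c ⊗ₜ y) = (b * c) ⊗ₜ f x y := by
  simp [bilinBaseChange, TensorProduct.smul_tmul']

/-- The dg-category `A ⊗_R B` over `B`: same objects, morphisms `B ⊗_R A(X, Y)`. -/
def baseChange (A : DGCat R) (B : Type u) [CommRing B] [Algebra R B] : DGCat B where
  Obj := A.Obj
  Hom X Y i := B ⊗[R] A.Hom X Y i
  d h := (A.d h).baseChange B
  comp h := bilinBaseChange B (A.comp h)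
  one X := 1 ⊗ₜ A.one X
  d_d h h' f := by
    induction f using TensorProduct.induction_on with
    | zero => simp
    | tmul b x => simp [A.d_d]
    | add x y hx hy => simp only [map_add, hx, hy, add_zero]
  d_comp {X Y Z i j n i' j' n'} h hn hi hj h₁ h₂ f g := by
    induction f using TensorProduct.induction_on with
    | zero => simp
    | add x y hx hy => simp only [map_add, LinearMap.add_apply, hx, hy, smul_add]; abel
    | tmul b x =>
      induction g using TensorProduct.induction_on with
      | zero => simp
      | add x y hx hy => simp only [map_add, hx, hy, smul_add]; abel
      | tmul c y =>
        simp only [bilinBaseChange_tmul, LinearMap.baseChange_tmul, A.d_comp h hn hi hj h₁ h₂,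
          TensorProduct.tmul_add]
        rcases Int.even_or_odd i with he | he
        · simp [Int.negOnePow_even i he]
        · simp [Int.negOnePow_odd i he, TensorProduct.tmul_neg]
  assoc h₁ h₂ h₃ h₄ f g e := by
    induction f using TensorProduct.induction_on with
    | zero => simp
    | add x y hx hy => simp only [map_add, LinearMap.add_apply, hx, hy]
    | tmul b x =>
      induction g using TensorProduct.induction_on with
      | zero => simp
      | add x y hx hy => simp only [map_add, LinearMap.add_apply, hx, hy]
      | tmul c y =>
        induction e using TensorProduct.induction_on with
        | zero => simp
        | add x y hx hy => simp only [map_add, hx, hy]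
        | tmul a z => simp [A.assoc h₁ h₂ h₃ h₄, mul_assoc]
  one_comp h f := by
    induction f using TensorProduct.induction_on with
    | zero => simp
    | tmul b x => simp [A.one_comp]
    | add x y hx hy => simp only [map_add, hx, hy]
  comp_one h f := by
    induction f using TensorProduct.induction_on with
    | zero => simp
    | tmul b x => simp [A.comp_one]
    | add x y hx hy => simp only [map_add, LinearMap.add_apply, hx, hy]

/-- The map `B ⊗_R A(X, Y) → B' ⊗_R A(X, Y)` induced by `B → B'`. -/
def baseChangeMapHom (A : DGCat R) {B B' : Type u} [CommRing B] [Algebra R B] [CommRing B']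
    [Algebra R B'] (φ : B →ₐ[R] B') (X Y : A.Obj) (i : ℤ) :
    B ⊗[R] A.Hom X Y i →+ B' ⊗[R] A.Hom X Y i :=
  (LinearMap.rTensor (A.Hom X Y i) φ.toLinearMap).toAddMonoidHom

@[simp]
lemma baseChangeMapHom_tmul (A : DGCat R) {B B' : Type u} [CommRing B] [Algebra R B]
    [CommRing B'] [Algebra R B'] (φ : B →ₐ[R] B') (X Y : A.Obj) (i : ℤ) (b : B)
    (x : A.Hom X Y i) : A.baseChangeMapHom φ X Y i (b ⊗ₜ x) = φ b ⊗ₜ x := rfl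

lemma baseChangeMapHom_d (A : DGCat R) {B B' : Type u} [CommRing B] [Algebra R B]
    [CommRing B'] [Algebra R B'] (φ : B →ₐ[R] B') {X Y : A.Obj} {i j : ℤ} (h : i + 1 = j)
    (f : B ⊗[R] A.Hom X Y i) :
    A.baseChangeMapHom φ X Y j ((A.d h).baseChange B f) =
      (A.d h).baseChange B' (A.baseChangeMapHom φ X Y i f) := by
  induction f using TensorProduct.induction_on with
  | zero => simp
  | tmul b x => simp
  | add x y hx hy => simp only [map_add, hx, hy]

lemma baseChangeMapHom_comp (A : DGCat R) {B B' : Type u} [CommRing B] [Algebra R B]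
    [CommRing B'] [Algebra R B'] (φ : B →ₐ[R] B') {X Y Z : A.Obj} {i j n : ℤ} (h : i + j = n)
    (f : B ⊗[R] A.Hom Y Z i) (g : B ⊗[R] A.Hom X Y j) :
    A.baseChangeMapHom φ X Z n (bilinBaseChange B (A.comp h) f g) =
      bilinBaseChange B' (A.comp h) (A.baseChangeMapHom φ Y Z i f)
        (A.baseChangeMapHom φ X Y j g) := by
  induction f using TensorProduct.induction_on with
  | zero => simp
  | add x y hx hy => simp only [map_add, LinearMap.add_apply, hx, hy]
  | tmul b x =>
    induction g using TensorProduct.induction_on with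
    | zero => simp
    | add x y hx hy => simp only [map_add, hx, hy]
    | tmul c y => simp

/-- The dg-functor `A ⊗_R B → A ⊗_R B'` induced by a morphism of `R`-algebras `B → B'`. -/
def baseChangeMap (A : DGCat R) {B B' : Type u} [CommRing B] [Algebra R B] [CommRing B']
    [Algebra R B'] (φ : B →ₐ[R] B') : Functor (A.baseChange B) (A.baseChange B') where
  obj X := X
  map := A.baseChangeMapHom φ _ _ _
  map_d h f := A.baseChangeMapHom_d φ h f
  map_comp h f g := A.baseChangeMapHom_comp φ h f g
  map_one X := by
    refine (A.baseChangeMapHom_tmul φ X X 0 1 (A.one X)).trans ?_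
    rw [map_one]; rfl

lemma baseChangeMap_id (A : DGCat R) (B : Type u) [CommRing B] [Algebra R B] :
    A.baseChangeMap (AlgHom.id R B) = Functor.id (A.baseChange B) := by
  have key : ∀ (X Y : A.Obj) (i : ℤ),
      A.baseChangeMapHom (AlgHom.id R B) X Y i = AddMonoidHom.id _ := fun X Y i =>
    AddMonoidHom.ext fun f => LinearMap.congr_fun (LinearMap.rTensor_id (A.Hom X Y i) B) f
  refine Functor.ext rfl (heq_of_eq ?_)
  funext X Y i
  exact key X Y i

lemma baseChangeMap_comp (A : DGCat R) {B B' B'' : Type u} [CommRing B] [Algebra R B]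
    [CommRing B'] [Algebra R B'] [CommRing B''] [Algebra R B''] (φ : B →ₐ[R] B')
    (ψ : B' →ₐ[R] B'') :
    A.baseChangeMap (ψ.comp φ) = (A.baseChangeMap φ).trans (A.baseChangeMap ψ) := by
  have key : ∀ (X Y : A.Obj) (i : ℤ), A.baseChangeMapHom (ψ.comp φ) X Y i =
      (A.baseChangeMapHom ψ X Y i).comp (A.baseChangeMapHom φ X Y i) := fun X Y i =>
    AddMonoidHom.ext fun f =>
      LinearMap.rTensor_comp_apply (A.Hom X Y i) ψ.toLinearMap φ.toLinearMap f
  refine Functor.ext rfl (heq_of_eq ?_)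
  funext X Y i
  exact key X Y i

end BaseChange

/-! ### Maurer-Cartan objects -/

/-- The twisted differential `f ↦ df + ζf - (-1)^{|f|} fη` on `A(E, F)`, for `η ∈ A¹(E, E)` and
`ζ ∈ A¹(F, F)`. -/
def twistedD (A : DGCat R) {E F : A.Obj} (η : A.Hom E E 1) (ζ : A.Hom F F 1) {i j : ℤ}
    (h : i + 1 = j) : A.Hom E F i →ₗ[R] A.Hom E F j :=
  A.d h + A.comp ((add_comm 1 i).trans h) ζ - i.negOnePow • (A.comp h).flip η

lemma twistedD_apply (A : DGCat R) {E F : A.Obj} (η : A.Hom E E 1) (ζ : A.Hom F F 1) {i j : ℤ}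
    (h : i + 1 = j) (f : A.Hom E F i) : A.twistedD η ζ h f =
      A.d h f + A.comp ((add_comm 1 i).trans h) ζ f - i.negOnePow • A.comp h f η := rfl

lemma twistedD_twistedD (A : DGCat R) {E F : A.Obj} {η : A.Hom E E 1} {ζ : A.Hom F F 1}
    (hη : A.d one_add_one_eq_two η + A.comp one_add_one_eq_two η η = 0)
    (hζ : A.d one_add_one_eq_two ζ + A.comp one_add_one_eq_two ζ ζ = 0) {i j l : ℤ}
    (h : i + 1 = j) (h' : j + 1 = l) (f : A.Hom E F i) :
    A.twistedD η ζ h' (A.twistedD η ζ h f) = 0 := by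
  have h2 : i + 2 = l := by omega
  have h2' : 2 + i = l := by omega
  have e1 := A.d_comp ((add_comm 1 i).trans h) h' one_add_one_eq_two h h2'
    ((add_comm 1 j).trans h') ζ f
  have e2 := A.d_comp h h' h one_add_one_eq_two h' h2 f η
  have a1 := A.assoc one_add_one_eq_two h2' ((add_comm 1 i).trans h)
    ((add_comm 1 j).trans h') ζ ζ f
  have a2 := A.assoc h h' one_add_one_eq_two h2 f η η
  have a3 := A.assoc ((add_comm 1 i).trans h) h' h ((add_comm 1 j).trans h') ζ f η
  have z1 : A.comp h2' (A.d one_add_one_eq_two ζ) f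
      + A.comp h2' (A.comp one_add_one_eq_two ζ ζ) f = 0 := by
    rw [← LinearMap.add_apply, ← map_add, hζ, map_zero, LinearMap.zero_apply]
  have z2 : A.comp h2 f (A.d one_add_one_eq_two η)
      + A.comp h2 f (A.comp one_add_one_eq_two η η) = 0 := by
    rw [← map_add, hη, map_zero]
  have hs : j.negOnePow = -i.negOnePow := by rw [← h, Int.negOnePow_succ]
  have z1' := eq_neg_of_add_eq_zero_left z1
  have z2' := eq_neg_of_add_eq_zero_left z2
  rw [a1] at z1'
  rw [← a2] at z2'
  rcases Int.even_or_odd i with he | he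
  · have hi := Int.negOnePow_even i he
    rw [hi] at e2 hs
    simp only [twistedD_apply, map_add, map_sub, A.d_d, hi, hs, one_smul, Units.neg_smul, e1, e2, z1', z2', Int.negOnePow_one, a3]
    abel
  · have hi := Int.negOnePow_odd i he
    rw [hi] at e2 hs
    simp only [twistedD_apply, map_add, map_sub, map_neg, A.d_d, hi, hs, one_smul, Units.neg_smul, neg_neg, e1, e2, z1', z2',
      Int.negOnePow_one, a3]
    abel

lemma twistedD_comp (A : DGCat R) {E F G : A.Obj} (η : A.Hom E E 1) (ζ : A.Hom F F 1)
    (ξ : A.Hom G G 1) {i j n i' j' n' : ℤ} (h : i + j = n) (hn : n + 1 = n')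
    (hi : i + 1 = i') (hj : j + 1 = j') (h₁ : i' + j = n') (h₂ : i + j' = n')
    (f : A.Hom F G i) (g : A.Hom E F j) :
    A.twistedD η ξ hn (A.comp h f g) = A.comp h₁ (A.twistedD ζ ξ hi f) g
      + i.negOnePow • A.comp h₂ f (A.twistedD η ζ hj g) := by
  have e := A.d_comp h hn hi hj h₁ h₂ f g
  have a1 := A.assoc ((add_comm 1 i).trans hi) h₁ h ((add_comm 1 n).trans hn) ξ f g
  have a2 := A.assoc hi h₁ ((add_comm 1 j).trans hj) h₂ f ζ g
  have a3 := A.assoc h hn hj h₂ f g η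
  have hs : n.negOnePow = i.negOnePow * j.negOnePow := by rw [← h, Int.negOnePow_add]
  rcases Int.even_or_odd i with he | he <;> rcases Int.even_or_odd j with he' | he' <;>
  [have hii := Int.negOnePow_even i he; have hii := Int.negOnePow_even i he;
    have hii := Int.negOnePow_odd i he; have hii := Int.negOnePow_odd i he] <;>
  [have hjj := Int.negOnePow_even j he'; have hjj := Int.negOnePow_odd j he';
    have hjj := Int.negOnePow_even j he'; have hjj := Int.negOnePow_odd j he'] <;>
  · rw [hii] at e
    simp only [twistedD_apply, map_add, map_sub, map_neg, LinearMap.add_apply, LinearMap.neg_apply,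
      LinearMap.sub_apply, hs, hii, hjj, one_mul, mul_one, neg_mul, one_smul, Units.neg_smul,
      neg_neg, e, a1, a2, a3]
    abel

/-- The dg-category `MC(A)` of Maurer-Cartan objects of `A`.  Its objects are the pairs `(E, η)`
with `η ∈ A¹(E, E)` and `dη + η² = 0`; the complex of morphisms from `(E, η)` to `(F, ζ)` is
`A(E, F)` with the twisted differential `f ↦ df + ζf - (-1)^{|f|} fη`. -/
def MC (A : DGCat R) : DGCat R where
  Obj := Σ E : A.Obj, {η : A.Hom E E 1 //
    A.d one_add_one_eq_two η + A.comp one_add_one_eq_two η η = 0}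
  Hom X Y i := A.Hom X.1 Y.1 i
  d {X Y _ _} h := A.twistedD X.2.1 Y.2.1 h
  comp h := A.comp h
  one X := A.one X.1
  d_d {X Y _ _ _} h h' f := A.twistedD_twistedD X.2.2 Y.2.2 h h' f
  d_comp {X Y Z _ _ _ _ _ _} h hn hi hj h₁ h₂ f g :=
    A.twistedD_comp X.2.1 Y.2.1 Z.2.1 h hn hi hj h₁ h₂ f g
  assoc h₁ h₂ h₃ h₄ f g e := A.assoc h₁ h₂ h₃ h₄ f g e
  one_comp h f := A.one_comp h f
  comp_one h f := A.comp_one h f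

lemma Functor.map_twistedD {S T : Type u} [CommRing S] [CommRing T] {A : DGCat S} {A' : DGCat T}
    (F : Functor A A') {X Y : A.Obj} (η : A.Hom X X 1) (ζ : A.Hom Y Y 1) {i j : ℤ}
    (h : i + 1 = j) (f : A.Hom X Y i) :
    F.map (A.twistedD η ζ h f) = A'.twistedD (F.map η) (F.map ζ) h (F.map f) := by
  rw [twistedD_apply, twistedD_apply]
  rcases Int.even_or_odd i with hi | hi
  · rw [Int.negOnePow_even i hi, one_smul, one_smul, map_sub, map_add, F.map_d, F.map_comp,
      F.map_comp]
  · rw [Int.negOnePow_odd i hi, Units.neg_smul, Units.neg_smul, one_smul, one_smul, map_sub,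
      map_add, map_neg, F.map_d, F.map_comp, F.map_comp]

/-- The dg-functor `MC(A) → MC(A')` induced by a dg-functor `A → A'`. -/
def MC.map {S T : Type u} [CommRing S] [CommRing T] {A : DGCat S} {A' : DGCat T}
    (F : Functor A A') : Functor (MC A) (MC A') where
  obj X := ⟨F.obj X.1, F.map X.2.1, by
    rw [← F.map_d, ← F.map_comp, ← map_add, X.2.2, map_zero]⟩
  map := F.map
  map_d {X Y _ _} h f := F.map_twistedD X.2.1 Y.2.1 h f
  map_comp h f g := F.map_comp h f g
  map_one X := F.map_one X.1

/-! ### The coherent nerve -/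

/-- `i ≤ c₁ ≤ ⋯ ≤ cₘ ≤ j`, where `c = [c₁, …, cₘ]`. -/
def IsChain {n : ℕ} (i : Fin (n + 1)) (c : List (Fin (n + 1))) (j : Fin (n + 1)) : Prop :=
  (i :: (c ++ [j])).Pairwise (· ≤ ·)

lemma IsChain.left {n : ℕ} {i j : Fin (n + 1)} {c : List (Fin (n + 1))} (h : IsChain i c j)
    (p : Fin c.length) : IsChain i (c.take p) (c.get p) := by
  refine List.Pairwise.sublist (List.Sublist.cons_cons i ?_) h
  rw [show c.take p ++ [c.get p] = c.take (p + 1) by simp]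
  exact (List.take_sublist _ _).trans (List.sublist_append_left _ _)

lemma IsChain.right {n : ℕ} {i j : Fin (n + 1)} {c : List (Fin (n + 1))} (h : IsChain i c j)
    (p : Fin c.length) : IsChain (c.get p) (c.drop (p + 1)) j := by
  refine List.Pairwise.sublist ?_ h
  rw [← List.cons_append, show c.get p :: c.drop (p + 1) = c.drop p by simp]
  exact List.Sublist.cons _ (List.Sublist.append_right (List.drop_sublist _ _) _)

lemma IsChain.erase {n : ℕ} {i j : Fin (n + 1)} {c : List (Fin (n + 1))} (h : IsChain i c j)
    (p : Fin c.length) : IsChain i (c.eraseIdx p) j :=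
  List.Pairwise.sublist
    (List.Sublist.cons_cons i (List.Sublist.append_right (List.eraseIdx_sublist _ _) _)) h

lemma IsChain.map {m n : ℕ} (θ : Fin (m + 1) →o Fin (n + 1)) {i j : Fin (m + 1)}
    {c : List (Fin (m + 1))} (h : IsChain i c j) : IsChain (θ i) (c.map θ) (θ j) := by
  have := List.Pairwise.map (S := (· ≤ ·)) θ (fun a b hab => θ.monotone hab) h
  simpa [IsChain] using this

/-- An `n`-simplex of the coherent nerve of `A`, i.e. a strictly unital weak functor from the
linear category `0 → 1 → ⋯ → n` to `A`: objects `X₀, …, Xₙ` and, for every weakly increasing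
sequence `i ≤ c₁ ≤ ⋯ ≤ cₘ ≤ j` in `{0, …, n}`, an element `α(i, c₁, …, cₘ, j)` of
`A(X_i, X_j)` of degree `-m`, here `α hc q hq` with `hc` the proof that the sequence is increasing
and `q = -m`. -/
@[ext]
structure NerveSimplex (A : DGCat R) (n : ℕ) where
  obj : Fin (n + 1) → A.Obj
  α : ∀ {i j : Fin (n + 1)} {c : List (Fin (n + 1))}, IsChain i c j →
    ∀ q : ℤ, q + c.length = 0 → A.Hom (obj i) (obj j) q
  /-- `α(i, i) = 1`. -/
  unit : ∀ {i : Fin (n + 1)} (h : IsChain i [] i), α h 0 (by simp) = A.one (obj i)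
  /-- `α` vanishes on the sequences of length at least three in which an index is repeated. -/
  degenerate : ∀ {i j : Fin (n + 1)} {c : List (Fin (n + 1))} (h : IsChain i c j) (q : ℤ)
    (hq : q + c.length = 0), c ≠ [] → ¬ (i :: (c ++ [j])).Nodup → α h q hq = 0
  /-- With `(i₀, …, i_{m+1}) = (i, c₁, …, cₘ, j)`:
  `d α(i₀, …, i_{m+1}) = ∑_{s=1}^{m} (-1)^{m-s}
    (α(i_s, …, i_{m+1}) α(i₀, …, i_s) - α(i₀, …, î_s, …, i_{m+1}))`; below `s = p + 1`. -/
  d_α : ∀ {i j : Fin (n + 1)} {c : List (Fin (n + 1))} (h : IsChain i c j) (q q' : ℤ)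
    (hq : q + c.length = 0) (hq' : q + 1 = q'),
    A.d hq' (α h q hq) = ∑ p : Fin c.length, (-1 : ℤ) ^ (c.length - 1 - (p : ℕ)) •
      (A.comp (i := -((c.drop (p + 1)).length : ℤ)) (j := -((c.take p).length : ℤ))
          (by have := p.2; simp only [List.length_drop, List.length_take]; omega)
          (α (h.right p) _ (by omega)) (α (h.left p) _ (by omega))
        - α (h.erase p) q' (by have := p.2; rw [List.length_eraseIdx_of_lt p.2]; omega))

namespace NerveSimplex

variable {A : DGCat R}

lemma α_congr {n : ℕ} (x : NerveSimplex A n) {i j : Fin (n + 1)} {c c' : List (Fin (n + 1))}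
    (hc : c = c') (h : IsChain i c j) (h' : IsChain i c' j) (q : ℤ) (hq : q + c.length = 0)
    (hq' : q + c'.length = 0) : x.α h q hq = x.α h' q hq' := by
  subst hc; rfl

lemma comp_congr {n : ℕ} (x : NerveSimplex A n) {i j a a' : Fin (n + 1)}
    {c₁ c₁' c₂ c₂' : List (Fin (n + 1))} (ha : a = a') (h₁ : c₁ = c₁') (h₂ : c₂ = c₂')
    (k₁ : IsChain i c₁ a) (k₁' : IsChain i c₁' a') (k₂ : IsChain a c₂ j) (k₂' : IsChain a' c₂' j)
    {q₁ q₁' q₂ q₂' q : ℤ} (l₁ : q₁ + c₁.length = 0) (l₁' : q₁' + c₁'.length = 0)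
    (l₂ : q₂ + c₂.length = 0) (l₂' : q₂' + c₂'.length = 0) (e : q₂ + q₁ = q)
    (e' : q₂' + q₁' = q) :
    A.comp e (x.α k₂ q₂ l₂) (x.α k₁ q₁ l₁) = A.comp e' (x.α k₂' q₂' l₂') (x.α k₁' q₁' l₁') := by
  subst ha h₁ h₂
  obtain rfl : q₁ = q₁' := by omega
  obtain rfl : q₂ = q₂' := by omega
  rfl

/-- The action of a weakly increasing map `θ` on simplices:
`(θ^*α)(i₀, …, i_m) = α(θ i₀, …, θ i_m)`. -/
def pullback {m n : ℕ} (θ : Fin (m + 1) →o Fin (n + 1)) (x : NerveSimplex A n) :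
    NerveSimplex A m where
  obj i := x.obj (θ i)
  α h q hq := x.α (h.map θ) q (by simpa using hq)
  unit h := x.unit (h.map θ)
  degenerate {i j c} h q hq hc hn := by
    refine x.degenerate (h.map θ) q _ (by simpa using hc) fun hn' => hn ?_
    refine List.Nodup.of_map θ ?_
    simpa using hn'
  d_α {i j c} h q q' hq hq' := by
    rw [x.d_α (h.map θ) q q' (by simpa using hq) hq']
    refine Fintype.sum_equiv (finCongr (List.length_map (f := θ) (as := c))) _ _ fun p => ?_
    congr 1
    · simp
    · congr 1
      · exact x.comp_congr (by simp) (by simp [List.map_take]) (by simp [List.map_drop]) _ _ _ _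
          _ _ _ _ _ _
      · exact x.α_congr (by simp [List.eraseIdx_map]) _ _ _ _ _

lemma pullback_id {n : ℕ} (x : NerveSimplex A n) : x.pullback OrderHom.id = x := by
  refine NerveSimplex.ext rfl (heq_of_eq ?_)
  funext i j c h q hq
  exact x.α_congr (List.map_id c) _ _ _ _ _

lemma pullback_comp {l m n : ℕ} (x : NerveSimplex A n) (θ : Fin (m + 1) →o Fin (n + 1))
    (θ' : Fin (l + 1) →o Fin (m + 1)) :
    x.pullback (θ.comp θ') = (x.pullback θ).pullback θ' := by
  refine NerveSimplex.ext rfl (heq_of_eq ?_)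
  funext i j c h q hq
  exact x.α_congr (List.map_map (f := θ') (g := θ) (l := c)).symm _ _ _ _ _

/-- The image of a simplex under a dg-functor. -/
def map {S T : Type u} [CommRing S] [CommRing T] {A : DGCat S} {A' : DGCat T} (F : Functor A A')
    {n : ℕ} (x : NerveSimplex A n) : NerveSimplex A' n where
  obj i := F.obj (x.obj i)
  α h q hq := F.map (x.α h q hq)
  unit h := by rw [x.unit h, F.map_one]
  degenerate h q hq hc hn := by rw [x.degenerate h q hq hc hn, map_zero]
  d_α h q q' hq hq' := by
    rw [← F.map_d, x.d_α h q q' hq hq', map_sum]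
    refine Finset.sum_congr rfl fun p _ => ?_
    rw [map_zsmul, map_sub, F.map_comp]

end NerveSimplex

/-- The coherent nerve `NC(A)`. -/
def NC (A : DGCat R) : SSet.{u} where
  obj n := NerveSimplex A n.unop.len
  map θ := ↾fun x => x.pullback θ.unop.toOrderHom
  map_id n := by
    refine ConcreteCategory.hom_ext _ _ fun x => ?_
    exact x.pullback_id
  map_comp θ θ' := by
    refine ConcreteCategory.hom_ext _ _ fun x => ?_
    exact x.pullback_comp _ _

/-- The simplicial subset `NC*(A)` of `NC(A)`: the simplices all of whose edges `α(i, j)`, `i ≤ j`,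
are equivalences. -/
def NCStar (A : DGCat R) : (NC A).Subcomplex where
  obj n := {x : NerveSimplex A n.unop.len | ∀ (i j : Fin (n.unop.len + 1)) (h : IsChain i [] j),
    A.IsEquivalence (x.α h 0 (by simp))}
  map θ x hx i j h := hx _ _ (h.map θ.unop.toOrderHom)

/-- The map `NC*(A) → NC*(A')` induced by a dg-functor. -/
def NCStar.map {S T : Type u} [CommRing S] [CommRing T] {A : DGCat S} {A' : DGCat T}
    (F : Functor A A') : (NCStar A).toSSet ⟶ (NCStar A').toSSet where
  app _ := ↾fun x => ⟨NerveSimplex.map F x.1, fun i j h => F.map_isEquivalence (x.2 i j h)⟩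
  naturality _ _ _ := rfl

/-- The functor `X = NC* ∘ R` from commutative `k`-algebras to simplicial sets, where
`R(B) = MC(P ⊗_k B)`. -/
def nerveMC {k : Type u} [Field k] (P : DGCat k) : CommAlgCat.{u} k ⥤ SSet.{u} where
  obj B := (NCStar (MC (P.baseChange B))).toSSet
  map φ := NCStar.map (MC.map (P.baseChangeMap φ.hom))
  map_id B := by
    have : NCStar.map (MC.map (P.baseChangeMap (AlgHom.id k B))) = 𝟙 _ := by
      rw [baseChangeMap_id]; rfl
    exact this
  map_comp φ ψ := by
    have : NCStar.map (MC.map (P.baseChangeMap (ψ.hom.comp φ.hom))) =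
        NCStar.map (MC.map (P.baseChangeMap φ.hom)) ≫
          NCStar.map (MC.map (P.baseChangeMap ψ.hom)) := by
      rw [baseChangeMap_comp]; rfl
    exact this

end DGCat

/-! ### Simplicial schemes -/

/-- The functor of points `B ↦ ([n] ↦ Hom_k(Spec B, Xₙ))` of a simplicial `k`-scheme. -/
def simplicialPoints (k : Type u) [Field k]
    (X : SimplicialObject (Over (Spec (CommRingCat.of k)))) : CommAlgCat.{u} k ⥤ SSet.{u} :=
  (algSpec (CommRingCat.of k)).rightOp ⋙ coyoneda ⋙
    (Functor.whiskeringLeft SimplexCategoryᵒᵖ (Over (Spec (CommRingCat.of k))) (Type u)).obj X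

/-- The localization map `B → B_b`, as a morphism of commutative `k`-algebras. -/
def awayMap {k : Type u} [Field k] (B : CommAlgCat.{u} k) (b : B) :
    B ⟶ CommAlgCat.of k (Localization.Away b) :=
  CommAlgCat.ofHom (IsScalarTower.toAlgHom k B (Localization.Away b))

/-- A morphism of functors from commutative `k`-algebras to simplicial sets is a local isomorphism
for the Zariski topology if in each simplicial degree it is injective and surjective Zariski-locally.
When the target is the functor of points of a simplicial scheme `X`, this says that `Xₙ` represents
the Zariski sheaf associated with `Fₙ`, for every `n`. -/
structure IsZariskiLocalIso {k : Type u} [Field k] {F G : CommAlgCat.{u} k ⥤ SSet.{u}}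
    (φ : F ⟶ G) : Prop where
  locally_injective : ∀ (n : SimplexCategoryᵒᵖ) (B : CommAlgCat.{u} k) (x y : (F.obj B).obj n),
    (φ.app B).app n x = (φ.app B).app n y →
      ∃ s : Finset B, Ideal.span (s : Set B) = ⊤ ∧
        ∀ b ∈ s, (F.map (awayMap B b)).app n x = (F.map (awayMap B b)).app n y
  locally_surjective : ∀ (n : SimplexCategoryᵒᵖ) (B : CommAlgCat.{u} k) (z : (G.obj B).obj n),
    ∃ s : Finset B, Ideal.span (s : Set B) = ⊤ ∧
      ∀ b ∈ s, ∃ x, (φ.app (CommAlgCat.of k (Localization.Away b))).app n x =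
        (G.map (awayMap B b)).app n z

section Matching

variable {C : Type*} [Category C] [HasFiniteLimits C]

/-- The object `Xₙ`. -/
abbrev level (X : SimplicialObject C) (n : ℕ) : C := X.obj (Opposite.op (SimplexCategory.mk n))

/-- Pairs `i < j + 1` of elements of `{0, …, n + 2}` different from `k`, recorded as `i ≤ j`. -/
abbrev HornPair (n : ℕ) (k : Fin (n + 3)) : Type :=
  {p : Fin (n + 2) × Fin (n + 2) // p.1 ≤ p.2 ∧ p.1.castSucc ≠ k ∧ p.2.succ ≠ k}

/-- The product of copies of `X_{n+1}` indexed by the faces `i ≠ k` of the `(n+2)`-simplex. -/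
abbrev hornFaces (X : SimplicialObject C) (n : ℕ) (k : Fin (n + 3)) : C :=
  ∏ᶜ fun _ : {i : Fin (n + 3) // i ≠ k} => level X (n + 1)

/-- `(f_i)_{i ≠ k} ↦ (∂_i f_{j+1})_{i ≤ j}`. -/
def hornLeft (X : SimplicialObject C) (n : ℕ) (k : Fin (n + 3)) :
    hornFaces X n k ⟶ ∏ᶜ fun _ : HornPair n k => level X n :=
  Pi.lift fun p => Pi.π (fun _ : {i : Fin (n + 3) // i ≠ k} => level X (n + 1))
    ⟨p.1.2.succ, p.2.2.2⟩ ≫ X.δ p.1.1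

/-- `(f_i)_{i ≠ k} ↦ (∂_j f_i)_{i ≤ j}`. -/
def hornRight (X : SimplicialObject C) (n : ℕ) (k : Fin (n + 3)) :
    hornFaces X n k ⟶ ∏ᶜ fun _ : HornPair n k => level X n :=
  Pi.lift fun p => Pi.π (fun _ : {i : Fin (n + 3) // i ≠ k} => level X (n + 1))
    ⟨p.1.1.castSucc, p.2.2.1⟩ ≫ X.δ p.1.2

/-- The matching object of `X` for the horn `Λ^k` of the `(n+1)`-simplex: families
`(f_i)_{i ≠ k}` in `Xₙ` with `∂_i f_j = ∂_{j-1} f_i` for `i < j` (no condition if `n = 0`, where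
there is exactly one index `i ≠ k`, so that the matching object is `X₀`). -/
def hornMatch (X : SimplicialObject C) : (n : ℕ) → Fin (n + 2) → C
  | 0, _ => level X 0
  | n + 1, k => equalizer (hornLeft X n k) (hornRight X n k)

/-- The matching map `x ↦ (∂_i x)_{i ≠ k}` from `X_{n+1}`. For `n = 0` the only `i ≠ k` in
`{0, 1}` is `1 - k`. -/
def hornMatchMap (X : SimplicialObject C) : (n : ℕ) → (k : Fin (n + 2)) →
    (level X (n + 1) ⟶ hornMatch X n k)
  | 0, k => X.δ (Fin.rev k)
  | n + 1, k => equalizer.lift (Pi.lift fun i => X.δ i.1) (by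
      refine Pi.hom_ext _ _ fun p => ?_
      simp only [hornLeft, hornRight, Category.assoc, Pi.lift_π, Pi.lift_π_assoc]
      exact X.δ_comp_δ p.2.1)

end Matching

/-- The Grothendieck-Pridham condition `G.P_{n+1,l}` for a simplicial `k`-scheme: the matching map
`X_{n+1} → Match_{Λ^l_{n+1}}(X)` is smooth and surjective. -/
def GrothendieckPridham {k : Type u} [Field k]
    (X : SimplicialObject (Over (Spec (CommRingCat.of k)))) (n : ℕ) (l : Fin (n + 2)) : Prop :=
  Smooth (hornMatchMap X n l).left ∧ Surjective (hornMatchMap X n l).left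

end

/-! Representability. The simplices over `B` with prescribed underlying objects `E` are solutions in
`B` of polynomial equations: their data are Maurer-Cartan elements and values on chains in
finite-dimensional spaces, with values on degenerate chains prescribed. They are represented by a
finitely generated algebra `SimplexRing E`, with universal simplex `univSimplex E`; the product over
all `E` is `NerveRing n`. A `B`-point of the product splits `Spec B` into open and closed pieces
according to `E`, so points come from simplices only Zariski-locally. Invertibility of the edges is
an open condition: a closed `f` is an equivalence when the unit is a boundary in the cones of `f^*`
and `f_*`, and if these complexes of finite free modules become exact over a residue field, their
cycles become boundaries after multiplication by a function that is nonzero there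
(`Matrix.exists_smul_eq_mulVec`, `Functor.IsFreeBaseChange.exists_isEquivalence`). Hence `X_n` is an
open subscheme of `Spec (NerveRing n)`.

The Grothendieck-Pridham condition. Everything is locally of finite type over a field, so smoothness
is the lifting property along square-zero extensions and surjectivity can be tested on points with
values in fields. Both become horn-filling problems relative to a dg-ideal `J`, the kernel of the
reduction in the first case and the unit ideal in the second: a family of values whose Maurer-Cartan
equations hold modulo `J`, and exactly on the horn, has to be corrected by elements of `J`.

Filling. The failure of the equation at a place is its `FinArray.defect`. The formal identity
`FinArray.rhs_rhs` yields a Bianchi identity, `FinArray.d_rhs`: the differential of the right hand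
side at a place is a combination of defects at smaller places. For a horn only the missing face and
the top place are unknown. For an inner horn the missing face enters the top equation linearly with
coefficient a sign; solving for it, the equation of the face follows from the Bianchi identity. For
an outer horn the missing face enters the top equation only composed with the first or last edge
`f`. The Bianchi identity then says that the two defects form a cocycle in the cone of `f^*` or
`f_*` on `J`, and this cone is exact because `f` is invertible up to homotopy as far as its action
on `J` is concerned (`DGIdeal.HtpyInv.exact_precomp`, `DGIdeal.HtpyInv.exact_postcomp`); a
cobounding pair is the correction.

Dimension one. Here one end point of an edge is given. For smoothness, the other Maurer-Cartan
element and the edge are lifted arbitrarily; the curvature of the former and the twisted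
differential of the latter again form a cocycle in such a cone
(`Functor.IsSquareZero.exists_lift_target`, `Functor.IsSquareZero.exists_lift_source`). Surjectivity
is witnessed by degenerate edges. -/

noncomputable section

namespace DGCat

variable {R : Type u} [CommRing R]

/-! ### Ideals of dg-categories and homotopy inverses -/

/-- A dg-ideal: subgroups of all morphism groups, stable under the differential and under
composition with arbitrary morphisms on either side. -/
structure DGIdeal (A : DGCat R) where
  mem : ∀ X Y i, AddSubgroup (A.Hom X Y i)
  d_mem : ∀ {X Y : A.Obj} {i j : ℤ} (h : i + 1 = j) {f : A.Hom X Y i},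
    f ∈ mem X Y i → A.d h f ∈ mem X Y j
  comp_mem_left : ∀ {X Y Z : A.Obj} {i j n : ℤ} (h : i + j = n) {f : A.Hom Y Z i}
    (g : A.Hom X Y j), f ∈ mem Y Z i → A.comp h f g ∈ mem X Z n
  comp_mem_right : ∀ {X Y Z : A.Obj} {i j n : ℤ} (h : i + j = n) (f : A.Hom Y Z i)
    {g : A.Hom X Y j}, g ∈ mem X Y j → A.comp h f g ∈ mem X Z n

/-- The unit dg-ideal. -/
def DGIdeal.top (A : DGCat R) : DGIdeal A where
  mem _ _ _ := ⊤
  d_mem _ _ _ := AddSubgroup.mem_top _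
  comp_mem_left _ _ _ _ := AddSubgroup.mem_top _
  comp_mem_right _ _ _ _ := AddSubgroup.mem_top _

/-- The kernel of a dg-functor. -/
def Functor.ker {S T : Type u} [CommRing S] [CommRing T] {A : DGCat S} {A' : DGCat T}
    (F : Functor A A') : DGIdeal A where
  mem _ _ _ := F.map.ker
  d_mem h f hf := by rw [AddMonoidHom.mem_ker] at hf ⊢; rw [F.map_d, hf, map_zero]
  comp_mem_left h f g hf := by
    rw [AddMonoidHom.mem_ker] at hf ⊢; rw [F.map_comp, hf, map_zero, LinearMap.zero_apply]
  comp_mem_right h f g hg := by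
    rw [AddMonoidHom.mem_ker] at hg ⊢; rw [F.map_comp, hg, map_zero]

lemma Functor.mem_ker {S T : Type u} [CommRing S] [CommRing T] {A : DGCat S} {A' : DGCat T}
    (F : Functor A A') {X Y : A.Obj} {i : ℤ} (f : A.Hom X Y i) :
    f ∈ F.ker.mem X Y i ↔ F.map f = 0 := AddMonoidHom.mem_ker

lemma DGIdeal.negOnePow_smul_mem {A : DGCat R} (J : DGIdeal A) {X Y : A.Obj} {i : ℤ}
    {f : A.Hom X Y i} (p : ℤ) (hf : f ∈ J.mem X Y i) : p.negOnePow • f ∈ J.mem X Y i := by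
  rcases Int.even_or_odd p with hp | hp
  · rwa [Int.negOnePow_even p hp, one_smul]
  · rw [Int.negOnePow_odd p hp, Units.neg_smul, one_smul]; exact neg_mem hf

/-- `f` has a homotopy inverse `g`, with homotopies `hX` and `hY`, as far as the action by
composition on the dg-ideal `J` is concerned. -/
structure DGIdeal.HtpyInv {A : DGCat R} (J : DGIdeal A) {X Y : A.Obj} (ηX : A.Hom X X 1)
    (ηY : A.Hom Y Y 1) (f : A.Hom X Y 0) where
  g : A.Hom Y X 0
  hX : A.Hom X X (-1)
  hY : A.Hom Y Y (-1)
  comp_df : ∀ {Z : A.Obj} {p q : ℤ} (e : p + 1 = q) (b : A.Hom Y Z p), b ∈ J.mem Y Z p →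
    A.comp e b (A.twistedD ηX ηY (zero_add 1) f) = 0
  comp_dg : ∀ {Z : A.Obj} {p q : ℤ} (e : p + 1 = q) (b : A.Hom X Z p), b ∈ J.mem X Z p →
    A.comp e b (A.twistedD ηY ηX (zero_add 1) g) = 0
  df_comp : ∀ {Z : A.Obj} {p q : ℤ} (e : 1 + p = q) (b : A.Hom Z X p), b ∈ J.mem Z X p →
    A.comp e (A.twistedD ηX ηY (zero_add 1) f) b = 0
  dg_comp : ∀ {Z : A.Obj} {p q : ℤ} (e : 1 + p = q) (b : A.Hom Z Y p), b ∈ J.mem Z Y p →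
    A.comp e (A.twistedD ηY ηX (zero_add 1) g) b = 0
  comp_gf : ∀ {Z : A.Obj} {p : ℤ} (e : p + 0 = p) (b : A.Hom X Z p), b ∈ J.mem X Z p →
    A.comp e b (A.comp (add_zero 0) g f) = b + A.comp e b (A.twistedD ηX ηX (by norm_num) hX)
  comp_fg : ∀ {Z : A.Obj} {p : ℤ} (e : p + 0 = p) (b : A.Hom Y Z p), b ∈ J.mem Y Z p →
    A.comp e b (A.comp (add_zero 0) f g) = b + A.comp e b (A.twistedD ηY ηY (by norm_num) hY)
  gf_comp : ∀ {Z : A.Obj} {p : ℤ} (e : 0 + p = p) (b : A.Hom Z X p), b ∈ J.mem Z X p →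
    A.comp e (A.comp (add_zero 0) g f) b = b + A.comp e (A.twistedD ηX ηX (by norm_num) hX) b
  fg_comp : ∀ {Z : A.Obj} {p : ℤ} (e : 0 + p = p) (b : A.Hom Z Y p), b ∈ J.mem Z Y p →
    A.comp e (A.comp (add_zero 0) f g) b = b + A.comp e (A.twistedD ηY ηY (by norm_num) hY) b

/-- The cone of `f^* : Hom(Y, Z) → Hom(X, Z)` is exact on a dg-ideal on which `f` is invertible
up to homotopy. -/
lemma DGIdeal.HtpyInv.exact_precomp {A : DGCat R} {J : DGIdeal A} {X Y Z : A.Obj}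
    {ηX : A.Hom X X 1} {ηY : A.Hom Y Y 1} (ηZ : A.Hom Z Z 1) {f : A.Hom X Y 0}
    (H : J.HtpyInv ηX ηY f) {r p q : ℤ} (hr : r + 1 = p) (hp : p + 1 = q) (hq : q + 0 = q)
    (hp0 : p + 0 = p) {b : A.Hom Y Z q} {a : A.Hom X Z p} (hb : b ∈ J.mem Y Z q)
    (ha : a ∈ J.mem X Z p)
    (db : A.twistedD ηY ηZ rfl b = 0) (da : A.twistedD ηX ηZ hp a = A.comp hq b f) :
    ∃ v ∈ J.mem Y Z p, ∃ u ∈ J.mem X Z r, A.twistedD ηY ηZ hp v = b ∧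
      a = A.comp hp0 v f + A.twistedD ηX ηZ hr u := by
  obtain rfl : p = r + 1 := hr.symm
  obtain rfl : q = r + 1 + 1 := hp.symm
  set g := H.g
  -- Since `da = bf`, the differential of `ag` is `bfg = b + b·d(hY)`. The second summand, whose
  -- differential is `-b·d(hY)` by the choice of sign, removes the excess.
  set v₀ : A.Hom Y Z (r + 1) := A.comp hp0 a g +
    (r + 1).negOnePow • A.comp (by omega) b H.hY with hv₀
  have mv₀ : v₀ ∈ J.mem Y Z (r + 1) :=
    add_mem (J.comp_mem_left _ _ ha) (J.negOnePow_smul_mem _ (J.comp_mem_left _ _ hb))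
  have sq : ∀ (s : ℤ) {X' Y' : A.Obj} {i' : ℤ} (x : A.Hom X' Y' i'),
      s.negOnePow • s.negOnePow • x = x := fun s _ _ _ x => by
    rw [smul_smul, ← Int.negOnePow_add, Int.negOnePow_even _ (Even.add_self s), one_smul]
  have tsm : ∀ (s : ℤ) {X' Y' : A.Obj} {i' j' : ℤ} (e : i' + 1 = j') (η : A.Hom X' X' 1)
      (ζ : A.Hom Y' Y' 1) (x : A.Hom X' Y' i'),
      A.twistedD η ζ e (s.negOnePow • x) = s.negOnePow • A.twistedD η ζ e x := fun s _ _ _ _ e η ζ x => by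
    rcases Int.even_or_odd s with hs | hs
    · rw [Int.negOnePow_even s hs, one_smul, one_smul]
    · rw [Int.negOnePow_odd s hs, Units.neg_smul, Units.neg_smul, one_smul, one_smul, map_neg]
  have dv₀ : A.twistedD ηY ηZ rfl v₀ = b := by
    rw [hv₀, map_add, tsm, A.twistedD_comp ηY ηX ηZ hp0 rfl rfl (zero_add 1) hq rfl a g, da,
      H.comp_dg _ _ ha, smul_zero, add_zero, A.assoc hq hq (add_zero 0) hq b f g,
      H.comp_fg _ _ hb, A.twistedD_comp ηY ηY ηZ (by omega) rfl rfl (by norm_num) (by omega) hq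
        b H.hY, db, map_zero, LinearMap.zero_apply, zero_add, Int.negOnePow_succ (r + 1),
      Units.neg_smul, smul_neg, sq]
    abel
  -- The remainder `a'` is closed. Adding `a'g` to `v₀` does not change its differential, and `a'gf
  -- = a' + a'·d(hX)`, where `a'·d(hX)` is up to sign the differential of `a'hX`. This determines
  -- `v` and `u`.
  set a' : A.Hom X Z (r + 1) := a - A.comp hp0 v₀ f with ha'
  have ma' : a' ∈ J.mem X Z (r + 1) := sub_mem ha (J.comp_mem_left _ _ mv₀)
  have da' : A.twistedD ηX ηZ rfl a' = 0 := by
    rw [ha', map_sub, da, A.twistedD_comp ηX ηY ηZ hp0 rfl rfl (zero_add 1) hq rfl v₀ f, dv₀,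
      H.comp_df _ _ mv₀, smul_zero, add_zero, sub_self]
  refine ⟨v₀ + A.comp hp0 a' g, add_mem mv₀ (J.comp_mem_left _ _ ma'),
    -((r + 1).negOnePow • A.comp (by omega) a' H.hX),
    neg_mem (J.negOnePow_smul_mem _ (J.comp_mem_left _ _ ma')), ?_, ?_⟩
  · rw [map_add, dv₀, A.twistedD_comp ηY ηX ηZ hp0 rfl rfl (zero_add 1) hq rfl a' g, da',
      H.comp_dg _ _ ma', map_zero, LinearMap.zero_apply, smul_zero, add_zero, add_zero]
  · rw [map_add, LinearMap.add_apply, A.assoc hp0 hp0 (add_zero 0) hp0 a' g f, H.comp_gf _ _ ma',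
      map_neg, tsm, A.twistedD_comp ηX ηX ηZ (by omega) rfl rfl (by norm_num) (by omega) hp0
        a' H.hX, da', map_zero, LinearMap.zero_apply, zero_add, sq, ha']
    abel

/-- The cone of `f_* : Hom(Z, X) → Hom(Z, Y)` is exact on a dg-ideal on which `f` is invertible
up to homotopy. -/
lemma DGIdeal.HtpyInv.exact_postcomp {A : DGCat R} {J : DGIdeal A} {X Y Z : A.Obj}
    {ηX : A.Hom X X 1} {ηY : A.Hom Y Y 1} (ηZ : A.Hom Z Z 1) {f : A.Hom X Y 0}
    (H : J.HtpyInv ηX ηY f) {r p q : ℤ} (hr : r + 1 = p) (hp : p + 1 = q) (hq : 0 + q = q)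
    (hp0 : 0 + p = p) {b : A.Hom Z X q} {a : A.Hom Z Y p} (hb : b ∈ J.mem Z X q)
    (ha : a ∈ J.mem Z Y p)
    (db : A.twistedD ηZ ηX rfl b = 0) (da : A.twistedD ηZ ηY hp a = A.comp hq f b) :
    ∃ v ∈ J.mem Z X p, ∃ u ∈ J.mem Z Y r, A.twistedD ηZ ηX hp v = b ∧
      a = A.comp hp0 f v + A.twistedD ηZ ηY hr u := by
  obtain rfl : p = r + 1 := hr.symm
  obtain rfl : q = r + 1 + 1 := hp.symm
  set g := H.g
  -- Mirror image of the argument for `f^*`. As `g` and `hX` now stand on the left of closed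
  -- elements or of `a`, no sign depending on the degree of `a` or `b` appears.
  set v₀ : A.Hom Z X (r + 1) := A.comp hp0 g a - A.comp (by omega) H.hX b with hv₀
  have mv₀ : v₀ ∈ J.mem Z X (r + 1) :=
    sub_mem (J.comp_mem_right _ _ ha) (J.comp_mem_right _ _ hb)
  have dv₀ : A.twistedD ηZ ηX rfl v₀ = b := by
    rw [hv₀, map_sub, A.twistedD_comp ηZ ηY ηX hp0 rfl (zero_add 1) rfl (by omega) hq g a, da,
      H.dg_comp _ _ ha, zero_add, Int.negOnePow_zero, one_smul,
      ← A.assoc (add_zero 0) hq hq hq g f b,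
      H.gf_comp _ _ hb, A.twistedD_comp ηZ ηX ηX (by omega) rfl (by norm_num) rfl hq (by omega)
        H.hX b, db, map_zero, smul_zero]
    abel
  set a' : A.Hom Z Y (r + 1) := a - A.comp hp0 f v₀ with ha'
  have ma' : a' ∈ J.mem Z Y (r + 1) := sub_mem ha (J.comp_mem_right _ _ mv₀)
  have da' : A.twistedD ηZ ηY rfl a' = 0 := by
    rw [ha', map_sub, da, A.twistedD_comp ηZ ηX ηY hp0 rfl (zero_add 1) rfl (by omega) hq f v₀,
      dv₀, H.df_comp _ _ mv₀, Int.negOnePow_zero, one_smul, zero_add, sub_self]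
  refine ⟨v₀ + A.comp hp0 g a', add_mem mv₀ (J.comp_mem_right _ _ ma'),
    -A.comp (by omega) H.hY a',
    neg_mem (J.comp_mem_right _ _ ma'), ?_, ?_⟩
  · rw [map_add, dv₀, A.twistedD_comp ηZ ηY ηX hp0 rfl (zero_add 1) rfl (by omega) hq g a', da',
      H.dg_comp _ _ ma', map_zero, smul_zero, add_zero, add_zero]
  · rw [map_add, ← A.assoc (add_zero 0) hp0 hp0 hp0 f g a', H.fg_comp _ _ ma',
      map_neg, A.twistedD_comp ηZ ηY ηY (by omega) rfl (by norm_num) rfl hp0 (by omega)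
        H.hY a', da', map_zero, smul_zero, ha']
    abel

/-- Identities are closed. -/
lemma d_one (A : DGCat R) (X : A.Obj) {j : ℤ} (h : 0 + 1 = j) : A.d h (A.one X) = 0 := by
  obtain rfl : j = 1 := h.symm
  have e := A.d_comp (add_zero 0) h h h (by norm_num) (by norm_num) (A.one X) (A.one X)
  rw [A.one_comp, A.comp_one, A.one_comp, Int.negOnePow_zero, one_smul] at e
  simpa using e

/-! ### Equivalences -/

lemma d_comp_zero (A : DGCat R) {X Y Z : A.Obj} {f : A.Hom Y Z 0} {g : A.Hom X Y 0}
    (hf : A.d (zero_add 1) f = 0) (hg : A.d (zero_add 1) g = 0) :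
    A.d (zero_add 1) (A.comp (add_zero 0) f g) = 0 := by
  rw [A.d_comp (add_zero 0) (zero_add 1) (zero_add 1) (zero_add 1) (by norm_num) (by norm_num), hf,
    hg, map_zero, LinearMap.zero_apply, map_zero, smul_zero, add_zero]

/-- Homotopy of morphisms of degree `0`. -/
def Homotopic (A : DGCat R) {X Y : A.Obj} (f g : A.Hom X Y 0) : Prop :=
  ∃ h : A.Hom X Y (-1), f = g + A.d (by norm_num) h

namespace Homotopic

variable {A : DGCat R} {X Y Z : A.Obj}

lemma refl (f : A.Hom X Y 0) : A.Homotopic f f := ⟨0, by simp⟩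

lemma symm {f g : A.Hom X Y 0} (h : A.Homotopic f g) : A.Homotopic g f := by
  obtain ⟨h, rfl⟩ := h
  exact ⟨-h, by simp⟩

lemma trans {f g e : A.Hom X Y 0} (h : A.Homotopic f g) (h' : A.Homotopic g e) :
    A.Homotopic f e := by
  obtain ⟨h, rfl⟩ := h
  obtain ⟨h', rfl⟩ := h'
  exact ⟨h' + h, by rw [map_add]; abel⟩

lemma comp_left {f f' : A.Hom Y Z 0} (h : A.Homotopic f f') {g : A.Hom X Y 0}
    (hg : A.d (zero_add 1) g = 0) :
    A.Homotopic (A.comp (add_zero 0) f g) (A.comp (add_zero 0) f' g) := by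
  obtain ⟨h, rfl⟩ := h
  refine ⟨A.comp (by norm_num) h g, ?_⟩
  rw [A.d_comp (by norm_num) (by norm_num) (by norm_num) (zero_add 1) (add_zero 0) (by norm_num),
    hg, map_zero, smul_zero, add_zero, map_add, LinearMap.add_apply]

lemma comp_right {f f' : A.Hom X Y 0} (h : A.Homotopic f f') {g : A.Hom Y Z 0}
    (hg : A.d (zero_add 1) g = 0) :
    A.Homotopic (A.comp (add_zero 0) g f) (A.comp (add_zero 0) g f') := by
  obtain ⟨h, rfl⟩ := h
  refine ⟨A.comp (by norm_num) g h, ?_⟩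
  rw [A.d_comp (by norm_num) (by norm_num) (zero_add 1) (by norm_num) (by norm_num) (add_zero 0),
    hg, map_zero, LinearMap.zero_apply, zero_add, Int.negOnePow_zero, one_smul, map_add]

end Homotopic

lemma isEquivalence_iff (A : DGCat R) {X Y : A.Obj} (f : A.Hom X Y 0) :
    A.IsEquivalence f ↔ A.d (zero_add 1) f = 0 ∧
      ∃ g : A.Hom Y X 0, A.d (zero_add 1) g = 0 ∧
        A.Homotopic (A.comp (add_zero 0) g f) (A.one X) ∧
        A.Homotopic (A.comp (add_zero 0) f g) (A.one Y) := Iff.rfl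

namespace IsEquivalence

variable {A : DGCat R} {X Y Z : A.Obj}

lemma one (X : A.Obj) : A.IsEquivalence (A.one X) := by
  rw [isEquivalence_iff]
  refine ⟨A.d_one X _, A.one X, A.d_one X _, ?_, ?_⟩ <;> rw [A.one_comp] <;> exact .refl _

/-- A left inverse `g` and a right inverse `g'` agree up to homotopy: `g ∼ gfg' ∼ g'`. The openness
argument produces the two inverses separately. -/
lemma of_left_right {f : A.Hom X Y 0} (hf : A.d (zero_add 1) f = 0) {g g' : A.Hom Y X 0}
    (hg : A.d (zero_add 1) g = 0) (hg' : A.d (zero_add 1) g' = 0)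
    (h : A.Homotopic (A.comp (add_zero 0) g f) (A.one X))
    (h' : A.Homotopic (A.comp (add_zero 0) f g') (A.one Y)) : A.IsEquivalence f := by
  refine (A.isEquivalence_iff f).2 ⟨hf, g, hg, h, ?_⟩
  have e : A.Homotopic g g' := by
    have h1 := h'.comp_right hg
    have h2 := h.comp_left hg'
    rw [A.comp_one] at h1
    rw [A.one_comp, A.assoc _ _ (add_zero 0) (add_zero 0)] at h2
    exact h1.symm.trans h2
  exact (e.comp_right hf).trans h'

lemma of_homotopic {f f' : A.Hom X Y 0} (h : A.IsEquivalence f)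
    (hf' : A.d (zero_add 1) f' = 0) (e : A.Homotopic f' f) : A.IsEquivalence f' := by
  obtain ⟨hf, g, hg, h1, h2⟩ := (A.isEquivalence_iff f).1 h
  exact (A.isEquivalence_iff f').2
    ⟨hf', g, hg, (e.comp_right hg).trans h1, (e.comp_left hg).trans h2⟩

lemma comp {f : A.Hom Y Z 0} {g : A.Hom X Y 0} (hf : A.IsEquivalence f)
    (hg : A.IsEquivalence g) : A.IsEquivalence (A.comp (add_zero 0) f g) := by
  obtain ⟨df, f', df', h1, h2⟩ := (A.isEquivalence_iff f).1 hf
  obtain ⟨dg, g', dg', h3, h4⟩ := (A.isEquivalence_iff g).1 hg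
  refine (A.isEquivalence_iff _).2 ⟨A.d_comp_zero df dg, A.comp (add_zero 0) g' f',
    A.d_comp_zero dg' df', ?_, ?_⟩
  · have := (h1.comp_left dg).comp_right dg'
    rw [A.one_comp, A.assoc (add_zero 0) (add_zero 0) (add_zero 0) (add_zero 0)] at this
    rw [A.assoc (add_zero 0) (add_zero 0) (add_zero 0) (add_zero 0)]
    exact this.trans h3
  · have := (h4.comp_left df').comp_right df
    rw [A.one_comp, A.assoc (add_zero 0) (add_zero 0) (add_zero 0) (add_zero 0)] at this
    rw [A.assoc (add_zero 0) (add_zero 0) (add_zero 0) (add_zero 0)]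
    exact this.trans h2

/-- With an inverse `g'` of `g` one has `f ∼ fgg' ∼ eg'`, a composite of equivalences. -/
lemma of_comp_left {f : A.Hom Y Z 0} {g : A.Hom X Y 0} {e : A.Hom X Z 0}
    (h : A.Homotopic (A.comp (add_zero 0) f g) e) (hf : A.d (zero_add 1) f = 0)
    (hg : A.IsEquivalence g) (he : A.IsEquivalence e) : A.IsEquivalence f := by
  obtain ⟨dg, g', dg', h3, h4⟩ := (A.isEquivalence_iff g).1 hg
  have hg' : A.IsEquivalence g' := (A.isEquivalence_iff g').2 ⟨dg', g, dg, h4, h3⟩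
  refine (he.comp hg').of_homotopic hf ?_
  have h5 := h4.comp_right hf
  have h6 := h.comp_left dg'
  rw [A.comp_one] at h5
  rw [A.assoc (add_zero 0) (add_zero 0) (add_zero 0) (add_zero 0)] at h6
  exact h5.symm.trans h6

lemma of_comp_right {f : A.Hom Y Z 0} {g : A.Hom X Y 0} {e : A.Hom X Z 0}
    (h : A.Homotopic (A.comp (add_zero 0) f g) e) (hg : A.d (zero_add 1) g = 0)
    (hf : A.IsEquivalence f) (he : A.IsEquivalence e) : A.IsEquivalence g := by
  obtain ⟨df, f', df', h1, h2⟩ := (A.isEquivalence_iff f).1 hf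
  have hf' : A.IsEquivalence f' := (A.isEquivalence_iff f').2 ⟨df', f, df, h2, h1⟩
  refine (hf'.comp he).of_homotopic hg ?_
  have h5 := h1.comp_left hg
  have h6 := h.comp_right df'
  rw [A.one_comp] at h5
  rw [← A.assoc (add_zero 0) (add_zero 0) (add_zero 0) (add_zero 0)] at h6
  exact h5.symm.trans h6

end IsEquivalence

/-- A morphism of `MC(A)` whose image under `MC(F)` is an equivalence acts invertibly, up to
homotopy, on the kernel of `F`, provided that the elements of the kernel have zero composites. -/
lemma Functor.nonempty_htpyInv_ker {S T : Type u} [CommRing S] [CommRing T] {A : DGCat S}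
    {A' : DGCat T} (F : Functor A A') (hF : ∀ X Y i, Function.Surjective (F.map (X := X) (Y := Y) (i := i)))
    (hker : ∀ {X Y Z : A.Obj} {i j n : ℤ} (h : i + j = n) (f : A.Hom Y Z i) (g : A.Hom X Y j),
      F.map f = 0 → F.map g = 0 → A.comp h f g = 0)
    {X Y : A.Obj} {ηX : A.Hom X X 1} {ηY : A.Hom Y Y 1} {f : A.Hom X Y 0}
    {g : A'.Hom (F.obj Y) (F.obj X) 0}
    (hdf : A'.twistedD (F.map ηX) (F.map ηY) (zero_add 1) (F.map f) = 0)
    (hdg : A'.twistedD (F.map ηY) (F.map ηX) (zero_add 1) g = 0)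
    (hgf : ∃ h : A'.Hom _ _ (-1), A'.comp (add_zero 0) g (F.map f) =
      A'.one _ + A'.twistedD (F.map ηX) (F.map ηX) (by norm_num) h)
    (hfg : ∃ h : A'.Hom _ _ (-1), A'.comp (add_zero 0) (F.map f) g =
      A'.one _ + A'.twistedD (F.map ηY) (F.map ηY) (by norm_num) h) :
    Nonempty (F.ker.HtpyInv ηX ηY f) := by
  -- Arbitrary lifts of the inverse and of the homotopies suffice: each identity then holds up to an
  -- element of the kernel, and such an element composes to zero with the kernel.
  obtain ⟨g, rfl⟩ := hF _ _ _ g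
  obtain ⟨hX, hX'⟩ := hgf
  obtain ⟨hY, hY'⟩ := hfg
  obtain ⟨hX, rfl⟩ := hF _ _ _ hX
  obtain ⟨hY, rfl⟩ := hF _ _ _ hY
  rw [← F.map_twistedD] at hdf hdg hX' hY'
  rw [← F.map_comp, ← F.map_one, ← map_add] at hX' hY'
  have hX'' := sub_eq_zero.2 hX'
  have hY'' := sub_eq_zero.2 hY'
  rw [← map_sub] at hX'' hY''
  refine ⟨⟨g, hX, hY, fun e b hb => hker _ _ _ hb hdf, fun e b hb => hker _ _ _ hb hdg,
    fun e b hb => hker _ _ _ hdf hb, fun e b hb => hker _ _ _ hdg hb, ?_, ?_, ?_, ?_⟩⟩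
  · intro Z p e b hb
    have := hker e b _ hb hX''
    rw [map_sub, map_add, A.comp_one] at this
    exact sub_eq_zero.1 this
  · intro Z p e b hb
    have := hker e b _ hb hY''
    rw [map_sub, map_add, A.comp_one] at this
    exact sub_eq_zero.1 this
  · intro Z p e b hb
    have := hker e _ b hX'' hb
    rw [map_sub, map_add, LinearMap.sub_apply, LinearMap.add_apply, A.one_comp] at this
    exact sub_eq_zero.1 this
  · intro Z p e b hb
    have := hker e _ b hY'' hb
    rw [map_sub, map_add, LinearMap.sub_apply, LinearMap.add_apply, A.one_comp] at this
    exact sub_eq_zero.1 this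

/-- A homotopy inverse acts on every dg-ideal. -/
def DGIdeal.HtpyInv.mk' {A : DGCat R} (J : DGIdeal A) {X Y : A.Obj} {ηX : A.Hom X X 1}
    {ηY : A.Hom Y Y 1} {f : A.Hom X Y 0} {g : A.Hom Y X 0} {hX : A.Hom X X (-1)}
    {hY : A.Hom Y Y (-1)} (df : A.twistedD ηX ηY (zero_add 1) f = 0)
    (dg : A.twistedD ηY ηX (zero_add 1) g = 0)
    (hX' : A.comp (add_zero 0) g f = A.one X + A.twistedD ηX ηX (by norm_num) hX)
    (hY' : A.comp (add_zero 0) f g = A.one Y + A.twistedD ηY ηY (by norm_num) hY) :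
    J.HtpyInv ηX ηY f where
  g := g
  hX := hX
  hY := hY
  comp_df _ _ _ := by rw [df, map_zero]
  comp_dg _ _ _ := by rw [dg, map_zero]
  df_comp _ _ _ := by rw [df, map_zero, LinearMap.zero_apply]
  dg_comp _ _ _ := by rw [dg, map_zero, LinearMap.zero_apply]
  comp_gf _ _ _ := by rw [hX', map_add, A.comp_one]
  comp_fg _ _ _ := by rw [hY', map_add, A.comp_one]
  gf_comp _ _ _ := by rw [hX', map_add, LinearMap.add_apply, A.one_comp]
  fg_comp _ _ _ := by rw [hY', map_add, LinearMap.add_apply, A.one_comp]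

/-- An equivalence of `MC(A)` acts invertibly, up to homotopy, on every dg-ideal. -/
lemma IsEquivalence.nonempty_htpyInv {A : DGCat R} (J : DGIdeal A) {X Y : (DGCat.MC A).Obj}
    {f : (DGCat.MC A).Hom X Y 0} (hf : (DGCat.MC A).IsEquivalence f) :
    Nonempty (J.HtpyInv (X := X.1) (Y := Y.1) X.2.1 Y.2.1 f) := by
  obtain ⟨df, g, dg, ⟨hX, hX'⟩, ⟨hY, hY'⟩⟩ := hf
  exact ⟨.mk' J df dg hX' hY'⟩

end DGCat

end

noncomputable section

/-! ### Arrays indexed by finite sets -/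

namespace Finset

variable {ι : Type*} [LinearOrder ι]

/-- The elements of `S` above `p`. -/
def above (S : Finset ι) (p : ι) : Finset ι := S.filter (p < ·)

/-- The elements of `S` below `p`. -/
def below (S : Finset ι) (p : ι) : Finset ι := S.filter (· < p)

lemma mem_above {S : Finset ι} {p q : ι} : q ∈ S.above p ↔ q ∈ S ∧ p < q := by simp [above]

lemma mem_below {S : Finset ι} {p q : ι} : q ∈ S.below p ↔ q ∈ S ∧ q < p := by simp [below]

lemma card_above_add_card_below {S : Finset ι} {p : ι} (hp : p ∈ S) :
    (S.above p).card + (S.below p).card + 1 = S.card := by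
  have h : S = insert p (S.above p ∪ S.below p) := by
    ext x; simp only [mem_insert, mem_union, mem_above, mem_below]
    constructor
    · intro hx; rcases lt_trichotomy x p with h | h | h <;> simp [*]
    · rintro (rfl | h | h) <;> tauto
  have hd : Disjoint (S.above p) (S.below p) := by
    rw [disjoint_left]; intro x hx hx'
    exact lt_asymm (mem_above.1 hx).2 (mem_below.1 hx').2
  have hn : p ∉ S.above p ∪ S.below p := by simp [mem_above, mem_below]
  conv_rhs => rw [h]
  rw [card_insert_of_notMem hn, card_union_of_disjoint hd]

lemma above_above {S : Finset ι} {p q : ι} (h : p < q) : (S.above p).above q = S.above q := by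
  ext x; simp only [mem_above]
  exact ⟨fun h' => ⟨h'.1.1, h'.2⟩, fun h' => ⟨⟨h'.1, h.trans h'.2⟩, h'.2⟩⟩

lemma below_below {S : Finset ι} {p q : ι} (h : q < p) : (S.below p).below q = S.below q := by
  ext x; simp only [mem_below]
  exact ⟨fun h' => ⟨h'.1.1, h'.2⟩, fun h' => ⟨⟨h'.1, h'.2.trans h⟩, h'.2⟩⟩

lemma below_above_comm {S : Finset ι} {p q : ι} : (S.above p).below q = (S.below q).above p := by
  ext x; simp only [mem_above, mem_below]; tauto

lemma above_erase {S : Finset ι} {p q : ι} : (S.erase p).above q = (S.above q).erase p := by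
  ext x; simp only [mem_above, mem_erase]; tauto

lemma below_erase {S : Finset ι} {p q : ι} : (S.erase p).below q = (S.below q).erase p := by
  ext x; simp only [mem_below, mem_erase]; tauto

end Finset

namespace DGCat

variable {R : Type u} [CommRing R] (A : DGCat R)

/-- Composition, extended by `0` to all target degrees. -/
def tcomp {X Y Z : A.Obj} {i j : ℤ} (n : ℤ) : A.Hom Y Z i →ₗ[R] A.Hom X Y j →ₗ[R] A.Hom X Z n :=
  if h : i + j = n then A.comp h else 0

variable {A}

lemma tcomp_eq {X Y Z : A.Obj} {i j n : ℤ} (h : i + j = n) :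
    A.tcomp n (i := i) (j := j) (X := X) (Y := Y) (Z := Z) = A.comp h := by
  rw [tcomp, dif_pos h]

lemma tcomp_assoc {W X Y Z : A.Obj} {i j l ij jl n : ℤ} (h₁ : i + j = ij) (h₂ : ij + l = n)
    (h₃ : j + l = jl) (f : A.Hom Y Z i) (g : A.Hom X Y j) (e : A.Hom W X l) :
    A.tcomp n (A.tcomp ij f g) e = A.tcomp n f (A.tcomp jl g e) := by
  rw [tcomp_eq h₁, tcomp_eq h₂, tcomp_eq h₃, tcomp_eq (show i + jl = n by omega),
    A.assoc h₁ h₂ h₃ (by omega)]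

section FinArray

variable {ι : Type} [LinearOrder ι] (X : ι → A.Obj)

/-- Families of morphisms indexed by finite sets of intermediate indices. -/
abbrev FinArray : Type u :=
  ∀ (i : ι) (_ : Finset ι) (j : ι) (q : ℤ), A.Hom (X i) (X j) q

variable {X}

/-- The right hand side of the Maurer-Cartan equations of the coherent nerve. -/
def FinArray.rhs (b : FinArray X) (i : ι) (S : Finset ι) (j : ι) (q : ℤ) : A.Hom (X i) (X j) q :=
  ∑ p ∈ S, (-1 : ℤ) ^ (S.above p).card •
    (A.tcomp q (b p (S.above p) j (-((S.above p).card : ℤ)))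
      (b i (S.below p) p (-((S.below p).card : ℤ))) - b i (S.erase p) j q)

/-- This is the formal part of `d² = 0`: applying the Leibniz rule to the right hand side and
replacing every `d b` by `b.rhs` gives zero for an arbitrary array. Expanding produces, for each
pair `p < p'`, a triple composite, two composites with one vertex deleted, and a term with both
deleted; each occurs twice with opposite signs, from the two orders in which the vertices are
treated. The condition on `q` makes the degrees match, so that composition is associative. -/
lemma FinArray.rhs_rhs (b : FinArray X) (i : ι) (S : Finset ι) (j : ι) (q : ℤ)
    (hq : q + S.card = 2) :
    ∑ p ∈ S, (-1 : ℤ) ^ (S.above p).card •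
      (A.tcomp q (b.rhs p (S.above p) j (1 - ((S.above p).card : ℤ)))
          (b i (S.below p) p (-((S.below p).card : ℤ)))
        + (-1 : ℤ) ^ (S.above p).card • A.tcomp q (b p (S.above p) j (-((S.above p).card : ℤ)))
          (b.rhs i (S.below p) p (1 - ((S.below p).card : ℤ)))
        - b.rhs i (S.erase p) j q) = 0 := by
  set σ : ι → ℤ := fun p => (-1 : ℤ) ^ (S.above p).card with hσ
  -- the five kinds of terms, for a pair `p < p'`
  set t1 : ι → ι → A.Hom (X i) (X j) q := fun p p' =>
    A.tcomp q (A.tcomp (1 - ((S.above p).card : ℤ))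
      (b p' (S.above p') j (-((S.above p').card : ℤ)))
      (b p ((S.above p).below p') p' (-(((S.above p).below p').card : ℤ))))
      (b i (S.below p) p (-((S.below p).card : ℤ)))
  set t2 : ι → ι → A.Hom (X i) (X j) q := fun p p' =>
    A.tcomp q (b p ((S.above p).erase p') j (1 - ((S.above p).card : ℤ)))
      (b i (S.below p) p (-((S.below p).card : ℤ)))
  set t3 : ι → ι → A.Hom (X i) (X j) q := fun p p' =>
    A.tcomp q (b p' (S.above p') j (-((S.above p').card : ℤ)))
      (b i ((S.below p').erase p) p' (1 - ((S.below p').card : ℤ)))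
  set t4 : ι → ι → A.Hom (X i) (X j) q := fun p p' => b i ((S.erase p).erase p') j q
  have cards : ∀ p p', p ∈ S → p' ∈ S → p < p' →
      ((S.above p).below p').card + (S.above p').card + 1 = (S.above p).card ∧
      ((S.above p).below p').card + (S.below p).card + 1 = (S.below p').card := by
    intro p p' hp hp' h
    have h1 := Finset.card_above_add_card_below (Finset.mem_above.2 ⟨hp', h⟩)
    have h2 := Finset.card_above_add_card_below (Finset.mem_below.2 ⟨hp, h⟩)
    rw [Finset.above_above h] at h1
    rw [Finset.below_below h, ← Finset.below_above_comm] at h2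
    omega
  have cardt : ∀ p, p ∈ S → ((S.above p).card : ℤ) + (S.below p).card + 1 = S.card := by
    intro p hp; exact_mod_cast Finset.card_above_add_card_below hp
  have e1 : ∀ p ∈ S, A.tcomp q (b.rhs p (S.above p) j (1 - ((S.above p).card : ℤ)))
      (b i (S.below p) p (-((S.below p).card : ℤ))) =
      ∑ p' ∈ S, if p < p' then σ p' • (t1 p p' - t2 p p') else 0 := by
    intro p hp
    rw [FinArray.rhs, map_sum, LinearMap.sum_apply, ← Finset.sum_filter]
    refine Finset.sum_congr rfl fun p' hp' => ?_
    have h := (Finset.mem_above.1 hp').2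
    rw [Finset.above_above h, map_zsmul, LinearMap.smul_apply, map_sub, LinearMap.sub_apply]
  have e2 : ∀ p ∈ S, σ p • A.tcomp q (b p (S.above p) j (-((S.above p).card : ℤ)))
      (b.rhs i (S.below p) p (1 - ((S.below p).card : ℤ))) =
      ∑ p' ∈ S, if p' < p then -(σ p' • (t1 p' p - t3 p' p)) else 0 := by
    intro p hp
    rw [FinArray.rhs, map_sum, ← Finset.sum_filter, Finset.smul_sum]
    refine Finset.sum_congr rfl fun p' hp' => ?_
    have h := (Finset.mem_below.1 hp').2
    have hp'S := (Finset.mem_below.1 hp').1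
    have c := cards p' p hp'S hp h
    have ct := cardt p hp
    have ct' := cardt p' hp'S
    rw [Finset.below_below h, ← Finset.below_above_comm, map_zsmul, map_sub, smul_smul]
    -- The elements above `p'` are those strictly between `p'` and `p`, then `p` itself, then those
    -- above `p`; the vertex `p` accounts for the change of sign.
    have hs : σ p * (-1) ^ ((S.above p').below p).card = -σ p' := by
      have : σ p' = (-1) ^ ((S.above p').below p).card * σ p * (-1) := by
        simp only [hσ, ← pow_add, ← pow_succ, c.1]
      rw [this]; ring
    rw [hs, neg_smul, ← tcomp_assoc (ij := 1 - ((S.above p').card : ℤ)) (by omega) (by omega)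
      (by omega)]
  have e3 : ∀ p ∈ S, b.rhs i (S.erase p) j q =
      ∑ p' ∈ S, ((if p < p' then σ p' • (t3 p p' - t4 p p') else 0) +
        (if p' < p then -(σ p' • (t2 p' p - t4 p p')) else 0)) := by
    intro p hp
    rw [FinArray.rhs, ← Finset.filter_ne' S p, Finset.sum_filter]
    refine Finset.sum_congr rfl fun p' hp' => ?_
    rw [Finset.filter_ne']
    have cp' := Finset.card_above_add_card_below hp'
    have ct' := cardt p' hp'
    rcases lt_trichotomy p p' with h | rfl | h
    · have h1 : (S.erase p).above p' = S.above p' := by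
        rw [Finset.above_erase, Finset.erase_eq_of_notMem]
        simp [Finset.mem_above, h.le]
      have hm : p ∈ S.below p' := Finset.mem_below.2 ⟨hp, h⟩
      rw [if_pos h.ne', if_pos h, if_neg h.asymm, add_zero, h1, Finset.below_erase,
        Finset.card_erase_of_mem hm]
      have : (((S.below p').card - 1 : ℕ) : ℤ) = (S.below p').card - 1 := by
        have := Finset.card_pos.2 ⟨p, hm⟩; omega
      rw [this, neg_sub]
    · simp
    · have h1 : (S.erase p).below p' = S.below p' := by
        rw [Finset.below_erase, Finset.erase_eq_of_notMem]
        simp [Finset.mem_below, h.le]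
      have hm : p ∈ S.above p' := Finset.mem_above.2 ⟨hp, h⟩
      have hc := Finset.card_pos.2 ⟨p, hm⟩
      have h2 : (((S.above p').card - 1 : ℕ) : ℤ) = (S.above p').card - 1 := by omega
      have hs : (-1 : ℤ) ^ ((S.above p').card - 1) = -σ p' := by
        have : σ p' = (-1) ^ ((S.above p').card - 1) * (-1) := by
          simp only [hσ]; rw [← pow_succ]; congr 1; omega
        rw [this]; ring
      rw [if_pos h.ne, if_neg h.asymm, if_pos h, zero_add, h1, Finset.above_erase,
        Finset.card_erase_of_mem hm, hs, neg_smul, h2, neg_sub]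
  have e4 : ∀ p p', t4 p p' = t4 p' p := fun p p' => by
    simp only [t4, Finset.erase_right_comm]
  calc _ = ∑ p ∈ S, ∑ p' ∈ S, ((if p < p' then (σ p * σ p') • (t1 p p' - t2 p p') else 0)
        + (if p' < p then -((σ p * σ p') • (t1 p' p - t3 p' p)) else 0)
        - ((if p < p' then (σ p * σ p') • (t3 p p' - t4 p p') else 0) +
          (if p' < p then -((σ p * σ p') • (t2 p' p - t4 p' p)) else 0))) := by
        refine Finset.sum_congr rfl fun p hp => ?_
        rw [e1 p hp, e2 p hp, e3 p hp, ← Finset.sum_add_distrib, ← Finset.sum_sub_distrib,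
          Finset.smul_sum]
        refine Finset.sum_congr rfl fun p' _ => ?_
        change σ p • _ = _
        rw [e4 p p']
        rcases lt_trichotomy p p' with h | rfl | h
        · simp only [if_pos h, if_neg h.asymm, add_zero, mul_smul, smul_sub]
        · simp
        · simp only [if_pos h, if_neg h.asymm, zero_add, mul_smul, smul_sub, smul_neg]
    _ = ∑ p ∈ S, ∑ p' ∈ S, ((if p < p' then (σ p * σ p') • (t1 p p' - t2 p p') else 0)
        - (if p < p' then (σ p * σ p') • (t3 p p' - t4 p p') else 0))
        + ∑ p ∈ S, ∑ p' ∈ S, ((if p' < p then -((σ p * σ p') • (t1 p' p - t3 p' p)) else 0)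
        - (if p' < p then -((σ p * σ p') • (t2 p' p - t4 p' p)) else 0)) := by
        simp only [← Finset.sum_add_distrib]
        refine Finset.sum_congr rfl fun p _ => Finset.sum_congr rfl fun p' _ => ?_
        abel
    _ = 0 := by
        -- Exchanging the roles of `p` and `p'` in the second double sum, the two sums cancel term
        -- by term.
        rw [Finset.sum_comm (f := fun p p' => ((if p' < p then -((σ p * σ p') • (t1 p' p - t3 p' p)) else 0)
        - (if p' < p then -((σ p * σ p') • (t2 p' p - t4 p' p)) else 0)))]
        simp only [← Finset.sum_add_distrib]
        refine Finset.sum_eq_zero fun p _ => Finset.sum_eq_zero fun p' _ => ?_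
        by_cases h : p < p'
        · simp only [if_pos h, mul_comm (σ p') (σ p), smul_sub]; abel
        · simp [if_neg h]

end FinArray

end DGCat

end

/-! ### The Bianchi identity and the correction of the two unknown values of a horn -/

noncomputable section

namespace DGCat

variable {R : Type u} [CommRing R] {A : DGCat R}

lemma d_tcomp {X Y Z : A.Obj} {i j n i' j' n' : ℤ} (h : i + j = n) (hn : n + 1 = n')
    (hi : i + 1 = i') (hj : j + 1 = j') (f : A.Hom Y Z i) (g : A.Hom X Y j) :
    A.d hn (A.tcomp n f g) = A.tcomp n' (A.d hi f) g + i.negOnePow • A.tcomp n' f (A.d hj g) := by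
  rw [tcomp_eq h, tcomp_eq (show i' + j = n' by omega), tcomp_eq (show i + j' = n' by omega),
    A.d_comp]

lemma negOnePow_neg_natCast_smul {M : Type*} [AddCommGroup M] (n : ℕ) (x : M) :
    (-(n : ℤ)).negOnePow • x = (-1 : ℤ) ^ n • x := by
  rw [Int.negOnePow_neg, Int.negOnePow_def, zpow_natCast, Units.smul_def]
  simp

lemma neg_one_pow_smul_smul {M : Type*} [AddCommGroup M] (n : ℕ) (x : M) :
    (-1 : ℤ) ^ n • (-1 : ℤ) ^ n • x = x := by
  rw [smul_smul, ← pow_add, ← two_mul, pow_mul]; norm_num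

section FinArray

variable {ι : Type} [LinearOrder ι] {X : ι → A.Obj}

/-- The failure of the Maurer-Cartan equation. -/
def FinArray.defect (b : FinArray X) (i : ι) (S : Finset ι) (j : ι) {q q' : ℤ} (h : q + 1 = q') :
    A.Hom (X i) (X j) q' :=
  A.d h (b i S j q) - b.rhs i S j q'

/-- The Bianchi identity. -/
lemma FinArray.d_rhs (b : FinArray X) (i : ι) (S : Finset ι) (j : ι) {q q' : ℤ}
    (hq : q + S.card = 1) (h : q + 1 = q') :
    A.d h (b.rhs i S j q) = ∑ p ∈ S, (-1 : ℤ) ^ (S.above p).card •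
      (A.tcomp q' (b.defect p (S.above p) j
          (show -((S.above p).card : ℤ) + 1 = 1 - ((S.above p).card : ℤ) by omega))
          (b i (S.below p) p (-((S.below p).card : ℤ)))
        + (-1 : ℤ) ^ (S.above p).card • A.tcomp q' (b p (S.above p) j (-((S.above p).card : ℤ)))
          (b.defect i (S.below p) p
            (show -((S.below p).card : ℤ) + 1 = 1 - ((S.below p).card : ℤ) by omega))
        - b.defect i (S.erase p) j h) := by
  -- Subtracting the vanishing expression of `rhs_rhs` turns every `d b` of the Leibniz expansion
  -- into `d b - b.rhs`, that is, into a defect.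
  rw [← sub_zero (A.d h _), ← b.rhs_rhs i S j q' (by omega)]
  rw [FinArray.rhs, map_sum, ← Finset.sum_sub_distrib]
  refine Finset.sum_congr rfl fun p hp => ?_
  have hc := Finset.card_above_add_card_below hp
  rw [map_zsmul, ← smul_sub, map_sub, d_tcomp (by omega) h (i' := 1 - ((S.above p).card : ℤ))
    (j' := 1 - ((S.below p).card : ℤ)) (by omega) (by omega), negOnePow_neg_natCast_smul]
  simp only [FinArray.defect, map_sub, LinearMap.sub_apply, smul_sub, smul_add]
  abel

/-- The Maurer-Cartan equation in one place. -/
def FinArray.IsMC (b : FinArray X) (i : ι) (S : Finset ι) (j : ι) : Prop :=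
  ∀ ⦃q q' : ℤ⦄ (h : q + 1 = q'), q + S.card = 0 → b.defect i S j h = 0

/-- Change of a value. -/
def FinArray.update (b : FinArray X) (i₀ : ι) (S₀ : Finset ι) (j₀ : ι) (q₀ : ℤ)
    (u : A.Hom (X i₀) (X j₀) q₀) : FinArray X := fun i S j q =>
  Function.update (β := fun t : ι × Finset ι × ι × ℤ => A.Hom (X t.1) (X t.2.2.1) t.2.2.2)
    (fun t => b t.1 t.2.1 t.2.2.1 t.2.2.2) (i₀, S₀, j₀, q₀) u (i, S, j, q)

lemma FinArray.update_self (b : FinArray X) (i₀ : ι) (S₀ : Finset ι) (j₀ : ι) (q₀ : ℤ)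
    (u : A.Hom (X i₀) (X j₀) q₀) : b.update i₀ S₀ j₀ q₀ u i₀ S₀ j₀ q₀ = u :=
  Function.update_self ..

lemma FinArray.update_of_ne (b : FinArray X) {i₀ : ι} {S₀ : Finset ι} {j₀ : ι} {q₀ : ℤ}
    (u : A.Hom (X i₀) (X j₀) q₀) {i : ι} {S : Finset ι} {j : ι} (q : ℤ)
    (h : ¬ (i = i₀ ∧ S = S₀ ∧ j = j₀)) : b.update i₀ S₀ j₀ q₀ u i S j q = b i S j q :=
  Function.update_of_ne (fun e => h (by simp only [Prod.mk.injEq] at e; tauto)) ..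

lemma FinArray.rhs_congr {b b' : FinArray X} {i : ι} {S : Finset ι} {j : ι} (q : ℤ)
    (h₁ : ∀ p ∈ S, ∀ q, b p (S.above p) j q = b' p (S.above p) j q)
    (h₂ : ∀ p ∈ S, ∀ q, b i (S.below p) p q = b' i (S.below p) p q)
    (h₃ : ∀ p ∈ S, ∀ q, b i (S.erase p) j q = b' i (S.erase p) j q) :
    b.rhs i S j q = b'.rhs i S j q :=
  Finset.sum_congr rfl fun p hp => by rw [h₁ p hp, h₂ p hp, h₃ p hp]

/-- Exactness of the cone of `f^* : Hom(Y, Z) → Hom(X, Z)` on a dg-ideal. -/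
def DGIdeal.ExactPre (J : DGIdeal A) {X Y : A.Obj} (f : A.Hom X Y 0) (Z : A.Obj) : Prop :=
  ∀ ⦃r p q : ℤ⦄ (hr : r + 1 = p) (hp : p + 1 = q) (b : A.Hom Y Z q) (a : A.Hom X Z p),
    b ∈ J.mem Y Z q → a ∈ J.mem X Z p → A.d rfl b = 0 → A.d hp a = A.comp (add_zero q) b f →
    ∃ v ∈ J.mem Y Z p, ∃ u ∈ J.mem X Z r, A.d hp v = b ∧
      a = A.comp (add_zero p) v f + A.d hr u

/-- Exactness of the cone of `f_* : Hom(Z, X) → Hom(Z, Y)` on a dg-ideal. -/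
def DGIdeal.ExactPost (J : DGIdeal A) {X Y : A.Obj} (f : A.Hom X Y 0) (Z : A.Obj) : Prop :=
  ∀ ⦃r p q : ℤ⦄ (hr : r + 1 = p) (hp : p + 1 = q) (b : A.Hom Z X q) (a : A.Hom Z Y p),
    b ∈ J.mem Z X q → a ∈ J.mem Z Y p → A.d rfl b = 0 → A.d hp a = A.comp (zero_add q) f b →
    ∃ v ∈ J.mem Z X p, ∃ u ∈ J.mem Z Y r, A.d hp v = b ∧
      a = A.comp (zero_add p) f v + A.d hr u

end FinArray

section Filling

variable {n : ℕ} {X : Fin (n + 3) → A.Obj}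

/-- The places lying in the horn `Λ^l`. -/
def InHorn (l i : Fin (n + 3)) (S : Finset (Fin (n + 3))) (j : Fin (n + 3)) : Prop :=
  ∃ p, p ≠ l ∧ p ≠ i ∧ p ≠ j ∧ p ∉ S

lemma InHorn.mono {l i j i' j' : Fin (n + 3)} {S S' : Finset (Fin (n + 3))} (h : InHorn l i S j)
    (hi : i' = i ∨ i' = j ∨ i' ∈ S) (hj : j' = i ∨ j' = j ∨ j' ∈ S) (hS : S' ⊆ S) :
    InHorn l i' S' j' := by
  obtain ⟨p, h1, h2, h3, h4⟩ := h
  refine ⟨p, h1, ?_, ?_, fun h => h4 (hS h)⟩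
  · rintro rfl; tauto
  · rintro rfl; tauto

lemma below_subset {ι : Type*} [LinearOrder ι] (S : Finset ι) (p : ι) : S.below p ⊆ S :=
  Finset.filter_subset _ _

lemma above_subset {ι : Type*} [LinearOrder ι] (S : Finset ι) (p : ι) : S.above p ⊆ S :=
  Finset.filter_subset _ _

lemma above_subset_Ioo {i j p : Fin (n + 3)} {S : Finset (Fin (n + 3))} (hS : S ⊆ Finset.Ioo i j) :
    S.above p ⊆ Finset.Ioo p j := fun x hx => by
  have h := Finset.mem_above.1 hx
  exact Finset.mem_Ioo.2 ⟨h.2, (Finset.mem_Ioo.1 (hS h.1)).2⟩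

lemma below_subset_Ioo {i j p : Fin (n + 3)} {S : Finset (Fin (n + 3))} (hS : S ⊆ Finset.Ioo i j) :
    S.below p ⊆ Finset.Ioo i p := fun x hx => by
  have h := Finset.mem_below.1 hx
  exact Finset.mem_Ioo.2 ⟨(Finset.mem_Ioo.1 (hS h.1)).1, h.2⟩

/-- The Maurer-Cartan equations at all places of a horn. -/
def FinArray.IsMCOnHorn (b : FinArray X) (l : Fin (n + 3)) : Prop :=
  ∀ i S j, i < j → S ⊆ Finset.Ioo i j → InHorn l i S j → b.IsMC i S j

/-- If the defects vanish at all smaller places, the right hand side is closed. -/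
lemma FinArray.d_rhs_eq_zero {b : FinArray X} {l : Fin (n + 3)} (hb : b.IsMCOnHorn l)
    {i j : Fin (n + 3)} {S : Finset (Fin (n + 3))} (hij : i < j) (hS : S ⊆ Finset.Ioo i j)
    (h : ∀ p ∈ S, InHorn l p (S.above p) j ∧ InHorn l i (S.below p) p ∧ InHorn l i (S.erase p) j)
    {q q' : ℤ} (hq : q + S.card = 1) (hqq' : q + 1 = q') : A.d hqq' (b.rhs i S j q) = 0 := by
  rw [b.d_rhs i S j hq hqq']
  refine Finset.sum_eq_zero fun p hp => ?_
  have hp' := Finset.mem_Ioo.1 (hS hp)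
  rw [hb p _ j hp'.2 (above_subset_Ioo hS) (h p hp).1 _ (by omega),
    hb i _ p hp'.1 (below_subset_Ioo hS) (h p hp).2.1 _ (by omega),
    hb i _ j hij ((Finset.erase_subset _ _).trans hS) (h p hp).2.2 _ (by
      rw [Finset.card_erase_of_mem hp]; have := Finset.card_pos.2 ⟨p, hp⟩; omega)]
  simp

/-- The unknown values at the missing face and at the top place can be corrected as soon as the
two corresponding equations can be solved. -/
lemma FinArray.exists_fill_of_solution (J : DGIdeal A) {b : FinArray X} {l : Fin (n + 3)}
    (hb : b.IsMCOnHorn l) {T : Finset (Fin (n + 3))} (hT : T = Finset.Ioo 0 (Fin.last _)) {i₁ j₁ : Fin (n + 3)} {S₁ : Finset (Fin (n + 3))}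
    (h₁ : S₁ ⊆ Finset.Ioo i₁ j₁) (hn₁ : ¬ InHorn l i₁ S₁ j₁)
    (hsub : ∀ p ∈ S₁, InHorn l p (S₁.above p) j₁ ∧ InHorn l i₁ (S₁.below p) p ∧
      InHorn l i₁ (S₁.erase p) j₁)
    (hcov : ∀ i S j, i < j → S ⊆ Finset.Ioo i j → InHorn l i S j ∨
      (i = i₁ ∧ S = S₁ ∧ j = j₁) ∨ (i = 0 ∧ S = T ∧ j = Fin.last _))
    (hne : ¬ (i₁ = 0 ∧ S₁ = T ∧ j₁ = Fin.last (n + 2)))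
    {v : A.Hom (X i₁) (X j₁) (-(S₁.card : ℤ))} (hv : v ∈ J.mem _ _ _)
    {u : A.Hom (X 0) (X (Fin.last _)) (-(T.card : ℤ))}
    (hu : u ∈ J.mem _ _ _)
    (ev : A.d rfl (b i₁ S₁ j₁ (-(S₁.card : ℤ)) + v) = b.rhs i₁ S₁ j₁ _)
    (eu : ∀ ⦃q' : ℤ⦄ (h : -(T.card : ℤ) + 1 = q'),
      A.d h (b 0 T (Fin.last _) (-(T.card : ℤ)) + u) =
        (b.update i₁ S₁ j₁ _ (b i₁ S₁ j₁ _ + v)).rhs 0 T (Fin.last _) q') :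
    ∃ b' : FinArray X, (∀ i S j q, b' i S j q - b i S j q ∈ J.mem _ _ _) ∧
      (∀ i S j q, InHorn l i S j → b' i S j q = b i S j q) ∧
      ∀ i S j, i < j → S ⊆ Finset.Ioo i j → b'.IsMC i S j := by
  have hnT : ¬ InHorn l 0 T (Fin.last _) := by
    rintro ⟨p, -, h0, hl, hpT⟩
    exact hpT (hT ▸ Finset.mem_Ioo.2 ⟨Fin.pos_iff_ne_zero.2 h0, Fin.lt_last_iff_ne_last.2 hl⟩)
  -- The missing face is changed first and the top place second. Neither lies in the horn, so the
  -- values and the equations of the horn are unaffected.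
  set b₁ := b.update i₁ S₁ j₁ _ (b i₁ S₁ j₁ (-(S₁.card : ℤ)) + v) with hb₁
  set b₂ := b₁.update 0 T (Fin.last _) _ (b 0 T (Fin.last _) (-(T.card : ℤ)) + u) with hb₂
  have e1 : ∀ i S j q, ¬ (i = 0 ∧ S = T ∧ j = Fin.last _) → b₂ i S j q = b₁ i S j q :=
    fun i S j q h => b₁.update_of_ne _ q h
  have e2 : ∀ i S j q, InHorn l i S j → b₂ i S j q = b i S j q := fun i S j q h => by
    rw [e1, hb₁, b.update_of_ne _ q]
    · rintro ⟨rfl, rfl, rfl⟩; exact hn₁ h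
    · rintro ⟨rfl, rfl, rfl⟩; exact hnT h
  refine ⟨b₂, ?_, e2, ?_⟩
  · intro i S j q
    by_cases h : i = 0 ∧ S = T ∧ j = Fin.last _
    · obtain ⟨rfl, rfl, rfl⟩ := h
      -- An array has values in every degree at each place; only the one in the relevant degree
      -- `-|S|` is altered.
      by_cases hq : q = -(S.card : ℤ)
      · subst hq
        rw [hb₂, FinArray.update_self, add_sub_cancel_left]; exact hu
      · have : b₂ 0 S (Fin.last _) q = b₁ 0 S (Fin.last _) q :=
          Function.update_of_ne (by simpa using hq) ..
        rw [this, hb₁, b.update_of_ne _ q fun h => hne ⟨h.1.symm, h.2.1.symm, h.2.2.symm⟩,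
          sub_self]
        exact zero_mem _
    · rw [e1 _ _ _ _ h]
      by_cases h' : i = i₁ ∧ S = S₁ ∧ j = j₁
      · obtain ⟨rfl, rfl, rfl⟩ := h'
        by_cases hq : q = -(S.card : ℤ)
        · subst hq
          rw [hb₁, FinArray.update_self, add_sub_cancel_left]; exact hv
        · have : b₁ i S j q = b i S j q := Function.update_of_ne (by simpa using hq) ..
          rw [this, sub_self]
          exact zero_mem _
      · rw [hb₁, b.update_of_ne _ q h', sub_self]; exact zero_mem _
  · intro i S j hij hS q q' hqq' hq
    obtain rfl : q = -(S.card : ℤ) := by omega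
    obtain rfl : q' = -(S.card : ℤ) + 1 := hqq'.symm
    rw [FinArray.defect]
    rcases hcov i S j hij hS with h | ⟨rfl, rfl, rfl⟩ | ⟨rfl, rfl, rfl⟩
    · have hh := hb i S j hij hS h hqq' hq
      rw [FinArray.defect] at hh
      rw [e2 i S j _ h, ← hh]
      congr 1
      refine FinArray.rhs_congr _ ?_ ?_ ?_
      · exact fun p hp q => e2 _ _ _ _ (h.mono (by tauto) (by tauto) (above_subset _ _))
      · exact fun p hp q => e2 _ _ _ _ (h.mono (by tauto) (by tauto) (below_subset _ _))
      · exact fun p hp q => e2 _ _ _ _ (h.mono (by tauto) (by tauto) (Finset.erase_subset _ _))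
    -- The right hand side at the missing face involves only places of the horn. In the remaining
    -- case, the one at the top involves every place but the top itself, so it sees `b₁`.
    · rw [e1 _ _ _ _ hne, hb₁, FinArray.update_self, ev, sub_eq_zero]
      exact (FinArray.rhs_congr _ (fun p hp q => e2 _ _ _ _ (hsub p hp).1)
        (fun p hp q => e2 _ _ _ _ (hsub p hp).2.1)
        (fun p hp q => e2 _ _ _ _ (hsub p hp).2.2)).symm
    · rw [show b₂ 0 S (Fin.last _) (-(S.card : ℤ)) = _ from FinArray.update_self .., eu, sub_eq_zero]
      refine (FinArray.rhs_congr _ ?_ ?_ ?_).symm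
      · intro p hp q
        refine e1 _ _ _ _ fun h => ?_
        exact (Finset.mem_Ioo.1 (hT ▸ hp)).1.ne' h.1
      · intro p hp q
        refine e1 _ _ _ _ fun h => ?_
        exact (Finset.mem_Ioo.1 (hT ▸ hp)).2.ne h.2.2
      · intro p hp q
        refine e1 _ _ _ _ fun h => ?_
        exact Finset.notMem_erase p S (by rw [h.2.1]; exact hp)

end Filling

end DGCat

end

/-! ### Filling of inner and outer horns relative to a dg-ideal -/

noncomputable section

namespace DGCat

variable {R : Type u} [CommRing R] {A : DGCat R} {n : ℕ} {X : Fin (n + 3) → A.Obj}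

lemma mem_of_not_inHorn {l i j p : Fin (n + 3)} {S : Finset (Fin (n + 3))} (h : ¬ InHorn l i S j)
    (hp : p ∈ Finset.Ioo i j) (hpl : p ≠ l) : p ∈ S := by
  by_contra hpS
  have := Finset.mem_Ioo.1 hp
  exact h ⟨p, hpl, this.1.ne', this.2.ne, hpS⟩

lemma eq_last_of_not_inHorn {l i j : Fin (n + 3)} {S : Finset (Fin (n + 3))}
    (h : ¬ InHorn l i S j) (hij : i < j) (hS : S ⊆ Finset.Ioo i j) (hl : l ≠ Fin.last _) :
    j = Fin.last _ := by
  by_contra hj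
  refine h ⟨Fin.last _, hl.symm, (hij.trans_le (Fin.le_last j)).ne', Ne.symm hj, fun hS' => ?_⟩
  exact ((Finset.mem_Ioo.1 (hS hS')).2.trans_le (Fin.le_last j)).false

lemma eq_zero_of_not_inHorn {l i j : Fin (n + 3)} {S : Finset (Fin (n + 3))}
    (h : ¬ InHorn l i S j) (hij : i < j) (hS : S ⊆ Finset.Ioo i j) (hl : l ≠ 0) :
    i = 0 := by
  by_contra hj
  refine h ⟨0, hl.symm, Ne.symm hj, ((Fin.zero_le i).trans_lt hij).ne, fun hS' => ?_⟩
  exact ((Fin.zero_le i).trans_lt (Finset.mem_Ioo.1 (hS hS')).1).false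

/-- Filling of inner horns, relative to a dg-ideal. -/
lemma FinArray.exists_fill_inner (J : DGIdeal A) {b : FinArray X} {l : Fin (n + 3)}
    (hl0 : l ≠ 0) (hll : l ≠ Fin.last _) (hb : b.IsMCOnHorn l)
    (hdef : ∀ i S j, i < j → S ⊆ Finset.Ioo i j → ∀ ⦃q q' : ℤ⦄ (h : q + 1 = q'),
      q + S.card = 0 → b.defect i S j h ∈ J.mem _ _ _) :
    ∃ b' : FinArray X, (∀ i S j q, b' i S j q - b i S j q ∈ J.mem _ _ _) ∧
      (∀ i S j q, InHorn l i S j → b' i S j q = b i S j q) ∧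
      ∀ i S j, i < j → S ⊆ Finset.Ioo i j → b'.IsMC i S j := by
  obtain ⟨T, hT⟩ : ∃ T, T = Finset.Ioo 0 (Fin.last (n + 2)) := ⟨_, rfl⟩
  have mT : ∀ p, p ∈ T ↔ p ≠ 0 ∧ p ≠ Fin.last _ := fun p => by
    rw [hT, Finset.mem_Ioo, Fin.pos_iff_ne_zero, Fin.lt_last_iff_ne_last]
  have h0l : (0 : Fin (n + 3)) < Fin.last _ := Fin.last_pos
  have hlT : l ∈ T := (mT l).2 ⟨hl0, hll⟩
  have hcard : (((T.erase l).card : ℕ) : ℤ) = T.card - 1 := by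
    rw [Finset.card_erase_of_mem hlT]
    have := Finset.card_pos.2 ⟨l, hlT⟩
    omega
  set ε : ℤ := (-1 : ℤ) ^ (T.above l).card with hε
  set q₁ : ℤ := -((T.erase l).card : ℤ) with hq₁
  have hq : -(T.card : ℤ) + 1 = q₁ := by omega
  -- vanishing of the defects at the places of the horn
  have hT1 : ∀ p ∈ T, InHorn l p (T.above p) (Fin.last _) := fun p hp =>
    ⟨0, hl0.symm, ((mT p).1 hp).1.symm, h0l.ne, fun h => by simp [mT, Finset.mem_above] at h⟩
  have hT2 : ∀ p ∈ T, InHorn l 0 (T.below p) p := fun p hp =>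
    ⟨Fin.last _, hll.symm, h0l.ne', ((mT p).1 hp).2.symm, fun h => by
      simp [mT, Finset.mem_below] at h⟩
  have hT3 : ∀ p ∈ T, p ≠ l → InHorn l 0 (T.erase p) (Fin.last _) := fun p hp hpl =>
    ⟨p, hpl, ((mT p).1 hp).1, ((mT p).1 hp).2, Finset.notMem_erase _ _⟩
  -- In the Bianchi identity at the top place the only defect not on the horn is that of the face
  -- opposite to `l`, which comes from deleting `l`.
  have hrhs : A.d rfl (b.rhs 0 T (Fin.last _) q₁) =
      -(ε • b.defect 0 (T.erase l) (Fin.last _) (q := q₁) rfl) := by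
    rw [b.d_rhs 0 T _ (by omega) rfl, Finset.sum_eq_single_of_mem l hlT]
    · rw [hb l _ _ (Fin.lt_last_iff_ne_last.2 hll) (above_subset_Ioo hT.subset) (hT1 l hlT) _
          (by omega), hb 0 _ l (Fin.pos_iff_ne_zero.2 hl0) (below_subset_Ioo hT.subset) (hT2 l hlT)
          _ (by omega)]
      simp [hε]
    · intro p hp hpl
      have hp' := (mT p).1 hp
      rw [hb p _ _ (Fin.lt_last_iff_ne_last.2 hp'.2) (above_subset_Ioo hT.subset) (hT1 p hp) _
          (by omega), hb 0 _ p (Fin.pos_iff_ne_zero.2 hp'.1) (below_subset_Ioo hT.subset)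
          (hT2 p hp) _ (by omega), hb 0 _ _ h0l ((Finset.erase_subset _ _).trans hT.subset)
          (hT3 p hp hpl) _ (by
            rw [Finset.card_erase_of_mem hp]; have := Finset.card_pos.2 ⟨p, hp⟩; omega)]
      simp
  -- The missing face occurs in the top equation with coefficient `-ε`. Adding `v = -ε·defect` to it
  -- changes the right hand side by exactly the top defect, so the top value may be kept.
  refine FinArray.exists_fill_of_solution J hb hT (i₁ := 0) (j₁ := Fin.last _)
    (S₁ := T.erase l) ((Finset.erase_subset _ _).trans hT.subset) ?_ ?_ ?_ ?_
    (v := -(ε • b.defect 0 T (Fin.last _) hq)) ?_ (u := 0) (zero_mem _) ?_ ?_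
  · rintro ⟨p, hpl, h0, hl, h⟩
    exact h (Finset.mem_erase.2 ⟨hpl, (mT p).2 ⟨h0, hl⟩⟩)
  · intro p hp
    have hp' := Finset.mem_erase.1 hp
    refine ⟨(hT1 p hp'.2).mono (by tauto) (by tauto) ?_, (hT2 p hp'.2).mono (by tauto) (by tauto) ?_,
      (hT3 p hp'.2 hp'.1).mono (by tauto) (by tauto) ?_⟩
    · rw [Finset.above_erase]; exact Finset.erase_subset _ _
    · rw [Finset.below_erase]; exact Finset.erase_subset _ _
    · exact Finset.erase_subset_erase _ (Finset.erase_subset _ _)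
  · intro i S j hij hS
    by_cases h : InHorn l i S j
    · exact Or.inl h
    · have hj := eq_last_of_not_inHorn h hij hS hll
      have hi := eq_zero_of_not_inHorn h hij hS hl0
      subst hi hj
      right
      by_cases hlS : l ∈ S
      · refine Or.inr ⟨rfl, Finset.Subset.antisymm (hT ▸ hS) fun p hp => ?_, rfl⟩
        by_cases hpl : p = l
        · exact hpl ▸ hlS
        · exact mem_of_not_inHorn h (hT ▸ hp) hpl
      · refine Or.inl ⟨rfl, Finset.Subset.antisymm (fun p hp => ?_) fun p hp => ?_, rfl⟩
        · exact Finset.mem_erase.2 ⟨fun e => hlS (e ▸ hp), hT ▸ hS hp⟩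
        · have := Finset.mem_erase.1 hp
          exact mem_of_not_inHorn h (hT ▸ this.2) this.1
  · rintro ⟨-, h, -⟩
    exact Finset.notMem_erase l T (by rw [h]; exact hlT)
  · exact neg_mem (zsmul_mem (hdef 0 T _ h0l hT.subset hq (by omega)) _)
  -- The equation at the missing face comes for free: by `hrhs` the differential of the top defect
  -- is `ε` times the defect of the face.
  · have e : A.d rfl (b.defect 0 T (Fin.last _) hq) =
        ε • b.defect 0 (T.erase l) (Fin.last _) (q := q₁) rfl := by
      rw [FinArray.defect, map_sub, A.d_d, hrhs, zero_sub, neg_neg]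
    rw [map_add, map_neg, map_zsmul, e, hε, neg_one_pow_smul_smul, FinArray.defect]
    abel
  · intro q' h
    obtain rfl : q' = q₁ := h.symm.trans hq
    rw [add_zero]
    have e : (b.update 0 (T.erase l) (Fin.last _) q₁ (b 0 (T.erase l) (Fin.last _) q₁ +
        -(ε • b.defect 0 T (Fin.last _) hq))).rhs 0 T (Fin.last _) q₁ - b.rhs 0 T (Fin.last _) q₁ =
        b.defect 0 T (Fin.last _) hq := by
      rw [FinArray.rhs, FinArray.rhs, ← Finset.sum_sub_distrib, Finset.sum_eq_single_of_mem l hlT]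
      · rw [b.update_of_ne _ _ fun h => hl0 h.1, b.update_of_ne _ _ fun h => hll h.2.2,
          FinArray.update_self, ← smul_sub, ← hε]
        rw [sub_sub_sub_cancel_left, sub_add_cancel_left, neg_neg, hε, neg_one_pow_smul_smul]
      · intro p hp hpl
        rw [b.update_of_ne _ _ fun h => ((mT p).1 hp).1 h.1,
          b.update_of_ne _ _ fun h => ((mT p).1 hp).2 h.2.2,
          b.update_of_ne _ _ fun h => ?_, sub_self]
        have : p ∈ T.erase l := Finset.mem_erase.2 ⟨hpl, hp⟩
        rw [← h.2.1] at this
        exact Finset.notMem_erase _ _ this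
    refine Eq.trans ?_ (sub_eq_iff_eq_add.1 e).symm
    rw [FinArray.defect, sub_add_cancel]

/-- Filling of the horn `Λ^0`, relative to a dg-ideal on which the cone of the first edge is
exact. -/
lemma FinArray.exists_fill_left (J : DGIdeal A) {b : FinArray X} (hb : b.IsMCOnHorn 0)
    (hdef : ∀ i S j, i < j → S ⊆ Finset.Ioo i j → ∀ ⦃q q' : ℤ⦄ (h : q + 1 = q'),
      q + S.card = 0 → b.defect i S j h ∈ J.mem _ _ _)
    (hex : J.ExactPre (b 0 ∅ 1 0) (X (Fin.last _))) :
    ∃ b' : FinArray X, (∀ i S j q, b' i S j q - b i S j q ∈ J.mem _ _ _) ∧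
      (∀ i S j q, InHorn 0 i S j → b' i S j q = b i S j q) ∧
      ∀ i S j, i < j → S ⊆ Finset.Ioo i j → b'.IsMC i S j := by
  obtain ⟨T, hT⟩ : ∃ T, T = Finset.Ioo 0 (Fin.last (n + 2)) := ⟨_, rfl⟩
  obtain ⟨S₁, hS₁⟩ : ∃ S, S = Finset.Ioo 1 (Fin.last (n + 2)) := ⟨_, rfl⟩
  have mT : ∀ p, p ∈ T ↔ p ≠ 0 ∧ p ≠ Fin.last _ := fun p => by
    rw [hT, Finset.mem_Ioo, Fin.pos_iff_ne_zero, Fin.lt_last_iff_ne_last]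
  have h0l : (0 : Fin (n + 3)) < Fin.last _ := Fin.last_pos
  have h01 : (0 : Fin (n + 3)) < 1 := Fin.zero_lt_one
  have h1l : (1 : Fin (n + 3)) < Fin.last _ := by simp [Fin.lt_def]
  have one_lt : ∀ p : Fin (n + 3), p ≠ 0 → p ≠ 1 → 1 < p := fun p h0 h1 => by
    exact lt_of_le_of_ne (Fin.one_le_of_ne_zero h0) h1.symm
  have mS₁ : ∀ p, p ∈ S₁ ↔ p ≠ 0 ∧ p ≠ 1 ∧ p ≠ Fin.last _ := fun p => by
    rw [hS₁, Finset.mem_Ioo, Fin.lt_last_iff_ne_last]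
    constructor
    · rintro ⟨h, h'⟩; exact ⟨(h01.trans h).ne', h.ne', h'⟩
    · rintro ⟨h, h', h''⟩; exact ⟨one_lt p h h', h''⟩
  have h1T : (1 : Fin (n + 3)) ∈ T := (mT 1).2 ⟨h01.ne', h1l.ne⟩
  have hT1 : T.above 1 = S₁ := by
    ext p; rw [Finset.mem_above, mT, mS₁]
    constructor
    · rintro ⟨⟨h, h'⟩, h''⟩; exact ⟨h, h''.ne', h'⟩
    · rintro ⟨h, h', h''⟩; exact ⟨⟨h, h''⟩, one_lt p h h'⟩
  have hT1' : T.below 1 = ∅ := by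
    ext p; rw [Finset.mem_below, mT]
    simp only [Finset.notMem_empty, iff_false, not_and, not_lt]
    rintro ⟨h, -⟩
    exact Fin.one_le_of_ne_zero h
  have hcard := Finset.card_above_add_card_below h1T
  rw [hT1, hT1', Finset.card_empty, add_zero] at hcard
  set ε : ℤ := (-1 : ℤ) ^ S₁.card with hε
  set q₁ : ℤ := -(S₁.card : ℤ) with hq₁
  have hq : -(T.card : ℤ) + 1 = q₁ := by omega
  -- vanishing of the defects at the places of the horn
  have hA : ∀ p ∈ T, p ≠ 1 → InHorn 0 p (T.above p) (Fin.last _) := fun p hp hp1 =>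
    ⟨1, h01.ne', hp1.symm, h1l.ne, fun h =>
      (one_lt p ((mT p).1 hp).1 hp1).asymm (Finset.mem_above.1 h).2⟩
  have hB : ∀ p ∈ T, InHorn 0 0 (T.below p) p := fun p hp =>
    ⟨Fin.last _, h0l.ne', h0l.ne', ((mT p).1 hp).2.symm, fun h => by
      simp [mT, Finset.mem_below] at h⟩
  have hC : ∀ p ∈ T, InHorn 0 0 (T.erase p) (Fin.last _) := fun p hp =>
    ⟨p, ((mT p).1 hp).1, ((mT p).1 hp).1, ((mT p).1 hp).2, Finset.notMem_erase _ _⟩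
  have hsub : ∀ p ∈ S₁, InHorn 0 p (S₁.above p) (Fin.last _) ∧ InHorn 0 1 (S₁.below p) p ∧
      InHorn 0 1 (S₁.erase p) (Fin.last _) := fun p hp => by
    have hp' := (mS₁ p).1 hp
    refine ⟨⟨1, h01.ne', hp'.2.1.symm, h1l.ne, fun h => ?_⟩,
      ⟨Fin.last _, h0l.ne', h1l.ne', hp'.2.2.symm, fun h => ?_⟩,
      ⟨p, hp'.1, hp'.2.1, hp'.2.2, Finset.notMem_erase _ _⟩⟩
    · simp [mS₁, Finset.mem_above] at h
    · simp [mS₁, Finset.mem_below] at h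
  set f := b 0 ∅ 1 0 with hf
  have hterm : ∀ (q q' : ℤ) (x : A.Hom (X 1) (X (Fin.last _)) q),
      A.tcomp q' x (b 0 (T.below 1) 1 (-((T.below 1).card : ℤ))) = A.tcomp q' x f := by
    intro q q' x
    rw [hT1']
    have key : ∀ c : ℤ, c = 0 → A.tcomp q' x (b 0 ∅ 1 c) = A.tcomp q' x (b 0 ∅ 1 0) := by
      rintro _ rfl; rfl
    exact key _ (by simp)
  -- The only defect off the horn is that of the face `{1, …, n+2}`; it enters through the splitting
  -- at the vertex `1`, hence composed with the first edge `f`.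
  have hrhs : A.d rfl (b.rhs 0 T (Fin.last _) q₁) =
      ε • A.comp (add_zero _) (b.defect 1 S₁ (Fin.last _) (q := q₁) rfl) f := by
    rw [b.d_rhs 0 T _ (by omega) rfl, Finset.sum_eq_single_of_mem 1 h1T]
    · rw [hb 0 _ 1 h01 (below_subset_Ioo hT.subset) (hB 1 h1T) _ (by omega),
        hb 0 _ _ h0l ((Finset.erase_subset _ _).trans hT.subset) (hC 1 h1T) _ (by
            rw [Finset.card_erase_of_mem h1T]; omega), hterm]
      rw [map_zero, smul_zero, add_zero, sub_zero, ← tcomp_eq (add_zero (q₁ + 1))]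
      have key : ∀ (S : Finset (Fin (n + 3))) (q a : ℤ) (h : q + 1 = a), S = S₁ → q = q₁ →
          (-1 : ℤ) ^ S.card • A.tcomp (q₁ + 1) (b.defect 1 S (Fin.last _) h) f =
          ε • A.tcomp (q₁ + 1) (b.defect 1 S₁ (Fin.last _) (q := q₁) rfl) f := by
        rintro _ _ _ h rfl rfl; subst h; rfl
      exact key _ _ _ _ hT1 (by rw [hT1])
    · intro p hp hp1
      have hp' := (mT p).1 hp
      rw [hb p _ _ (Fin.lt_last_iff_ne_last.2 hp'.2) (above_subset_Ioo hT.subset) (hA p hp hp1) _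
          (by omega), hb 0 _ p (Fin.pos_iff_ne_zero.2 hp'.1) (below_subset_Ioo hT.subset)
          (hB p hp) _ (by omega), hb 0 _ _ h0l ((Finset.erase_subset _ _).trans hT.subset)
          (hC p hp) _ (by
            rw [Finset.card_erase_of_mem hp]; have := Finset.card_pos.2 ⟨p, hp⟩; omega)]
      simp
  -- The defect of the face and that of the top place, with these signs, form a cocycle in the cone
  -- of `f^*`: the first is closed by the Bianchi identity on the face, and the second condition is
  -- `hrhs`.
  obtain ⟨v, hv, u, hu, dv, hvu⟩ := hex hq rfl
    (-b.defect 1 S₁ (Fin.last _) (q := q₁) rfl) (ε • b.defect 0 T (Fin.last _) hq)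
    (neg_mem (hdef 1 S₁ _ h1l hS₁.subset _ (by omega)))
    (zsmul_mem (hdef 0 T _ h0l hT.subset hq (by omega)) _)
    (by rw [map_neg, FinArray.defect, map_sub, A.d_d,
          FinArray.d_rhs_eq_zero hb h1l hS₁.subset hsub (by omega), sub_self, neg_zero])
    (by rw [map_zsmul, FinArray.defect, map_sub, A.d_d, hrhs, zero_sub, smul_neg, hε,
          neg_one_pow_smul_smul, map_neg, LinearMap.neg_apply])
  -- Changing the face by `v` changes the right hand side at the top by `ε·vf`, and `ε·defect = vf +
  -- du`; so the top value has to be changed by `-ε·u`.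
  refine FinArray.exists_fill_of_solution J hb hT (i₁ := 1) (j₁ := Fin.last _)
    (S₁ := S₁) hS₁.subset ?_ hsub ?_ (fun h => h01.ne' h.1)
    (v := v) hv (u := -(ε • u)) (neg_mem (zsmul_mem hu _)) ?_ ?_
  · rintro ⟨p, h0, h1, hl, h⟩
    exact h ((mS₁ p).2 ⟨h0, h1, hl⟩)
  · intro i S j hij hS
    by_cases h : InHorn 0 i S j
    · exact Or.inl h
    · have hj := eq_last_of_not_inHorn h hij hS h0l.ne
      subst hj
      right
      by_cases hi : i = 0
      · subst hi
        exact Or.inr ⟨rfl, Finset.Subset.antisymm (hT ▸ hS) fun p hp =>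
          mem_of_not_inHorn h (hT ▸ hp) ((mT p).1 hp).1, rfl⟩
      · have hi1 : i = 1 := by
          by_contra hi1
          exact h ⟨1, h01.ne', Ne.symm hi1, h1l.ne, fun h1 =>
            (one_lt i hi hi1).asymm (Finset.mem_Ioo.1 (hS h1)).1⟩
        subst hi1
        exact Or.inl ⟨rfl, Finset.Subset.antisymm (hS₁ ▸ hS) fun p hp =>
          mem_of_not_inHorn h (hS₁ ▸ hp) ((mS₁ p).1 hp).1, rfl⟩
  · rw [map_add, dv, FinArray.defect]
    abel
  · intro q' h
    obtain rfl : q' = q₁ := h.symm.trans hq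
    have e : (b.update 1 S₁ (Fin.last _) q₁ (b 1 S₁ (Fin.last _) q₁ + v)).rhs
        0 T (Fin.last _) q₁ - b.rhs 0 T (Fin.last _) q₁ = ε • A.comp (add_zero _) v f := by
      rw [FinArray.rhs, FinArray.rhs, ← Finset.sum_sub_distrib, Finset.sum_eq_single_of_mem 1 h1T]
      · rw [b.update_of_ne (i := 0) _ _ fun h => h01.ne h.1,
          b.update_of_ne (i := 0) _ _ fun h => h01.ne h.1, hterm, hterm, ← smul_sub, hT1,
          FinArray.update_self, map_add, LinearMap.add_apply, ← hε, ← tcomp_eq (add_zero q₁)]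
        congr 1
        abel
      · intro p hp hp1
        rw [b.update_of_ne _ _ fun h => hp1 h.1,
          b.update_of_ne (i := 0) _ _ fun h => h01.ne h.1,
          b.update_of_ne (i := 0) _ _ fun h => h01.ne h.1, sub_self]
    refine Eq.trans ?_ (sub_eq_iff_eq_add.1 e).symm
    have e2 : ε • A.comp (add_zero _) v f = b.defect 0 T (Fin.last _) hq - ε • A.d hq u := by
      rw [eq_sub_iff_add_eq, ← smul_add, ← hvu, hε, neg_one_pow_smul_smul]
    rw [e2, FinArray.defect, map_add, map_neg, map_zsmul]
    abel

/-- Filling of the last horn, relative to a dg-ideal on which the cone of the last edge is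
exact. -/
lemma FinArray.exists_fill_right (J : DGIdeal A) {b : FinArray X}
    (hb : b.IsMCOnHorn (Fin.last _))
    (hdef : ∀ i S j, i < j → S ⊆ Finset.Ioo i j → ∀ ⦃q q' : ℤ⦄ (h : q + 1 = q'),
      q + S.card = 0 → b.defect i S j h ∈ J.mem _ _ _)
    (hex : J.ExactPost (b (Fin.last (n + 1)).castSucc ∅ (Fin.last _) 0) (X 0)) :
    ∃ b' : FinArray X, (∀ i S j q, b' i S j q - b i S j q ∈ J.mem _ _ _) ∧
      (∀ i S j q, InHorn (Fin.last _) i S j → b' i S j q = b i S j q) ∧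
      ∀ i S j, i < j → S ⊆ Finset.Ioo i j → b'.IsMC i S j := by
  obtain ⟨m, hm⟩ : ∃ m, m = (Fin.last (n + 1)).castSucc := ⟨_, rfl⟩
  rw [← hm] at hex
  obtain ⟨T, hT⟩ : ∃ T, T = Finset.Ioo 0 (Fin.last (n + 2)) := ⟨_, rfl⟩
  obtain ⟨S₁, hS₁⟩ : ∃ S, S = Finset.Ioo 0 m := ⟨_, rfl⟩
  have mT : ∀ p, p ∈ T ↔ p ≠ 0 ∧ p ≠ Fin.last _ := fun p => by
    rw [hT, Finset.mem_Ioo, Fin.pos_iff_ne_zero, Fin.lt_last_iff_ne_last]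
  have h0l : (0 : Fin (n + 3)) < Fin.last _ := Fin.last_pos
  have h0m : 0 < m := by rw [hm]; simp [Fin.lt_def]
  have hml : m < Fin.last _ := by rw [hm]; simp [Fin.lt_def]
  have le_m : ∀ p : Fin (n + 3), p ≠ Fin.last _ → p ≤ m := fun p hl => by
    have := Fin.lt_last_iff_ne_last.2 hl
    rw [hm, Fin.le_def]; rw [Fin.lt_def] at this
    simp only [Fin.val_last, Fin.val_castSucc] at this ⊢
    omega
  have lt_m : ∀ p : Fin (n + 3), p ≠ Fin.last _ → p ≠ m → p < m := fun p hl h1 =>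
    lt_of_le_of_ne (le_m p hl) h1
  have mS₁ : ∀ p, p ∈ S₁ ↔ p ≠ 0 ∧ p ≠ m ∧ p ≠ Fin.last _ := fun p => by
    rw [hS₁, Finset.mem_Ioo, Fin.pos_iff_ne_zero]
    constructor
    · rintro ⟨h, h'⟩; exact ⟨h, h'.ne, (h'.trans hml).ne⟩
    · rintro ⟨h, h', h''⟩; exact ⟨h, lt_m p h'' h'⟩
  have hmT : m ∈ T := (mT m).2 ⟨h0m.ne', hml.ne⟩
  have hTm : T.below m = S₁ := by
    ext p; rw [Finset.mem_below, mT, mS₁]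
    constructor
    · rintro ⟨⟨h, h'⟩, h''⟩; exact ⟨h, h''.ne, h'⟩
    · rintro ⟨h, h', h''⟩; exact ⟨⟨h, h''⟩, lt_m p h'' h'⟩
  have hTm' : T.above m = ∅ := by
    ext p; rw [Finset.mem_above, mT]
    simp only [Finset.notMem_empty, iff_false, not_and, not_lt]
    rintro ⟨-, h⟩
    exact le_m p h
  have hcard := Finset.card_above_add_card_below hmT
  rw [hTm, hTm', Finset.card_empty, zero_add] at hcard
  set q₁ : ℤ := -(S₁.card : ℤ) with hq₁
  have hq : -(T.card : ℤ) + 1 = q₁ := by omega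
  -- vanishing of the defects at the places of the horn
  have hA : ∀ p ∈ T, InHorn (Fin.last _) p (T.above p) (Fin.last _) := fun p hp =>
    ⟨0, h0l.ne, ((mT p).1 hp).1.symm, h0l.ne, fun h => by simp [mT, Finset.mem_above] at h⟩
  have hB : ∀ p ∈ T, p ≠ m → InHorn (Fin.last _) 0 (T.below p) p := fun p hp hpm =>
    ⟨m, hml.ne, h0m.ne', hpm.symm, fun h =>
      (lt_m p ((mT p).1 hp).2 hpm).asymm (Finset.mem_below.1 h).2⟩
  have hC : ∀ p ∈ T, InHorn (Fin.last _) 0 (T.erase p) (Fin.last _) := fun p hp =>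
    ⟨p, ((mT p).1 hp).2, ((mT p).1 hp).1, ((mT p).1 hp).2, Finset.notMem_erase _ _⟩
  have hsub : ∀ p ∈ S₁, InHorn (Fin.last _) p (S₁.above p) m ∧
      InHorn (Fin.last _) 0 (S₁.below p) p ∧ InHorn (Fin.last _) 0 (S₁.erase p) m := fun p hp => by
    have hp' := (mS₁ p).1 hp
    refine ⟨⟨0, h0l.ne, hp'.1.symm, h0m.ne, fun h => ?_⟩,
      ⟨m, hml.ne, h0m.ne', hp'.2.1.symm, fun h => ?_⟩,
      ⟨p, hp'.2.2, hp'.1, hp'.2.1, Finset.notMem_erase _ _⟩⟩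
    · simp [mS₁, Finset.mem_above] at h
    · simp [mS₁, Finset.mem_below] at h
  set f := b m ∅ (Fin.last _) 0 with hf
  have hterm : ∀ (q q' : ℤ) (x : A.Hom (X 0) (X m) q),
      (-1 : ℤ) ^ (T.above m).card •
        A.tcomp q' (b m (T.above m) (Fin.last _) (-((T.above m).card : ℤ))) x =
      A.tcomp q' f x := by
    intro q q' x
    rw [hTm', Finset.card_empty, pow_zero, one_smul]
    have key : ∀ c : ℤ, c = 0 → A.tcomp q' (b m ∅ (Fin.last _) c) x = A.tcomp q' f x := by
      rintro _ rfl; rfl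
    exact key _ (by simp)
  have hrhs : A.d rfl (b.rhs 0 T (Fin.last _) q₁) =
      A.comp (zero_add _) f (b.defect 0 S₁ m (q := q₁) rfl) := by
    rw [b.d_rhs 0 T _ (by omega) rfl, Finset.sum_eq_single_of_mem m hmT]
    · rw [hb m _ _ hml (above_subset_Ioo hT.subset) (hA m hmT) _ (by omega),
        hb 0 _ _ h0l ((Finset.erase_subset _ _).trans hT.subset) (hC m hmT) _ (by
            rw [Finset.card_erase_of_mem hmT]; omega), hterm]
      rw [map_zero, LinearMap.zero_apply, zero_add, sub_zero, ← tcomp_eq (zero_add (q₁ + 1)), hTm',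
        Finset.card_empty, pow_zero, one_smul]
      have key : ∀ (S : Finset (Fin (n + 3))) (q a : ℤ) (h : q + 1 = a), S = S₁ → q = q₁ →
          A.tcomp (q₁ + 1) f (b.defect 0 S m h) =
          A.tcomp (q₁ + 1) f (b.defect 0 S₁ m (q := q₁) rfl) := by
        rintro _ _ _ h rfl rfl; subst h; rfl
      exact key _ _ _ _ hTm (by rw [hTm])
    · intro p hp hpm
      have hp' := (mT p).1 hp
      rw [hb p _ _ (Fin.lt_last_iff_ne_last.2 hp'.2) (above_subset_Ioo hT.subset) (hA p hp) _
          (by omega), hb 0 _ p (Fin.pos_iff_ne_zero.2 hp'.1) (below_subset_Ioo hT.subset)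
          (hB p hp hpm) _ (by omega), hb 0 _ _ h0l ((Finset.erase_subset _ _).trans hT.subset)
          (hC p hp) _ (by
            rw [Finset.card_erase_of_mem hp]; have := Finset.card_pos.2 ⟨p, hp⟩; omega)]
      simp
  -- The analogous cocycle lies in the cone of `f_*`, for the last edge `f`. No vertex of `T` lies
  -- above `m`, so the sign `ε` of the other outer horn is replaced by `1`.
  obtain ⟨v, hv, u, hu, dv, hvu⟩ := hex hq rfl
    (-b.defect 0 S₁ m (q := q₁) rfl) (b.defect 0 T (Fin.last _) hq)
    (neg_mem (hdef 0 S₁ _ h0m hS₁.subset _ (by omega)))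
    (hdef 0 T _ h0l hT.subset hq (by omega))
    (by rw [map_neg, FinArray.defect, map_sub, A.d_d,
          FinArray.d_rhs_eq_zero hb h0m hS₁.subset hsub (by omega), sub_self, neg_zero])
    (by rw [FinArray.defect, map_sub, A.d_d, hrhs, zero_sub, map_neg])
  refine FinArray.exists_fill_of_solution J hb hT (i₁ := 0) (j₁ := m)
    (S₁ := S₁) hS₁.subset ?_ hsub ?_ (fun h => hml.ne h.2.2)
    (v := v) hv (u := -u) (neg_mem hu) ?_ ?_
  · rintro ⟨p, h0, h1, hl, h⟩
    exact h ((mS₁ p).2 ⟨h1, hl, h0⟩)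
  · intro i S j hij hS
    by_cases h : InHorn (Fin.last _) i S j
    · exact Or.inl h
    · have hi := eq_zero_of_not_inHorn h hij hS h0l.ne'
      subst hi
      right
      by_cases hj : j = Fin.last _
      · subst hj
        exact Or.inr ⟨rfl, Finset.Subset.antisymm (hT ▸ hS) fun p hp =>
          mem_of_not_inHorn h (hT ▸ hp) ((mT p).1 hp).2, rfl⟩
      · have hjm : j = m := by
          by_contra hjm
          exact h ⟨m, hml.ne, h0m.ne', Ne.symm hjm, fun h1 =>
            (lt_m j hj hjm).asymm (Finset.mem_Ioo.1 (hS h1)).2⟩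
        subst hjm
        exact Or.inl ⟨rfl, Finset.Subset.antisymm (hS₁ ▸ hS) fun p hp =>
          mem_of_not_inHorn h (hS₁ ▸ hp) ((mS₁ p).1 hp).2.2, rfl⟩
  · rw [map_add, dv, FinArray.defect]
    abel
  · intro q' h
    obtain rfl : q' = q₁ := h.symm.trans hq
    have e : (b.update 0 S₁ m q₁ (b 0 S₁ m q₁ + v)).rhs
        0 T (Fin.last _) q₁ - b.rhs 0 T (Fin.last _) q₁ = A.comp (zero_add _) f v := by
      rw [FinArray.rhs, FinArray.rhs, ← Finset.sum_sub_distrib, Finset.sum_eq_single_of_mem m hmT]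
      · rw [b.update_of_ne (j := Fin.last _) _ _ fun h => hml.ne' h.2.2,
          b.update_of_ne (j := Fin.last _) _ _ fun h => hml.ne' h.2.2, smul_sub, smul_sub,
          hterm, hterm, hTm, FinArray.update_self, map_add, ← tcomp_eq (zero_add q₁)]
        abel
      · intro p hp hp1
        rw [b.update_of_ne (i := 0) (j := p) _ _ fun h => hp1 h.2.2,
          b.update_of_ne (j := Fin.last _) _ _ fun h => hml.ne' h.2.2,
          b.update_of_ne (j := Fin.last _) _ _ fun h => hml.ne' h.2.2, sub_self]
    refine Eq.trans ?_ (sub_eq_iff_eq_add.1 e).symm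
    have e2 : A.comp (zero_add _) f v = b.defect 0 T (Fin.last _) hq - A.d hq u := by
      rw [hvu, add_sub_cancel_right]
    rw [e2, FinArray.defect, map_add, map_neg]
    abel

/-- Filling of horns, relative to a dg-ideal. -/
theorem FinArray.exists_fill (J : DGIdeal A) {b : FinArray X} {l : Fin (n + 3)}
    (hb : b.IsMCOnHorn l)
    (hdef : ∀ i S j, i < j → S ⊆ Finset.Ioo i j → ∀ ⦃q q' : ℤ⦄ (h : q + 1 = q'),
      q + S.card = 0 → b.defect i S j h ∈ J.mem _ _ _)
    (hl : l = 0 → J.ExactPre (b 0 ∅ 1 0) (X (Fin.last _)))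
    (hr : l = Fin.last _ → J.ExactPost (b (Fin.last (n + 1)).castSucc ∅ (Fin.last _) 0) (X 0)) :
    ∃ b' : FinArray X, (∀ i S j q, b' i S j q - b i S j q ∈ J.mem _ _ _) ∧
      (∀ i S j q, InHorn l i S j → b' i S j q = b i S j q) ∧
      ∀ i S j, i < j → S ⊆ Finset.Ioo i j → b'.IsMC i S j := by
  by_cases h0 : l = 0
  · subst h0; exact FinArray.exists_fill_left J hb hdef (hl rfl)
  · by_cases hll : l = Fin.last _
    · subst hll; exact FinArray.exists_fill_right J hb hdef (hr rfl)
    · exact FinArray.exists_fill_inner J h0 hll hb hdef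

end DGCat

end

/-! ### Chains as lists and as finite sets; the equations at degenerate chains -/

noncomputable section

namespace List

variable {ι : Type*} [LinearOrder ι] {c : List ι}

lemma toFinset_drop_eq_above (hc : c.Pairwise (· < ·)) (p : Fin c.length) :
    (c.drop (p + 1)).toFinset = c.toFinset.above (c.get p) := by
  have hm := hc.sortedLT.strictMono_get
  ext x
  rw [mem_toFinset, mem_drop_iff_getElem, Finset.mem_above, mem_toFinset, mem_iff_get]
  constructor
  · rintro ⟨j, hj, rfl⟩
    refine ⟨⟨⟨_, by omega⟩, rfl⟩, hm (a := p) (b := ⟨p + 1 + j, by omega⟩) ?_⟩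
    rw [Fin.lt_def]
    simp only
    omega
  · rintro ⟨⟨q, rfl⟩, h⟩
    have h' := hm.lt_iff_lt.1 h
    rw [Fin.lt_def] at h'
    refine ⟨q - (p + 1), by omega, ?_⟩
    rw [get_eq_getElem]; congr 1; omega

lemma toFinset_take_eq_below (hc : c.Pairwise (· < ·)) (p : Fin c.length) :
    (c.take p).toFinset = c.toFinset.below (c.get p) := by
  have hm := hc.sortedLT.strictMono_get
  ext x
  rw [mem_toFinset, mem_take_iff_getElem, Finset.mem_below, mem_toFinset, mem_iff_get]
  constructor
  · rintro ⟨j, hj, rfl⟩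
    refine ⟨⟨⟨j, by omega⟩, rfl⟩, hm (a := ⟨j, by omega⟩) (b := p) ?_⟩
    rw [Fin.lt_def]
    simp only
    omega
  · rintro ⟨⟨q, rfl⟩, h⟩
    have h' := hm.lt_iff_lt.1 h
    rw [Fin.lt_def] at h'
    exact ⟨q, by omega, rfl⟩

lemma toFinset_eraseIdx_eq_erase (hc : c.Pairwise (· < ·)) (p : Fin c.length) :
    (c.eraseIdx p).toFinset = c.toFinset.erase (c.get p) := by
  have hm := hc.sortedLT.strictMono_get
  ext x
  rw [mem_toFinset, mem_eraseIdx_iff_getElem, Finset.mem_erase, mem_toFinset, mem_iff_get]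
  constructor
  · rintro ⟨j, hj, hjp, rfl⟩
    refine ⟨fun h => hjp ?_, ⟨⟨j, hj⟩, rfl⟩⟩
    exact congrArg Fin.val (hm.injective (a₁ := ⟨j, hj⟩) (a₂ := p) h)
  · rintro ⟨h, ⟨q, rfl⟩⟩
    refine ⟨q, q.2, fun e => h ?_, rfl⟩
    rw [Fin.ext e]

lemma sort_toFinset_of_pairwise_lt (hc : c.Pairwise (· < ·)) : c.toFinset.sort = c :=
  (toFinset_sort (· ≤ ·) (hc.imp fun h => h.ne)).2 (hc.imp fun h => h.le)

end List

namespace DGCat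

variable {R : Type u} [CommRing R] {A : DGCat R}

/-- The right hand side of the Maurer-Cartan equation as a sum over the positions of a list. -/
lemma FinArray.rhs_toFinset {ι : Type} [LinearOrder ι] {X : ι → A.Obj} (b : FinArray X)
    (i : ι) {c : List ι} (hc : c.Pairwise (· < ·)) (j : ι) (q : ℤ) :
    b.rhs i c.toFinset j q = ∑ p : Fin c.length, (-1 : ℤ) ^ (c.length - 1 - (p : ℕ)) •
      (A.tcomp q (b (c.get p) (c.drop (p + 1)).toFinset j (-((c.drop (p + 1)).length : ℤ)))
        (b i (c.take p).toFinset (c.get p) (-((c.take p).length : ℤ)))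
        - b i (c.eraseIdx p).toFinset j q) := by
  have hn : c.Nodup := hc.imp fun h => h.ne
  rw [FinArray.rhs]
  symm
  refine Finset.sum_nbij c.get (fun p _ => by simp) (fun p _ q _ h => ?_) (fun x hx => ?_)
    fun p _ => ?_
  · exact hc.sortedLT.strictMono_get.injective h
  · simpa [List.mem_iff_get] using hx
  · have h1 := List.toFinset_drop_eq_above hc p
    have h2 := List.toFinset_take_eq_below hc p
    have c1 : (c.drop (p + 1)).length = (c.toFinset.above (c.get p)).card := by
      rw [← h1, List.toFinset_card_of_nodup (hn.sublist (List.drop_sublist _ _))]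
    have c2 : (c.take p).length = (c.toFinset.below (c.get p)).card := by
      rw [← h2, List.toFinset_card_of_nodup (hn.sublist (List.take_sublist _ _))]
    have c3 : c.length - 1 - (p : ℕ) = (c.toFinset.above (c.get p)).card := by
      rw [← c1, List.length_drop]; omega
    rw [h1, h2, c1, c2, c3, List.toFinset_eraseIdx_eq_erase hc p]

lemma IsChain.le {n : ℕ} {i j : Fin (n + 1)} {c : List (Fin (n + 1))} (h : IsChain i c j) :
    i ≤ j := (List.pairwise_cons.1 h).1 j (by simp)

lemma IsChain.pairwise_lt {n : ℕ} {i j : Fin (n + 1)} {c : List (Fin (n + 1))}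
    (h : IsChain i c j) (hn : (i :: (c ++ [j])).Nodup) :
    i < j ∧ c.Pairwise (· < ·) ∧ c.toFinset ⊆ Finset.Ioo i j := by
  have h' : (i :: (c ++ [j])).Pairwise (· < ·) :=
    (List.Pairwise.and h hn).imp fun h => lt_of_le_of_ne h.1 h.2
  rw [List.pairwise_cons, List.pairwise_append] at h'
  refine ⟨h'.1 j (by simp), h'.2.1, fun x hx => ?_⟩
  rw [List.mem_toFinset] at hx
  exact Finset.mem_Ioo.2 ⟨h'.1 x (by simp [hx]), h'.2.2.2 x hx j (by simp)⟩

lemma isChain_of_lt {n : ℕ} {i j : Fin (n + 1)} {c : List (Fin (n + 1))} (hij : i < j)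
    (hc : c.Pairwise (· < ·)) (hS : c.toFinset ⊆ Finset.Ioo i j) :
    IsChain i c j ∧ (i :: (c ++ [j])).Nodup := by
  have hm : ∀ x ∈ c, i < x ∧ x < j := fun x hx => Finset.mem_Ioo.1 (hS (List.mem_toFinset.2 hx))
  have : (i :: (c ++ [j])).Pairwise (· < ·) := by
    rw [List.pairwise_cons, List.pairwise_append]
    refine ⟨fun x hx => ?_, hc, by simp, fun x hx y hy => ?_⟩
    · rw [List.mem_append, List.mem_singleton] at hx
      rcases hx with hx | rfl
      exacts [(hm x hx).1, hij]
    · rw [List.mem_singleton] at hy; subst hy; exact (hm x hx).2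
  exact ⟨this.imp fun h => h.le, this.imp fun h => h.ne⟩

namespace NerveSimplex

open Classical in
/-- The values of a simplex of the coherent nerve on finite sets of intermediate vertices. -/
def arr {n : ℕ} (x : NerveSimplex A n) : FinArray x.obj := fun i S j q =>
  if h : IsChain i (S.sort (· ≤ ·)) j ∧ q + (S.sort (· ≤ ·)).length = 0 then x.α h.1 q h.2 else 0

lemma arr_toFinset {n : ℕ} (x : NerveSimplex A n) {i j : Fin (n + 1)} {c : List (Fin (n + 1))}
    (hc : c.Pairwise (· < ·)) (h : IsChain i c j) (q : ℤ) (hq : q + c.length = 0) :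
    x.arr i c.toFinset j q = x.α h q hq := by
  have e := List.sort_toFinset_of_pairwise_lt hc
  have h' : IsChain i c.toFinset.sort j ∧ q + c.toFinset.sort.length = 0 := by
    rw [e]; exact ⟨h, hq⟩
  rw [arr, dif_pos h']
  exact x.α_congr e _ _ _ _ _

lemma arr_empty {n : ℕ} (x : NerveSimplex A n) {i j : Fin (n + 1)} (h : IsChain i [] j) :
    x.arr i ∅ j 0 = x.α h 0 (by simp) :=
  x.arr_toFinset List.Pairwise.nil h 0 (by simp)

lemma arr_isMC {n : ℕ} (x : NerveSimplex A n) {i j : Fin (n + 1)} {S : Finset (Fin (n + 1))}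
    (hij : i < j) (hS : S ⊆ Finset.Ioo i j) : x.arr.IsMC i S j := by
  intro q q' h hq
  obtain ⟨c, hc, rfl⟩ : ∃ c : List (Fin (n + 1)), c.Pairwise (· < ·) ∧ S = c.toFinset :=
    ⟨S.sort, S.sortedLT_sort.pairwise, (Finset.sort_toFinset S (· ≤ ·)).symm⟩
  have hn : c.Nodup := hc.imp fun h => h.ne
  rw [List.toFinset_card_of_nodup hn] at hq
  obtain ⟨hch, -⟩ := isChain_of_lt hij hc hS
  rw [FinArray.defect, x.arr_toFinset hc hch q hq, x.d_α hch q q' hq h, FinArray.rhs_toFinset _ _ hc,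
    sub_eq_zero]
  refine Finset.sum_congr rfl fun p _ => ?_
  have hl : ((c.drop (p + 1)).length : ℤ) + (c.take p).length + 1 = c.length := by
    have := p.2; simp only [List.length_drop, List.length_take]; omega
  rw [x.arr_toFinset (hc.sublist (List.drop_sublist _ _)) (hch.right p) _ (by omega),
    x.arr_toFinset (hc.sublist (List.take_sublist _ _)) (hch.left p) _ (by omega),
    x.arr_toFinset (hc.sublist (List.eraseIdx_sublist _ _)) (hch.erase p) _ (by
      have := p.2; rw [List.length_eraseIdx_of_lt p.2]; omega), tcomp_eq (by omega)]

end NerveSimplex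

section Degenerate

variable {n : ℕ} {X : Fin (n + 1) → A.Obj}

/-- The Maurer-Cartan equation at a degenerate chain follows from the normalization. -/
lemma sum_degenerate_eq_zero
    (a : ∀ (i : Fin (n + 1)) (_ : List (Fin (n + 1))) (j : Fin (n + 1)) (q : ℤ),
      A.Hom (X i) (X j) q) (hone : ∀ i, a i [] i 0 = A.one (X i))
    (hdeg : ∀ i c j q, c ≠ [] → ¬ (i :: (c ++ [j])).Nodup → a i c j q = 0)
    {i j : Fin (n + 1)} {c : List (Fin (n + 1))} (h : IsChain i c j) (hc : c ≠ [])
    (hn : ¬ (i :: (c ++ [j])).Nodup) (q : ℤ) (hq : q + c.length = 1) :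
    ∑ p : Fin c.length, (-1 : ℤ) ^ (c.length - 1 - (p : ℕ)) •
      (A.tcomp q (a (c.get p) (c.drop (p + 1)) j (-((c.drop (p + 1)).length : ℤ)))
        (a i (c.take p) (c.get p) (-((c.take p).length : ℤ)))
        - a i (c.eraseIdx p) j q) = 0 := by
  have hdeg' : ∀ i c j q x, c ≠ [] → [x, x].Sublist (i :: (c ++ [j])) → a i c j q = 0 :=
    fun i c j q x hc hx => hdeg i c j q hc fun hn => List.nodup_iff_sublist.1 hn x hx
  -- a repetition occurs at the beginning, at the end, or in the middle
  have key : (∃ c', c = i :: c') ∨ (∃ c', c = c' ++ [j]) ∨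
      ∃ l₁ x l₂, c = l₁ ++ x :: x :: l₂ := by
    rcases c with _ | ⟨y, c'⟩
    · exact absurd rfl hc
    by_cases hy : i = y
    · exact Or.inl ⟨c', by rw [hy]⟩
    right
    -- A weakly increasing chain without equal neighbours is strictly increasing and so has no
    -- repetition at all.
    by_contra! hcon
    apply hn
    have hle : (i :: (y :: c' ++ [j])).IsChain (· ≤ ·) := List.Pairwise.isChain h
    have hlt : (i :: (y :: c' ++ [j])).IsChain (· < ·) := by
      rw [List.isChain_iff_getElem] at hle ⊢
      intro t ht
      refine lt_of_le_of_ne (hle t ht) fun e => ?_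
      rcases t with _ | t
      · exact hy (by simpa using e)
      · simp only [List.getElem_cons_succ] at e
        simp only [List.length_cons, List.length_append, List.length_nil, List.cons_append] at ht
        by_cases htl : t + 1 < (y :: c').length
        · rw [List.getElem_append_left (by omega), List.getElem_append_left htl] at e
          refine hcon.2 ((y :: c').take t) (y :: c')[t] ((y :: c').drop (t + 2)) ?_
          conv_lhs => rw [← List.take_append_drop t (y :: c')]
          rw [List.drop_eq_getElem_cons (by omega), List.drop_eq_getElem_cons htl, ← e]
        · simp only [List.length_cons] at htl
          have ht' : t = c'.length := by omega
          subst ht'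
          rw [List.getElem_append_left (by simp), List.getElem_append_right (by simp)] at e
          refine hcon.1 ((y :: c').dropLast) ?_
          rw [← List.dropLast_append_getLast (l := y :: c') (by simp), List.getLast_eq_getElem]
          simp at e ⊢
          exact e
    exact hlt.pairwise.imp fun h => h.ne
  have hcomp0 : ∀ {k : Fin (n + 1)} {r s : ℤ} (u : A.Hom (X k) (X j) r) (v : A.Hom (X i) (X k) s),
      (u = 0 ∨ v = 0) → A.tcomp q u v = 0 := by
    rintro k r s u v (rfl | rfl) <;> simp
  -- If the repetition is at an end of the chain, the composite with the unit `α(i, i) = 1`,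
  -- respectively `α(j, j) = 1`, cancels the deletion term of the same summand; in every other
  -- summand a factor of the composite and the shortened chain still contain the repetition.
  rcases key with ⟨c', rfl⟩ | ⟨c', rfl⟩ | ⟨l₁, x, l₂, rfl⟩
  · rw [List.length_cons] at hq
    refine Finset.sum_eq_zero fun p _ => ?_
    rcases p with ⟨_ | p, hp⟩
    · have e : ∀ (k : Fin (n + 1)) (l l' l'' : List (Fin (n + 1))) (r s : ℤ), k = i → l = c' →
          l' = [] → l'' = c' → s = 0 → r = q →
          A.tcomp q (a k l j r) (a i l' k s) - a i l'' j q = 0 := by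
        rintro k l l' l'' r s rfl rfl rfl rfl rfl rfl
        rw [hone, tcomp_eq (add_zero r), A.comp_one, sub_self]
      rw [e, smul_zero]
      · simp
      · simp
      · simp
      · simp
      · simp
      · simp; omega
    · rw [hcomp0 _ _ (Or.inr (hdeg' _ _ _ _ i (by simp) (by simp))),
        hdeg' i _ _ _ i (by simp) (by simp), sub_self, smul_zero]
  · rw [List.length_append, List.length_singleton] at hq
    refine Finset.sum_eq_zero fun p _ => ?_
    by_cases hp : (p : ℕ) < c'.length
    · have h1 : (c' ++ [j]).drop (p + 1) = c'.drop (p + 1) ++ [j] :=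
        List.drop_append_of_le_length (by omega)
      have h2 : (c' ++ [j]).eraseIdx p = c'.eraseIdx p ++ [j] :=
        List.eraseIdx_append_of_lt_length hp _
      have hs : ∀ l : List (Fin (n + 1)), ∀ k, [j, j].Sublist (k :: (l ++ [j] ++ [j])) := by
        intro l k
        rw [List.append_assoc]
        exact ((List.sublist_append_right l _)).cons k
      rw [hcomp0 _ _ (Or.inl (hdeg' _ _ _ _ j (by rw [h1]; simp) (by rw [h1]; exact hs _ _))),
        hdeg' i _ _ _ j (by rw [h2]; simp) (by rw [h2]; exact hs _ _), sub_self, smul_zero]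
    · have hp' : (p : ℕ) = c'.length := by
        have := p.2; simp only [List.length_append, List.length_singleton] at this; omega
      have e : ∀ (k : Fin (n + 1)) (l l' l'' : List (Fin (n + 1))) (r s : ℤ), k = j → l = [] →
          l' = c' → l'' = c' → r = 0 → s = q →
          A.tcomp q (a k l j r) (a i l' k s) - a i l'' j q = 0 := by
        rintro k l l' l'' r s rfl rfl rfl rfl rfl rfl
        rw [hone, tcomp_eq (zero_add s), A.one_comp, sub_self]
      rw [e, smul_zero]
      · simp [hp']
      · simp [hp']
      · simp [hp']
      · rw [hp', List.eraseIdx_append_of_length_le le_rfl]; simp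
      · simp [hp']
      · simp [hp']; omega
  · set m := l₁.length with hm
    have hlen : (l₁ ++ x :: x :: l₂).length = m + l₂.length + 2 := by simp [hm]; omega
    -- For a repetition in the middle, all composites have a degenerate factor. Only the two
    -- deletions of the repeated vertex remain; they give the same chain with opposite signs.
    rw [Finset.sum_eq_add (⟨m, by omega⟩ : Fin (l₁ ++ x :: x :: l₂).length) ⟨m + 1, by omega⟩
      (by simp) ?_ (by simp) (by simp)]
    · have e1 : (l₁ ++ x :: x :: l₂).eraseIdx m = l₁ ++ x :: l₂ := by
        rw [hm, List.eraseIdx_append_of_length_le le_rfl]; simp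
      have e2 : (l₁ ++ x :: x :: l₂).eraseIdx (m + 1) = l₁ ++ x :: l₂ := by
        rw [hm, List.eraseIdx_append_of_length_le (by omega)]; simp
      rw [hcomp0 _ _ (Or.inl (hdeg' _ _ _ _ x ?_ ?_)), hcomp0 _ _ (Or.inr (hdeg' _ _ _ _ x ?_ ?_))]
      · simp only [e1, e2, zero_sub, smul_neg]
        rw [← neg_add, neg_eq_zero, ← add_smul]
        have : (l₁ ++ x :: x :: l₂).length - 1 - m = (l₁ ++ x :: x :: l₂).length - 1 - (m + 1) + 1 := by
          omega
        rw [this, pow_succ]; simp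
      · simp only [ne_eq, List.take_eq_nil_iff]; simp
      · have t : (l₁ ++ x :: x :: l₂).take (m + 1) = l₁ ++ [x] := by
          rw [List.take_append]; simp [hm]
        have g : (l₁ ++ x :: x :: l₂).get ⟨m + 1, by omega⟩ = x := by
          rw [List.get_eq_getElem]; simp [hm]
        rw [t, g, List.append_assoc]
        exact (List.sublist_append_right l₁ _).cons i
      · simp [hm]
      · have t : (l₁ ++ x :: x :: l₂).drop (m + 1) = x :: l₂ := by
          rw [List.drop_append]; simp [hm]
        have g : (l₁ ++ x :: x :: l₂).get ⟨m, by omega⟩ = x := by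
          rw [List.get_eq_getElem]; simp [hm]
        simp only [t, g]; simp
    · rintro p - ⟨hp1, hp2⟩
      have hp1' : (p : ℕ) ≠ m := fun h => hp1 (Fin.ext h)
      have hp2' : (p : ℕ) ≠ m + 1 := fun h => hp2 (Fin.ext h)
      have hs : ∀ (l l' : List (Fin (n + 1))) (k k'),
          [x, x].Sublist (k :: (l ++ x :: x :: l' ++ [k'])) := by
        intro l l' k k'
        rw [List.append_assoc]
        exact ((by simp : [x, x].Sublist (x :: x :: l' ++ [k'])).trans
          (List.sublist_append_right l _)).cons k
      rcases lt_or_gt_of_ne hp1' with h' | h'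
      · have h1 : (l₁ ++ x :: x :: l₂).drop (p + 1) = l₁.drop (p + 1) ++ x :: x :: l₂ :=
          List.drop_append_of_le_length (by omega)
        have h2 : (l₁ ++ x :: x :: l₂).eraseIdx p = l₁.eraseIdx p ++ x :: x :: l₂ :=
          List.eraseIdx_append_of_lt_length (by omega) _
        rw [hcomp0 _ _ (Or.inl (hdeg' _ _ _ _ x (by rw [h1]; simp) (by rw [h1]; exact hs _ _ _ _))),
          hdeg' i _ _ _ x (by rw [h2]; simp) (by rw [h2]; exact hs _ _ _ _), sub_self, smul_zero]
      · have h1 : (l₁ ++ x :: x :: l₂).take p = l₁ ++ x :: x :: l₂.take (p - m - 2) := by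
          obtain ⟨t, ht⟩ : ∃ t, (p : ℕ) = m + 2 + t := ⟨p - m - 2, by omega⟩
          rw [ht, List.take_append, List.take_of_length_le (by omega),
            show m + 2 + t - l₁.length = t + 2 by omega]
          simp
        have h2 : (l₁ ++ x :: x :: l₂).eraseIdx p = l₁ ++ x :: x :: l₂.eraseIdx (p - m - 2) := by
          obtain ⟨t, ht⟩ : ∃ t, (p : ℕ) = m + 2 + t := ⟨p - m - 2, by omega⟩
          rw [ht, List.eraseIdx_append_of_length_le (by omega),
            show m + 2 + t - l₁.length = t + 2 by omega]
          simp
        rw [hcomp0 _ _ (Or.inr (hdeg' _ _ _ _ x (by rw [h1]; simp) (by rw [h1]; exact hs _ _ _ _))),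
          hdeg' i _ _ _ x (by rw [h2]; simp) (by rw [h2]; exact hs _ _ _ _), sub_self, smul_zero]

end Degenerate

end DGCat

end

/-! ### Simplices from arrays, and restriction to faces -/

noncomputable section

namespace DGCat

variable {R : Type u} [CommRing R] {A : DGCat R}

namespace NerveSimplex

section Mk

variable {n : ℕ} (X : Fin (n + 1) → A.Obj) (b : FinArray X)
  (hone : ∀ i, b i ∅ i 0 = A.one (X i))
  (hMC : ∀ i S j, i < j → S ⊆ Finset.Ioo i j → b.IsMC i S j)

open Classical in
/-- The extension of an array to all lists, by zero on degenerate chains. -/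
def listArr (i : Fin (n + 1)) (c : List (Fin (n + 1))) (j : Fin (n + 1)) (q : ℤ) :
    A.Hom (X i) (X j) q :=
  if c = [] ∨ (i :: (c ++ [j])).Nodup then b i c.toFinset j q else 0

lemma listArr_eq {i : Fin (n + 1)} {c : List (Fin (n + 1))} {j : Fin (n + 1)} {q : ℤ}
    (h : c = [] ∨ (i :: (c ++ [j])).Nodup) : listArr X b i c j q = b i c.toFinset j q :=
  if_pos h

/-- The simplex of the coherent nerve with prescribed values on nondegenerate chains. -/
def ofFinArray : NerveSimplex A n where
  obj := X
  α {i j c} _ q _ := listArr X b i c j q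
  unit {i} _ := by rw [listArr_eq X b (Or.inl rfl)]; exact hone i
  degenerate _ _ _ hc hn := if_neg (by tauto)
  d_α {i j c} h q q' hq hq' := by
    have e : ∀ p : Fin c.length, A.comp (i := -((c.drop (p + 1)).length : ℤ))
        (j := -((c.take p).length : ℤ)) (n := q')
          (by have := p.2; simp only [List.length_drop, List.length_take]; omega)
          (listArr X b (c.get p) (c.drop (p + 1)) j (-((c.drop (p + 1)).length : ℤ)))
          (listArr X b i (c.take p) (c.get p) (-((c.take p).length : ℤ))) =
        A.tcomp q' (listArr X b (c.get p) (c.drop (p + 1)) j (-((c.drop (p + 1)).length : ℤ)))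
          (listArr X b i (c.take p) (c.get p) (-((c.take p).length : ℤ))) := fun p => by
      rw [tcomp_eq]
    simp only [e]
    by_cases hn : (i :: (c ++ [j])).Nodup
    · obtain ⟨hij, hc, hS⟩ := h.pairwise_lt hn
      have hcn : c.Nodup := hc.imp fun h => h.ne
      have hd := hMC i c.toFinset j hij hS hq' (by
        rw [List.toFinset_card_of_nodup hcn]; exact hq)
      rw [FinArray.defect, sub_eq_zero, FinArray.rhs_toFinset _ _ hc] at hd
      rw [listArr_eq X b (Or.inr hn), hd]
      refine Finset.sum_congr rfl fun p _ => ?_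
      have sub1 : ((c.get p) :: (c.drop (p + 1) ++ [j])).Nodup := by
        refine List.Nodup.sublist ?_ hn
        rw [← List.cons_append, show c.get p :: c.drop (p + 1) = c.drop p by simp]
        exact List.Sublist.cons _ (List.Sublist.append_right (List.drop_sublist _ _) _)
      have sub2 : (i :: (c.take p ++ [c.get p])).Nodup := by
        refine List.Nodup.sublist (List.Sublist.cons_cons i ?_) hn
        rw [show c.take p ++ [c.get p] = c.take (p + 1) by simp]
        exact (List.take_sublist _ _).trans (List.sublist_append_left _ _)
      have sub3 : (i :: (c.eraseIdx p ++ [j])).Nodup := List.Nodup.sublist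
        (List.Sublist.cons_cons i (List.Sublist.append_right (List.eraseIdx_sublist _ _) _)) hn
      rw [listArr_eq X b (Or.inr sub1), listArr_eq X b (Or.inr sub2), listArr_eq X b (Or.inr sub3)]
    · by_cases hc : c = []
      · subst hc
        obtain rfl : i = j := by
          by_contra hij
          exact hn (by simpa using hij)
        obtain rfl : q = 0 := by simpa using hq
        rw [listArr_eq X b (Or.inl rfl)]
        have := hone i
        simp only [List.toFinset_nil, this, A.d_one]
        rfl
      · have h0 : listArr X b i c j q = 0 := if_neg (by tauto)
        rw [h0, map_zero]
        exact (sum_degenerate_eq_zero (listArr X b)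
          (fun i => (listArr_eq X b (Or.inl rfl)).trans (hone i))
          (fun i c j q hc hn => if_neg (by tauto)) h hc hn q' (by omega)).symm

lemma arr_ofFinArray {i j : Fin (n + 1)} {S : Finset (Fin (n + 1))} (hij : i < j)
    (hS : S ⊆ Finset.Ioo i j) {q : ℤ} (hq : q + S.card = 0) :
    (ofFinArray X b hone hMC).arr i S j q = b i S j q := by
  obtain ⟨c, hc, rfl⟩ : ∃ c : List (Fin (n + 1)), c.Pairwise (· < ·) ∧ S = c.toFinset :=
    ⟨S.sort, S.sortedLT_sort.pairwise, (Finset.sort_toFinset S (· ≤ ·)).symm⟩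
  have hn : c.Nodup := hc.imp fun h => h.ne
  rw [List.toFinset_card_of_nodup hn] at hq
  obtain ⟨hch, hch'⟩ := isChain_of_lt hij hc hS
  rw [arr_toFinset _ hc hch q hq]
  exact listArr_eq X b (Or.inr hch')

end Mk

/-- A simplex is determined by its objects and its values on nondegenerate chains. -/
lemma ext_arr {n : ℕ} {x y : NerveSimplex A n} (h : x.obj = y.obj)
    (h' : ∀ i S j (q : ℤ), i < j → S ⊆ Finset.Ioo i j → q + S.card = 0 →
      x.arr i S j q ≍ y.arr i S j q) : x = y := by
  obtain ⟨X, α, u, dg, dα⟩ := x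
  obtain ⟨Y, β, v, dg', dβ⟩ := y
  obtain rfl : X = Y := h
  refine NerveSimplex.ext rfl (heq_of_eq ?_)
  funext i j c hc q hq
  by_cases hn : (i :: (c ++ [j])).Nodup
  · obtain ⟨hij, hlt, hS⟩ := hc.pairwise_lt hn
    have e := eq_of_heq (h' i c.toFinset j q hij hS (by
      rw [List.toFinset_card_of_nodup (hlt.imp fun h => h.ne)]; exact hq))
    rwa [arr_toFinset _ hlt hc q hq, arr_toFinset _ hlt hc q hq] at e
  · by_cases hcn : c = []
    · subst hcn
      obtain rfl : i = j := by
        by_contra hij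
        exact hn (by simpa using hij)
      obtain rfl : q = 0 := by simpa using hq
      exact (u hc).trans (v hc).symm
    · exact (dg hc q hq hcn hn).trans (dg' hc q hq hcn hn).symm

/-- An order embedding preserves and reflects chains, so the default values `0` also correspond and
the identity holds at every place and in every degree. -/
lemma arr_pullback {m n : ℕ} (θ : Fin (m + 1) ↪o Fin (n + 1)) (x : NerveSimplex A n)
    (i : Fin (m + 1)) (S : Finset (Fin (m + 1))) (j : Fin (m + 1)) (q : ℤ) :
    (x.pullback θ.toOrderHom).arr i S j q = x.arr (θ i) (S.map θ.toEmbedding) (θ j) q := by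
  obtain ⟨c, hc, rfl⟩ : ∃ c : List (Fin (m + 1)), c.Pairwise (· < ·) ∧ S = c.toFinset :=
    ⟨S.sort, S.sortedLT_sort.pairwise, (Finset.sort_toFinset S (· ≤ ·)).symm⟩
  have hc' : (c.map θ).Pairwise (· < ·) := List.pairwise_map.2 (hc.imp fun h => θ.lt_iff_lt.2 h)
  have hm : c.toFinset.map θ.toEmbedding = (c.map θ).toFinset := by
    ext; simp
  rw [hm]
  have hchain : IsChain i c j ↔ IsChain (θ i) (c.map θ) (θ j) := by
    refine ⟨fun h => h.map θ.toOrderHom, fun h => ?_⟩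
    have : ((i :: (c ++ [j])).map θ).Pairwise (· ≤ ·) := by simpa [IsChain] using h
    exact (List.pairwise_map.1 this).imp fun h => θ.le_iff_le.1 h
  by_cases h : IsChain i c j ∧ q + c.length = 0
  · rw [arr_toFinset _ hc h.1 q h.2, arr_toFinset _ hc' (hchain.1 h.1) q (by simpa using h.2)]
    rfl
  · have e1 : (x.pullback θ.toOrderHom).arr i c.toFinset j q = 0 := dif_neg (by
      rw [List.sort_toFinset_of_pairwise_lt hc]; exact h)
    have e2 : x.arr (θ i) (c.map θ).toFinset (θ j) q = 0 := dif_neg (by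
      rw [List.sort_toFinset_of_pairwise_lt hc', ← hchain, List.length_map]; exact h)
    exact e1.trans e2.symm

/-- The value of a simplex together with its source and target. -/
def tot {n : ℕ} (x : NerveSimplex A n) (i : Fin (n + 1)) (S : Finset (Fin (n + 1)))
    (j : Fin (n + 1)) (q : ℤ) : Σ XY : A.Obj × A.Obj, A.Hom XY.1 XY.2 q :=
  ⟨(x.obj i, x.obj j), x.arr i S j q⟩

/-- Bundling source and target lets values of simplices with only propositionally equal objects be
compared by plain equality. -/
lemma tot_pullback {m n : ℕ} (θ : Fin (m + 1) ↪o Fin (n + 1)) (x : NerveSimplex A n)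
    (i : Fin (m + 1)) (S : Finset (Fin (m + 1))) (j : Fin (m + 1)) (q : ℤ) :
    (x.pullback θ.toOrderHom).tot i S j q = x.tot (θ i) (S.map θ.toEmbedding) (θ j) q := by
  rw [tot, arr_pullback]; rfl

end NerveSimplex

/-- Restriction of an array along an order embedding. -/
def FinArray.comap {ι κ : Type} [LinearOrder ι] [LinearOrder κ] (θ : κ ↪o ι) {X : ι → A.Obj}
    (b : FinArray X) : FinArray (X ∘ θ) :=
  fun i S j q => b (θ i) (S.map θ.toEmbedding) (θ j) q

lemma FinArray.rhs_comap {ι κ : Type} [LinearOrder ι] [LinearOrder κ] (θ : κ ↪o ι)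
    {X : ι → A.Obj} (b : FinArray X) (i : κ) (S : Finset κ) (j : κ) (q : ℤ) :
    (b.comap θ).rhs i S j q = b.rhs (θ i) (S.map θ.toEmbedding) (θ j) q := by
  rw [FinArray.rhs, FinArray.rhs, Finset.sum_map]
  refine Finset.sum_congr rfl fun p _ => ?_
  have h1 : (S.map θ.toEmbedding).above (θ p) = (S.above p).map θ.toEmbedding := by
    ext x; simp only [Finset.mem_above, Finset.mem_map]; constructor
    · rintro ⟨⟨y, hy, rfl⟩, h⟩; exact ⟨y, ⟨hy, θ.lt_iff_lt.1 h⟩, rfl⟩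
    · rintro ⟨y, ⟨hy, h⟩, rfl⟩; exact ⟨⟨y, hy, rfl⟩, θ.lt_iff_lt.2 h⟩
  have h2 : (S.map θ.toEmbedding).below (θ p) = (S.below p).map θ.toEmbedding := by
    ext x; simp only [Finset.mem_below, Finset.mem_map]; constructor
    · rintro ⟨⟨y, hy, rfl⟩, h⟩; exact ⟨y, ⟨hy, θ.lt_iff_lt.1 h⟩, rfl⟩
    · rintro ⟨y, ⟨hy, h⟩, rfl⟩; exact ⟨⟨y, hy, rfl⟩, θ.lt_iff_lt.2 h⟩
  have h3 : (S.map θ.toEmbedding).erase (θ p) = (S.erase p).map θ.toEmbedding :=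
    (Finset.map_erase θ.toEmbedding S p).symm
  have key : ∀ (U V W : Finset ι) (r s : ℤ) (c : ℕ), U = (S.above p).map θ.toEmbedding →
      V = (S.below p).map θ.toEmbedding → W = (S.erase p).map θ.toEmbedding →
      r = -((S.above p).card : ℤ) → s = -((S.below p).card : ℤ) → c = (S.above p).card →
      (-1 : ℤ) ^ (S.above p).card •
        (A.tcomp q (b.comap θ p (S.above p) j (-((S.above p).card : ℤ)))
          (b.comap θ i (S.below p) p (-((S.below p).card : ℤ))) - b.comap θ i (S.erase p) j q) =
      (-1 : ℤ) ^ c • (A.tcomp q (b (θ p) U (θ j) r) (b (θ i) V (θ p) s) - b (θ i) W (θ j) q) := by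
    rintro _ _ _ _ _ _ rfl rfl rfl rfl rfl rfl
    rfl
  exact key _ _ _ _ _ _ h1 h2 h3 (by rw [RelEmbedding.coe_toEmbedding, h1, Finset.card_map])
    (by rw [RelEmbedding.coe_toEmbedding, h2, Finset.card_map])
    (by rw [RelEmbedding.coe_toEmbedding, h1, Finset.card_map])

lemma FinArray.isMC_comap {ι κ : Type} [LinearOrder ι] [LinearOrder κ] (θ : κ ↪o ι)
    {X : ι → A.Obj} (b : FinArray X) {i : κ} {S : Finset κ} {j : κ} (h : (b.comap θ).IsMC i S j) :
    b.IsMC (θ i) (S.map θ.toEmbedding) (θ j) := by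
  intro q q' e hq
  rw [Finset.card_map] at hq
  have := h e hq
  rwa [FinArray.defect, FinArray.rhs_comap] at this

/-- An array which agrees with a simplex on a face satisfies the Maurer-Cartan equations there. -/
lemma NerveSimplex.isMC_of_tot_eq {m n : ℕ} (x : NerveSimplex A m)
    (θ : Fin (m + 1) ↪o Fin (n + 1)) {X : Fin (n + 1) → A.Obj} {b : FinArray X}
    (h : ∀ i S j q, x.tot i S j q =
      ⟨(X (θ i), X (θ j)), b (θ i) (S.map θ.toEmbedding) (θ j) q⟩)
    {i j : Fin (m + 1)} {S : Finset (Fin (m + 1))} (hij : i < j) (hS : S ⊆ Finset.Ioo i j) :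
    b.IsMC (θ i) (S.map θ.toEmbedding) (θ j) := by
  refine FinArray.isMC_comap θ b ?_
  have h0 := fun i S j (hij : i < j) hS => x.arr_isMC (i := i) (S := S) (j := j) hij hS
  simp only [tot] at h
  -- Once the values are detached from `x`, the equality of its objects with `X ∘ θ` can be
  -- substituted, and then that of the values.
  generalize x.arr = a at h h0
  obtain ⟨Y, _, _, _, _⟩ := x
  simp only at a h h0
  obtain rfl : Y = X ∘ θ := by
    funext i
    exact congrArg (fun t => t.1.1) (h i ∅ i 0)
  obtain rfl : a = b.comap θ := by
    funext i S j q
    exact eq_of_heq (Sigma.mk.inj (h i S j q)).2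
  exact h0 i S j hij hS

end DGCat

end

/-! ### Gluing the faces of a horn -/

noncomputable section

namespace DGCat

variable {R : Type u} [CommRing R] {A : DGCat R}

/-- The inclusion of the face opposite to `p`. -/
abbrev face {n : ℕ} (p : Fin (n + 2)) : Fin (n + 1) ↪o Fin (n + 2) := Fin.succAboveOrderEmb p

lemma face_face {n : ℕ} {r s : Fin (n + 2)} (h : r ≤ s) (i : Fin (n + 1)) :
    face r.castSucc (face s i) = face s.succ (face r i) :=
  (DFunLike.congr_fun (congrArg SimplexCategory.Hom.toOrderHom (SimplexCategory.δ_comp_δ h)) i).symm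

lemma face_castSucc_of_le {n : ℕ} {r s : Fin (n + 2)} (h : r ≤ s) : face r.castSucc s = s.succ := by
  simp only [Fin.succAboveOrderEmb_apply]
  rw [Fin.succAbove_of_le_castSucc]
  exact Fin.castSucc_le_castSucc_iff.2 h

lemma exists_map_face_eq {n : ℕ} {p : Fin (n + 2)} {S : Finset (Fin (n + 2))} (h : p ∉ S) :
    ∃ S' : Finset (Fin (n + 1)), S'.map (face p).toEmbedding = S := by
  classical
  refine ⟨Finset.univ.filter fun i => face p i ∈ S, ?_⟩
  ext x
  simp only [Finset.mem_map, Finset.mem_filter, Finset.mem_univ, true_and]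
  constructor
  · rintro ⟨y, hy, rfl⟩; exact hy
  · intro hx
    obtain ⟨y, rfl⟩ := Fin.exists_succAbove_eq (x := x) (y := p) (by rintro rfl; exact h hx)
    exact ⟨y, hx, rfl⟩

section Glue

variable {n : ℕ} {l : Fin (n + 3)} (f : ∀ p : Fin (n + 3), p ≠ l → NerveSimplex A (n + 1))

/-- The compatibility of the faces of a horn. -/
def HornCompatible : Prop :=
  ∀ (r s : Fin (n + 2)) (_ : r ≤ s) (hr : r.castSucc ≠ l) (hs : s.succ ≠ l),
    (f s.succ hs).pullback (face r).toOrderHom = (f r.castSucc hr).pullback (face s).toOrderHom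

variable {f}

/-- A place common to two faces avoids both omitted vertices, hence comes from a place of the
codimension-two face on which the two simplices agree by hypothesis. -/
lemma HornCompatible.tot_eq_of_le (hf : HornCompatible f) {r s : Fin (n + 2)} (h : r ≤ s)
    (hr : r.castSucc ≠ l) (hs : s.succ ≠ l) {i₁ j₁ i₂ j₂ : Fin (n + 2)}
    {S₁ S₂ : Finset (Fin (n + 2))} (hi : face r.castSucc i₁ = face s.succ i₂)
    (hj : face r.castSucc j₁ = face s.succ j₂)
    (hS : S₁.map (face r.castSucc).toEmbedding = S₂.map (face s.succ).toEmbedding) (q : ℤ) :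
    (f r.castSucc hr).tot i₁ S₁ j₁ q = (f s.succ hs).tot i₂ S₂ j₂ q := by
  have lift : ∀ {v₁ v₂ : Fin (n + 2)}, face r.castSucc v₁ = face s.succ v₂ →
      ∃ v : Fin (n + 1), v₁ = face s v ∧ v₂ = face r v := by
    intro v₁ v₂ e
    have hv : v₁ ≠ s := by
      rintro rfl
      rw [face_castSucc_of_le h] at e
      exact Fin.succAbove_ne _ _ e.symm
    obtain ⟨v, rfl⟩ := Fin.exists_succAbove_eq hv
    refine ⟨v, rfl, (face s.succ).injective ?_⟩
    rw [← face_face h, ← e]; rfl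
  obtain ⟨i, rfl, rfl⟩ := lift hi
  obtain ⟨j, rfl, rfl⟩ := lift hj
  have hsS : s ∉ S₁ := by
    intro hmem
    have : s.succ ∈ S₂.map (face s.succ).toEmbedding := by
      rw [← hS, ← face_castSucc_of_le h]
      exact Finset.mem_map_of_mem _ hmem
    obtain ⟨y, -, hy⟩ := Finset.mem_map.1 this
    exact Fin.succAbove_ne _ _ hy
  obtain ⟨S, rfl⟩ := exists_map_face_eq hsS
  have hS₂ : S₂ = S.map (face r).toEmbedding := by
    refine Finset.map_injective (face s.succ).toEmbedding ?_
    rw [← hS, Finset.map_map, Finset.map_map]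
    congr 1
    ext1 x
    exact face_face h x
  subst hS₂
  rw [← NerveSimplex.tot_pullback, ← NerveSimplex.tot_pullback, hf r s h hr hs]

/-- `t` is the value of the compatible family of faces at the place `(i, S, j)`. -/
def FaceValue (f : ∀ p : Fin (n + 3), p ≠ l → NerveSimplex A (n + 1)) (i : Fin (n + 3))
    (S : Finset (Fin (n + 3))) (j : Fin (n + 3)) (q : ℤ)
    (t : Σ XY : A.Obj × A.Obj, A.Hom XY.1 XY.2 q) : Prop :=
  ∃ (p : Fin (n + 3)) (hp : p ≠ l) (i' j' : Fin (n + 2)) (S' : Finset (Fin (n + 2))),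
    face p i' = i ∧ face p j' = j ∧ S'.map (face p).toEmbedding = S ∧ t = (f p hp).tot i' S' j' q

/-- Two different faces are compared after ordering the omitted vertices; on a single face,
injectivity of its inclusion is enough. -/
lemma FaceValue.unique (hf : HornCompatible f) {i j : Fin (n + 3)} {S : Finset (Fin (n + 3))}
    {q : ℤ} {t t' : Σ XY : A.Obj × A.Obj, A.Hom XY.1 XY.2 q} (h : FaceValue f i S j q t)
    (h' : FaceValue f i S j q t') : t = t' := by
  obtain ⟨p, hp, i₁, j₁, S₁, hi₁, hj₁, hS₁, rfl⟩ := h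
  obtain ⟨p', hp', i₂, j₂, S₂, hi₂, hj₂, hS₂, rfl⟩ := h'
  have main : ∀ (p p' : Fin (n + 3)) (hp : p ≠ l) (hp' : p' ≠ l) (i₁ j₁ : Fin (n + 2)) (S₁)
      (i₂ j₂ : Fin (n + 2)) (S₂), p < p' → face p i₁ = face p' i₂ → face p j₁ = face p' j₂ →
      S₁.map (face p).toEmbedding = S₂.map (face p').toEmbedding →
      (f p hp).tot i₁ S₁ j₁ q = (f p' hp').tot i₂ S₂ j₂ q := by
    intro p p' hp hp' i₁ j₁ S₁ i₂ j₂ S₂ hlt e1 e2 e3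
    obtain ⟨r, rfl⟩ := Fin.exists_castSucc_eq.2 (Fin.ne_last_of_lt hlt)
    obtain ⟨s, rfl⟩ := Fin.exists_succ_eq.2 (Fin.ne_zero_of_lt hlt)
    exact hf.tot_eq_of_le (Fin.castSucc_lt_succ_iff.1 hlt) hp hp' e1 e2 e3 q
  rcases lt_trichotomy p p' with h | rfl | h
  · exact main p p' hp hp' _ _ _ _ _ _ h (hi₁.trans hi₂.symm) (hj₁.trans hj₂.symm)
      (hS₁.trans hS₂.symm)
  · obtain rfl := (face p).injective (hi₁.trans hi₂.symm)
    obtain rfl := (face p).injective (hj₁.trans hj₂.symm)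
    obtain rfl := Finset.map_injective _ (hS₁.trans hS₂.symm)
    rfl
  · exact (main p' p hp' hp _ _ _ _ _ _ h (hi₂.trans hi₁.symm) (hj₂.trans hj₁.symm)
      (hS₂.trans hS₁.symm)).symm

/-- Every vertex lies on some face of the horn because there are at least three vertices. This fails
in dimension one, where an end point is missing and edges need a separate argument. -/
lemma exists_ne_ne {n : ℕ} (l v : Fin (n + 3)) : ∃ p, p ≠ l ∧ p ≠ v := by
  obtain ⟨p, hp⟩ : ∃ p, p ∉ ({l, v} : Finset (Fin (n + 3))) := by
    by_contra! h
    have := Finset.card_le_card (fun x _ => h x : (Finset.univ : Finset (Fin (n + 3))) ⊆ {l, v})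
    rw [Finset.card_univ, Fintype.card_fin] at this
    have := this.trans Finset.card_le_two
    omega
  simp only [Finset.mem_insert, Finset.mem_singleton, not_or] at hp
  exact ⟨p, hp⟩

/-- Compatible faces glue to an array. -/
lemma HornCompatible.exists_finArray (hf : HornCompatible f) :
    ∃ (X : Fin (n + 3) → A.Obj) (b : FinArray X), ∀ p hp i S j q, (f p hp).tot i S j q =
      ⟨(X (face p i), X (face p j)), b (face p i) (S.map (face p).toEmbedding) (face p j) q⟩ := by
  classical
  have hX : ∀ v : Fin (n + 3), ∃ X : A.Obj, ∀ t, FaceValue f v ∅ v 0 t → t.1.1 = X := by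
    intro v
    obtain ⟨p, hp, hpv⟩ := exists_ne_ne l v
    obtain ⟨v', rfl⟩ := Fin.exists_succAbove_eq hpv.symm
    refine ⟨((f p hp).tot v' ∅ v' 0).1.1, fun t ht => ?_⟩
    rw [ht.unique hf ⟨p, hp, v', v', ∅, rfl, rfl, by simp, rfl⟩]
  choose X hX using hX
  have hobj : ∀ p hp i, (f p hp).obj i = X (face p i) := fun p hp i =>
    hX (face p i) ((f p hp).tot i ∅ i 0) ⟨p, hp, i, i, ∅, rfl, rfl, by simp, rfl⟩
  have hb : ∀ i S j q, ∃ b : A.Hom (X i) (X j) q,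
      ∀ t, FaceValue f i S j q t → t = ⟨(X i, X j), b⟩ := by
    intro i S j q
    by_cases h : ∃ t, FaceValue f i S j q t
    · obtain ⟨t, ht⟩ := h
      have key : ∃ b : A.Hom (X i) (X j) q, t = ⟨(X i, X j), b⟩ := by
        obtain ⟨p, hp, i', j', S', rfl, rfl, -, rfl⟩ := ht
        rw [NerveSimplex.tot, ← hobj p hp, ← hobj p hp]
        exact ⟨_, rfl⟩
      obtain ⟨b, hb⟩ := key
      exact ⟨b, fun t' ht' => (ht'.unique hf ht).trans hb⟩
    -- Places on no face of the horn receive the default value `0`.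
    · exact ⟨0, fun t ht => absurd ⟨t, ht⟩ h⟩
  choose b hb using hb
  exact ⟨X, b, fun p hp i S j q => hb _ _ _ _ _ ⟨p, hp, i, j, S, rfl, rfl, rfl, rfl⟩⟩

variable {X : Fin (n + 3) → A.Obj} {b : FinArray X}

lemma InHorn.exists_face {i j : Fin (n + 3)} {S : Finset (Fin (n + 3))} (h : InHorn l i S j) :
    ∃ (p : Fin (n + 3)) (_ : p ≠ l) (i' j' : Fin (n + 2)) (S' : Finset (Fin (n + 2))),
      face p i' = i ∧ face p j' = j ∧ S'.map (face p).toEmbedding = S := by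
  obtain ⟨p, hp, hi, hj, hS⟩ := h
  obtain ⟨i', rfl⟩ := Fin.exists_succAbove_eq hi.symm
  obtain ⟨j', rfl⟩ := Fin.exists_succAbove_eq hj.symm
  obtain ⟨S', rfl⟩ := exists_map_face_eq hS
  exact ⟨p, hp, i', j', S', rfl, rfl, rfl⟩

lemma subset_Ioo_of_map_face {p : Fin (n + 3)} {i j : Fin (n + 2)} {S : Finset (Fin (n + 2))}
    (h : S.map (face p).toEmbedding ⊆ Finset.Ioo (face p i) (face p j)) : S ⊆ Finset.Ioo i j := by
  intro x hx
  have := Finset.mem_Ioo.1 (h (Finset.mem_map_of_mem _ hx))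
  exact Finset.mem_Ioo.2 ⟨(face p).lt_iff_lt.1 this.1, (face p).lt_iff_lt.1 this.2⟩

lemma map_face_subset_Ioo {p : Fin (n + 3)} {i j : Fin (n + 2)} {S : Finset (Fin (n + 2))}
    (h : S ⊆ Finset.Ioo i j) : S.map (face p).toEmbedding ⊆ Finset.Ioo (face p i) (face p j) := by
  intro x hx
  obtain ⟨y, hy, rfl⟩ := Finset.mem_map.1 hx
  have := Finset.mem_Ioo.1 (h hy)
  exact Finset.mem_Ioo.2 ⟨(face p).lt_iff_lt.2 this.1, (face p).lt_iff_lt.2 this.2⟩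

lemma isMCOnHorn_of_faces (hb : ∀ p hp i S j q, (f p hp).tot i S j q =
      ⟨(X (face p i), X (face p j)), b (face p i) (S.map (face p).toEmbedding) (face p j) q⟩) :
    b.IsMCOnHorn l := by
  intro i S j hij hS h
  obtain ⟨p, hp, i, j, S, rfl, rfl, rfl⟩ := h.exists_face
  exact (f p hp).isMC_of_tot_eq (face p) (hb p hp) ((face p).lt_iff_lt.1 hij)
    (subset_Ioo_of_map_face hS)

lemma NerveSimplex.tot_unit {m : ℕ} (x : NerveSimplex A m) (i : Fin (m + 1)) :
    x.tot i ∅ i 0 = ⟨(x.obj i, x.obj i), A.one (x.obj i)⟩ := by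
  have h : IsChain i [] i := by simp [IsChain]
  rw [tot, x.arr_empty h, x.unit h]

lemma one_of_faces (hb : ∀ p hp i S j q, (f p hp).tot i S j q =
      ⟨(X (face p i), X (face p j)), b (face p i) (S.map (face p).toEmbedding) (face p j) q⟩)
    (v : Fin (n + 3)) : b v ∅ v 0 = A.one (X v) := by
  obtain ⟨p, hp, hpv⟩ := exists_ne_ne l v
  obtain ⟨v, rfl⟩ := Fin.exists_succAbove_eq hpv.symm
  have h := hb p hp v ∅ v 0
  have h1 : (f p hp).obj v = X (face p v) := congrArg (fun t => t.1.1) h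
  rw [NerveSimplex.tot_unit, h1, Finset.map_empty] at h
  exact (eq_of_heq (Sigma.mk.inj h).2).symm

/-- Horns can be filled as soon as the equations can be corrected in a dg-ideal. -/
theorem exists_filler (J : DGIdeal A) (hb : ∀ p hp i S j q, (f p hp).tot i S j q =
      ⟨(X (face p i), X (face p j)), b (face p i) (S.map (face p).toEmbedding) (face p j) q⟩)
    (hdef : ∀ i S j, i < j → S ⊆ Finset.Ioo i j → ∀ ⦃q q' : ℤ⦄ (h : q + 1 = q'),
      q + S.card = 0 → b.defect i S j h ∈ J.mem _ _ _)
    (hl : l = 0 → J.ExactPre (b 0 ∅ 1 0) (X (Fin.last _)))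
    (hr : l = Fin.last _ → J.ExactPost (b (Fin.last (n + 1)).castSucc ∅ (Fin.last _) 0) (X 0)) :
    ∃ x : NerveSimplex A (n + 2), (∀ p hp, x.pullback (face p).toOrderHom = f p hp) ∧
      ∃ h : x.obj = X, ∀ i S j (q : ℤ), i < j → S ⊆ Finset.Ioo i j → q + S.card = 0 →
        (h ▸ x.arr : FinArray X) i S j q - b i S j q ∈ J.mem _ _ _ := by
  -- The corrected array agrees with `b` at all places of the horn (`hh`), so it retains the units
  -- and the prescribed faces.
  obtain ⟨b', hJ, hh, hMC⟩ := FinArray.exists_fill J (isMCOnHorn_of_faces hb) hdef hl hr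
  have hone : ∀ v, b' v ∅ v 0 = A.one (X v) := fun v => by
    rw [hh, one_of_faces hb]
    obtain ⟨p, hp, hpv⟩ := exists_ne_ne l v
    exact ⟨p, hp, hpv, hpv, by simp⟩
  refine ⟨.ofFinArray X b' hone hMC, fun p hp => ?_, rfl, fun i S j q hij hS hq => ?_⟩
  · refine NerveSimplex.ext_arr ?_ fun i S j q hij hS hq => ?_
    · funext i
      exact (congrArg (fun t => t.1.1) (hb p hp i ∅ i 0)).symm
    · rw [NerveSimplex.arr_pullback, NerveSimplex.arr_ofFinArray X b' hone hMC
        ((face p).lt_iff_lt.2 hij) (map_face_subset_Ioo hS) (by rw [Finset.card_map]; exact hq), hh]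
      · exact (Sigma.mk.inj (hb p hp i S j q)).2.symm
      · refine ⟨p, hp, (Fin.succAbove_ne _ _).symm, (Fin.succAbove_ne _ _).symm, fun h => ?_⟩
        obtain ⟨y, -, hy⟩ := Finset.mem_map.1 h
        exact Fin.succAbove_ne _ _ hy
  · have := NerveSimplex.arr_ofFinArray X b' hone hMC hij hS hq
    change (NerveSimplex.ofFinArray X b' hone hMC).arr i S j q - _ ∈ _
    rw [this]
    exact hJ i S j q

end Glue

end DGCat

end

noncomputable section

namespace DGCat

variable {R : Type u} [CommRing R] {A : DGCat R}

/-! ### Curvature -/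

/-- The curvature `dη + η²`. -/
def curv (A : DGCat R) {E : A.Obj} (η : A.Hom E E 1) : A.Hom E E 2 :=
  A.d one_add_one_eq_two η + A.comp one_add_one_eq_two η η

/-- The Bianchi identity for the curvature; it provides the closedness needed for the cone cocycle
when an end point of an edge is lifted. -/
lemma twistedD_curv {E : A.Obj} (η : A.Hom E E 1) : A.twistedD η η rfl (A.curv η) = 0 := by
  have e := A.d_comp one_add_one_eq_two (rfl : (2 : ℤ) + 1 = 2 + 1) one_add_one_eq_two
    one_add_one_eq_two (by norm_num) (by norm_num) η η
  have a := A.assoc one_add_one_eq_two (rfl : (2 : ℤ) + 1 = 2 + 1) one_add_one_eq_two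
    (by norm_num) η η η
  rw [twistedD_apply, curv, map_add, A.d_d, e, map_add, map_add, LinearMap.add_apply, a,
    Int.negOnePow_one, Int.negOnePow_even 2 even_two, one_smul, Units.neg_smul, one_smul]
  abel

/-- No Maurer-Cartan equation is imposed: arbitrary lifts of Maurer-Cartan elements have curvature,
and this measures by how much the twisted differential fails to square to zero. -/
lemma twistedD_twistedD_eq_curv {E F : A.Obj} (η : A.Hom E E 1) (ζ : A.Hom F F 1) {i j l : ℤ}
    (h : i + 1 = j) (h' : j + 1 = l) (h₂ : 2 + i = l) (h₃ : i + 2 = l) (f : A.Hom E F i) :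
    A.twistedD η ζ h' (A.twistedD η ζ h f) =
      A.comp h₂ (A.curv ζ) f - A.comp h₃ f (A.curv η) := by
  have e1 := A.d_comp ((add_comm 1 i).trans h) h' one_add_one_eq_two h h₂
    ((add_comm 1 j).trans h') ζ f
  have e2 := A.d_comp h h' h one_add_one_eq_two h' h₃ f η
  have a1 := A.assoc one_add_one_eq_two h₂ ((add_comm 1 i).trans h)
    ((add_comm 1 j).trans h') ζ ζ f
  have a2 := A.assoc h h' one_add_one_eq_two h₃ f η η
  have a3 := A.assoc ((add_comm 1 i).trans h) h' h ((add_comm 1 j).trans h') ζ f η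
  have hs : j.negOnePow = -i.negOnePow := by rw [← h, Int.negOnePow_succ]
  rcases Int.even_or_odd i with he | he
  · have hi := Int.negOnePow_even i he
    rw [hi] at e2 hs
    simp only [curv, twistedD_apply, map_add, map_sub, A.d_d, hi, hs, one_smul, Units.neg_smul, e1,
      e2, Int.negOnePow_one, a3, LinearMap.add_apply, a1, a2]
    abel
  · have hi := Int.negOnePow_odd i he
    rw [hi] at e2 hs
    simp only [curv, twistedD_apply, map_add, map_sub, map_neg, A.d_d, hi, hs, one_smul,
      Units.neg_smul, neg_neg, e1, e2, Int.negOnePow_one, a3, LinearMap.add_apply,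
      a1, a2]
    abel

/-- For `v` in an ideal of square zero the last term vanishes, so that the curvature is affine in
`v` with linear part the twisted differential. -/
lemma curv_add {E : A.Obj} (η v : A.Hom E E 1) :
    A.curv (η + v) = A.curv η + A.twistedD η η one_add_one_eq_two v +
      A.comp one_add_one_eq_two v v := by
  simp only [curv, twistedD_apply, map_add, LinearMap.add_apply, Int.negOnePow_one, Units.neg_smul,
    one_smul]
  abel

lemma Functor.map_curv {S T : Type u} [CommRing S] [CommRing T] {A : DGCat S} {A' : DGCat T}
    (F : Functor A A') {E : A.Obj} (η : A.Hom E E 1) : F.map (A.curv η) = A'.curv (F.map η) := by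
  rw [curv, curv, map_add, F.map_d, F.map_comp]

/-! ### Lifting along square-zero extensions -/

section SquareZero

variable {S T : Type u} [CommRing S] [CommRing T] {A : DGCat S} {A' : DGCat T}

/-- A dg-functor which is surjective on objects and morphisms, and whose kernel has zero square. -/
structure Functor.IsSquareZero (F : Functor A A') : Prop where
  obj_surjective : Function.Surjective F.obj
  map_surjective : ∀ X Y i, Function.Surjective (F.map (X := X) (Y := Y) (i := i))
  comp_eq_zero : ∀ {X Y Z : A.Obj} {i j n : ℤ} (h : i + j = n) (f : A.Hom Y Z i) (g : A.Hom X Y j),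
    F.map f = 0 → F.map g = 0 → A.comp h f g = 0

variable {F : Functor A A'}

/-- Lift `ζ'` and `α'` arbitrarily to `ζ` and `α`. The curvature `c` of `ζ` and the twisted
differential `e` of `α` lie in the kernel, `c` is closed, and `De = cα` because `η` is
Maurer-Cartan. Thus `(c, e)` is a cocycle in the cone of `α^*` on the kernel, which is exact. If `Dv
= c` and `e = vα + Du`, then `ζ - v` and `α - u` are the required lifts, all products of two
elements of the kernel being zero. -/
lemma Functor.IsSquareZero.exists_lift_target (hF : F.IsSquareZero) {E Y : A.Obj}
    {η : A.Hom E E 1} (hη : A.curv η = 0) {ζ' : A'.Hom (F.obj Y) (F.obj Y) 1}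
    (hζ' : A'.curv ζ' = 0) {α' : A'.Hom (F.obj E) (F.obj Y) 0}
    (hα' : (MC A').IsEquivalence (X := ⟨F.obj E, F.map η, by
      rw [← curv, ← F.map_curv, hη, map_zero]⟩) (Y := ⟨F.obj Y, ζ', hζ'⟩) α') :
    ∃ (ζ : A.Hom Y Y 1) (α : A.Hom E Y 0), A.curv ζ = 0 ∧ A.twistedD η ζ (zero_add 1) α = 0 ∧
      F.map ζ = ζ' ∧ F.map α = α' := by
  obtain ⟨ζ, rfl⟩ := hF.map_surjective _ _ _ ζ'
  obtain ⟨α, rfl⟩ := hF.map_surjective _ _ _ α'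
  obtain ⟨hd, g, hg, hX, hY⟩ := hα'
  obtain ⟨H⟩ := F.nonempty_htpyInv_ker hF.map_surjective hF.comp_eq_zero (ηX := η) (ηY := ζ)
    (f := α) (g := g) hd hg hX hY
  have hc : A.curv ζ ∈ F.ker.mem _ _ _ := by rw [F.mem_ker, F.map_curv, hζ']
  have he : A.twistedD η ζ (zero_add 1) α ∈ F.ker.mem _ _ _ := by
    rw [F.mem_ker, F.map_twistedD]; exact hd
  obtain ⟨v, hv, u, hu, e1, e2⟩ := H.exact_precomp ζ (zero_add 1) one_add_one_eq_two (add_zero 2)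
    (add_zero 1) hc he (twistedD_curv ζ) (by
      rw [twistedD_twistedD_eq_curv η ζ (zero_add 1) one_add_one_eq_two (add_zero 2) (zero_add 2),
        hη, map_zero, sub_zero])
  rw [F.mem_ker] at hv hu
  refine ⟨ζ - v, α - u, ?_, ?_, by rw [map_sub, hv, sub_zero], by rw [map_sub, hu, sub_zero]⟩
  · rw [sub_eq_add_neg, curv_add, map_neg, e1, hF.comp_eq_zero _ _ _ (by rw [map_neg, hv, neg_zero])
      (by rw [map_neg, hv, neg_zero])]
    abel
  · have h0 : A.comp (add_zero 1) v u = 0 := hF.comp_eq_zero _ _ _ hv hu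
    have : A.twistedD η (ζ - v) (zero_add 1) (α - u) = A.twistedD η ζ (zero_add 1) α -
        (A.comp (add_zero 1) v α + A.twistedD η ζ (zero_add 1) u) + A.comp (add_zero 1) v u := by
      simp only [twistedD_apply, map_sub, LinearMap.sub_apply]
      abel
    rw [this, ← e2, h0, sub_self, zero_add]

/-- The mirror image, with the cone of `α_*`. Here `De = -αc`, so the cocycle is `(-c, e)` and the
Maurer-Cartan element is corrected by adding `v`. -/
lemma Functor.IsSquareZero.exists_lift_source (hF : F.IsSquareZero) {E Y : A.Obj}
    {η : A.Hom E E 1} (hη : A.curv η = 0) {ζ' : A'.Hom (F.obj Y) (F.obj Y) 1}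
    (hζ' : A'.curv ζ' = 0) {α' : A'.Hom (F.obj Y) (F.obj E) 0}
    (hα' : (MC A').IsEquivalence (X := ⟨F.obj Y, ζ', hζ'⟩) (Y := ⟨F.obj E, F.map η, by
      rw [← curv, ← F.map_curv, hη, map_zero]⟩) α') :
    ∃ (ζ : A.Hom Y Y 1) (α : A.Hom Y E 0), A.curv ζ = 0 ∧ A.twistedD ζ η (zero_add 1) α = 0 ∧
      F.map ζ = ζ' ∧ F.map α = α' := by
  obtain ⟨ζ, rfl⟩ := hF.map_surjective _ _ _ ζ'
  obtain ⟨α, rfl⟩ := hF.map_surjective _ _ _ α'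
  obtain ⟨hd, g, hg, hX, hY⟩ := hα'
  obtain ⟨H⟩ := F.nonempty_htpyInv_ker hF.map_surjective hF.comp_eq_zero (ηX := ζ) (ηY := η)
    (f := α) (g := g) hd hg hX hY
  have hc : -A.curv ζ ∈ F.ker.mem _ _ _ := by rw [F.mem_ker, map_neg, F.map_curv, hζ', neg_zero]
  have he : A.twistedD ζ η (zero_add 1) α ∈ F.ker.mem _ _ _ := by
    rw [F.mem_ker, F.map_twistedD]; exact hd
  obtain ⟨v, hv, u, hu, e1, e2⟩ := H.exact_postcomp ζ (zero_add 1) one_add_one_eq_two (zero_add 2)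
    (zero_add 1) hc he (by rw [map_neg, twistedD_curv ζ, neg_zero]) (by
      rw [twistedD_twistedD_eq_curv ζ η (zero_add 1) one_add_one_eq_two (add_zero 2) (zero_add 2),
        hη, map_zero, LinearMap.zero_apply, zero_sub, map_neg])
  rw [F.mem_ker] at hv hu
  refine ⟨ζ + v, α - u, ?_, ?_, by rw [map_add, hv, add_zero], by rw [map_sub, hu, sub_zero]⟩
  · rw [curv_add, e1, hF.comp_eq_zero _ _ _ hv hv]
    abel
  · have h0 : A.comp (zero_add 1) u v = 0 := hF.comp_eq_zero _ _ _ hu hv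
    have : A.twistedD (ζ + v) η (zero_add 1) (α - u) = A.twistedD ζ η (zero_add 1) α -
        (A.comp (zero_add 1) α v + A.twistedD ζ η (zero_add 1) u) + A.comp (zero_add 1) u v := by
      simp only [twistedD_apply, map_add, map_sub, Int.negOnePow_zero, one_smul]
      abel
    rw [this, ← e2, h0, sub_self, zero_add]

/-- On a kernel of square zero composition with `f` depends only on the image of `f`, so
invertibility of the image up to homotopy is enough. -/
lemma Functor.IsSquareZero.exactPre (hF : F.IsSquareZero) {X Y : (MC A).Obj}
    {f : (MC A).Hom X Y 0} (hf : (MC A').IsEquivalence ((MC.map F).map f)) (Z : (MC A).Obj) :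
    (MC.map F).ker.ExactPre f Z := by
  obtain ⟨hd, g, hg, hX, hY⟩ := hf
  obtain ⟨H⟩ := F.nonempty_htpyInv_ker hF.map_surjective hF.comp_eq_zero (ηX := X.2.1)
    (ηY := Y.2.1) (f := f) (g := g) hd hg hX hY
  intro r p q hr hp b a hb ha db da
  exact H.exact_precomp Z.2.1 hr hp (add_zero q) (add_zero p) hb ha db da

lemma Functor.IsSquareZero.exactPost (hF : F.IsSquareZero) {X Y : (MC A).Obj}
    {f : (MC A).Hom X Y 0} (hf : (MC A').IsEquivalence ((MC.map F).map f)) (Z : (MC A).Obj) :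
    (MC.map F).ker.ExactPost f Z := by
  obtain ⟨hd, g, hg, hX, hY⟩ := hf
  obtain ⟨H⟩ := F.nonempty_htpyInv_ker hF.map_surjective hF.comp_eq_zero (ηX := X.2.1)
    (ηY := Y.2.1) (f := f) (g := g) hd hg hX hY
  intro r p q hr hp b a hb ha db da
  exact H.exact_postcomp Z.2.1 hr hp (zero_add q) (zero_add p) hb ha db da

/-- The absolute case, used for filling horns over a field: on the unit ideal `f` itself has to be
an equivalence. -/
lemma IsEquivalence.exactPre_top {X Y : (MC A).Obj} {f : (MC A).Hom X Y 0}
    (hf : (MC A).IsEquivalence f) (Z : (MC A).Obj) : (DGIdeal.top (MC A)).ExactPre f Z := by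
  obtain ⟨H⟩ := hf.nonempty_htpyInv (DGIdeal.top A)
  intro r p q hr hp b a hb ha db da
  exact H.exact_precomp Z.2.1 hr hp (add_zero q) (add_zero p) hb ha db da

lemma IsEquivalence.exactPost_top {X Y : (MC A).Obj} {f : (MC A).Hom X Y 0}
    (hf : (MC A).IsEquivalence f) (Z : (MC A).Obj) : (DGIdeal.top (MC A)).ExactPost f Z := by
  obtain ⟨H⟩ := hf.nonempty_htpyInv (DGIdeal.top A)
  intro r p q hr hp b a hb ha db da
  exact H.exact_postcomp Z.2.1 hr hp (zero_add q) (zero_add p) hb ha db da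

end SquareZero

/-! ### Simplices of `NC*` -/

namespace NerveSimplex

/-- All edges are equivalences. -/
def IsStar {n : ℕ} (x : NerveSimplex A n) : Prop :=
  ∀ (i j : Fin (n + 1)) (h : IsChain i [] j), A.IsEquivalence (x.α h 0 (by simp))

lemma isStar_iff_arr {n : ℕ} (x : NerveSimplex A n) :
    x.IsStar ↔ ∀ i j, i < j → A.IsEquivalence (x.arr i ∅ j 0) := by
  have hc : ∀ {i j : Fin (n + 1)}, i ≤ j → IsChain i [] j := fun h => by simpa [IsChain] using h
  constructor
  · intro h i j hij
    rw [x.arr_empty (hc hij.le)]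
    exact h i j _
  · intro h i j hij
    rcases hij.le.eq_or_lt with rfl | h'
    · rw [x.unit]; exact .one _
    · rw [← x.arr_empty]; exact h i j h'

lemma IsStar.pullback {m n : ℕ} {x : NerveSimplex A n} (hx : x.IsStar)
    (θ : Fin (m + 1) →o Fin (n + 1)) : (x.pullback θ).IsStar :=
  fun _ _ h => hx _ _ (h.map θ)

lemma IsStar.map {S T : Type u} [CommRing S] [CommRing T] {A : DGCat S} {A' : DGCat T}
    {n : ℕ} {x : NerveSimplex A n} (hx : x.IsStar) (F : Functor A A') :
    (NerveSimplex.map F x).IsStar :=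
  fun i j h => F.map_isEquivalence (hx i j h)

lemma d_arr_empty {n : ℕ} (x : NerveSimplex A n) {i j : Fin (n + 1)} (h : i < j) :
    A.d (zero_add 1) (x.arr i ∅ j 0) = 0 := by
  have := x.arr_isMC h (Finset.empty_subset _) (zero_add 1) (by simp)
  simpa [FinArray.defect, FinArray.rhs] using this

/-- The value at the triangle `(a, b, c)` is the homotopy: its Maurer-Cartan equation is exactly the
assertion. -/
lemma homotopic_arr {n : ℕ} (x : NerveSimplex A n) {a b c : Fin (n + 1)} (hab : a < b)
    (hbc : b < c) :
    A.Homotopic (A.comp (add_zero 0) (x.arr b ∅ c 0) (x.arr a ∅ b 0)) (x.arr a ∅ c 0) := by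
  have h := x.arr_isMC (S := {b}) (hab.trans hbc) (by simp [hab, hbc])
    (show (-1 : ℤ) + 1 = 0 by norm_num) (by simp)
  refine ⟨x.arr a {b} c (-1), ?_⟩
  rw [FinArray.defect, sub_eq_zero] at h
  have h1 : ({b} : Finset (Fin (n + 1))).above b = ∅ := by ext y; simp [Finset.mem_above]; aesop
  have h2 : ({b} : Finset (Fin (n + 1))).below b = ∅ := by ext y; simp [Finset.mem_below]; aesop
  have key : ∀ (U V W : Finset (Fin (n + 1))) (r s : ℤ), U = ∅ → V = ∅ → W = ∅ → r = 0 → s = 0 →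
      A.tcomp 0 (x.arr b U c r) (x.arr a V b s) - x.arr a W c 0 =
      A.comp (add_zero 0) (x.arr b ∅ c 0) (x.arr a ∅ b 0) - x.arr a ∅ c 0 := by
    rintro _ _ _ _ _ rfl rfl rfl rfl rfl
    rw [tcomp_eq]
  rw [h, FinArray.rhs, Finset.sum_singleton,
    key _ _ _ _ _ h1 h2 (by simp) (by rw [h1]; simp) (by rw [h2]; simp), h1]
  simp

/-- Edges on a triangle: two equivalences out of three suffice. -/
lemma isEquivalence_of_triangle {n : ℕ} (x : NerveSimplex A n) {i j l : Fin (n + 1)} (hij : i < j)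
    (hi : l < i → A.IsEquivalence (x.arr l ∅ i 0)) (hi' : i < l → A.IsEquivalence (x.arr i ∅ l 0))
    (hj : l < j → A.IsEquivalence (x.arr l ∅ j 0)) (hj' : j < l → A.IsEquivalence (x.arr j ∅ l 0))
    (hli : l ≠ i) (hlj : l ≠ j) : A.IsEquivalence (x.arr i ∅ j 0) := by
  rcases lt_or_gt_of_ne hli with h1 | h1
  · exact .of_comp_left (x.homotopic_arr h1 hij) (x.d_arr_empty hij) (hi h1) (hj (h1.trans hij))
  · rcases lt_or_gt_of_ne hlj with h2 | h2
    · exact ((hj h2).comp (hi' h1)).of_homotopic (x.d_arr_empty hij) (x.homotopic_arr h1 h2).symm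
    · exact .of_comp_right (x.homotopic_arr hij h2) (x.d_arr_empty hij) (hj' h2)
        (hi' (hij.trans h2))

lemma arr_map {S T : Type u} [CommRing S] [CommRing T] {A : DGCat S} {A' : DGCat T}
    (F : Functor A A') {n : ℕ} (x : NerveSimplex A n) (i : Fin (n + 1)) (s : Finset (Fin (n + 1)))
    (j : Fin (n + 1)) (q : ℤ) : (x.map F).arr i s j q = F.map (x.arr i s j q) := by
  rw [arr, arr]
  split_ifs with h
  · rfl
  · exact (map_zero F.map).symm

end NerveSimplex

/-- The image of a morphism, together with its source and target. -/
def Functor.mapTot {S T : Type u} [CommRing S] [CommRing T] {A : DGCat S} {A' : DGCat T}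
    (F : Functor A A') {q : ℤ} (t : Σ XY : A.Obj × A.Obj, A.Hom XY.1 XY.2 q) :
    Σ XY : A'.Obj × A'.Obj, A'.Hom XY.1 XY.2 q :=
  ⟨(F.obj t.1.1, F.obj t.1.2), F.map t.2⟩

lemma NerveSimplex.tot_map {S T : Type u} [CommRing S] [CommRing T] {A : DGCat S} {A' : DGCat T}
    (F : Functor A A') {n : ℕ} (x : NerveSimplex A n) (i : Fin (n + 1)) (s : Finset (Fin (n + 1)))
    (j : Fin (n + 1)) (q : ℤ) : (x.map F).tot i s j q = F.mapTot (x.tot i s j q) := by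
  rw [tot, arr_map]; rfl

/-- The image of an array. -/
def FinArray.map {S T : Type u} [CommRing S] [CommRing T] {A : DGCat S} {A' : DGCat T}
    (F : Functor A A') {ι : Type} [LinearOrder ι] {X : ι → A.Obj} (b : FinArray X) :
    FinArray (F.obj ∘ X) := fun i s j q => F.map (b i s j q)

lemma FinArray.defect_map {S T : Type u} [CommRing S] [CommRing T] {A : DGCat S} {A' : DGCat T}
    (F : Functor A A') {ι : Type} [LinearOrder ι] {X : ι → A.Obj} (b : FinArray X) (i : ι)
    (s : Finset ι) (j : ι) {q q' : ℤ} (h : q + 1 = q') :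
    F.map (b.defect i s j h) = (b.map F).defect i s j h := by
  rw [FinArray.defect, FinArray.defect, map_sub, F.map_d, FinArray.rhs, FinArray.rhs, map_sum]
  congr 1
  refine Finset.sum_congr rfl fun p _ => ?_
  rw [map_zsmul, map_sub]
  congr 2
  by_cases e : -((s.above p).card : ℤ) + -((s.below p).card : ℤ) = q'
  · rw [tcomp_eq e, tcomp_eq e, F.map_comp]; rfl
  · rw [tcomp, tcomp, dif_neg e, dif_neg e]
    exact map_zero F.map

end DGCat

end

/-! ### Lifting and filling of horns and edges in `NC*` -/

noncomputable section

namespace DGCat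

section

variable {S T : Type u} [CommRing S] [CommRing T] {A : DGCat S} {A' : DGCat T} {F : Functor A A'}

/-- Horns of dimension at least two lift along square-zero extensions. -/
theorem HornCompatible.exists_lift (hF : F.IsSquareZero) {n : ℕ} {l : Fin (n + 3)}
    {f : ∀ p : Fin (n + 3), p ≠ l → NerveSimplex (MC A) (n + 1)} (hf : HornCompatible f)
    {y : NerveSimplex (MC A') (n + 2)} (hy : y.IsStar)
    (hfy : ∀ p hp, (f p hp).map (MC.map F) = y.pullback (face p).toOrderHom) :
    ∃ x : NerveSimplex (MC A) (n + 2), (∀ p hp, x.pullback (face p).toOrderHom = f p hp) ∧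
      x.map (MC.map F) = y := by
  obtain ⟨X, b₀, hb₀⟩ := hf.exists_finArray
  have hface : ∀ p (_ : p ≠ l) i (s : Finset (Fin (n + 2))) j q, y.tot (face p i) (s.map (face p).toEmbedding) (face p j) q =
      (MC.map F).mapTot ⟨(X (face p i), X (face p j)),
        b₀ (face p i) (s.map (face p).toEmbedding) (face p j) q⟩ := fun p hp i s j q => by
    rw [← NerveSimplex.tot_pullback, ← hfy p hp, NerveSimplex.tot_map, hb₀ p hp]
  have hobj : ∀ v, y.obj v = (MC.map F).obj (X v) := fun v => by
    obtain ⟨p, hp, hpv⟩ := exists_ne_ne l v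
    obtain ⟨v, rfl⟩ := Fin.exists_succAbove_eq hpv.symm
    exact congrArg (fun t => t.1.1) (hface p hp v ∅ v 0)
  -- On the horn the given values are kept; elsewhere any lift of the values of `y` will do.
  have key : ∀ i s j q, ∃ b : (MC A).Hom (X i) (X j) q, (InHorn l i s j → b = b₀ i s j q) ∧
      y.tot i s j q = (MC.map F).mapTot ⟨(X i, X j), b⟩ := by
    intro i s j q
    by_cases h : InHorn l i s j
    · refine ⟨b₀ i s j q, fun _ => rfl, ?_⟩
      obtain ⟨p, hp, i, j, s, rfl, rfl, rfl⟩ := h.exists_face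
      exact hface p hp i s j q
    · rw [NerveSimplex.tot]
      generalize y.arr i s j q = c
      revert c
      rw [hobj i, hobj j]
      intro c
      obtain ⟨b, hb⟩ := hF.map_surjective (X i).1 (X j).1 q c
      exact ⟨b, fun h' => absurd h' h, by rw [← hb]; rfl⟩
  choose b hb hby using key
  have hbf : ∀ p hp i (s : Finset (Fin (n + 2))) j q, (f p hp).tot i s j q =
      ⟨(X (face p i), X (face p j)), b (face p i) (s.map (face p).toEmbedding) (face p j) q⟩ := by
    intro p hp i s j q
    rw [hb₀, hb]
    refine ⟨p, hp, (Fin.succAbove_ne _ _).symm, (Fin.succAbove_ne _ _).symm, fun h => ?_⟩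
    obtain ⟨z, -, hz⟩ := Finset.mem_map.1 h
    exact Fin.succAbove_ne _ _ hz
  have hyb : ∀ i s j q, y.tot i s j q = ⟨(((MC.map F).obj ∘ X) i, ((MC.map F).obj ∘ X) j),
      FinArray.map (MC.map F) b i s j q⟩ := hby
  have hedge : ∀ i j, i < j → (MC A').IsEquivalence ((MC.map F).map (b i ∅ j 0)) := by
    intro i j hij
    have h1 : (MC A').IsEquivalence (y.tot i ∅ j 0).2 := (y.isStar_iff_arr.1 hy) i j hij
    rw [hby] at h1
    exact h1
  -- The image of `b` satisfies the equations, being the array of `y`, so the defects of `b` lie in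
  -- the kernel. Corrections by elements of the kernel do not change the image. Taking the identity
  -- as embedding allows `isMC_of_tot_eq` to be applied to `y` itself.
  obtain ⟨x, hx, hxX, hxb⟩ := exists_filler (MC.map F).ker hbf (fun i s j hij hs q q' h hq => by
      rw [Functor.mem_ker, FinArray.defect_map]
      have := y.isMC_of_tot_eq (RelEmbedding.refl _) (X := (MC.map F).obj ∘ X)
        (b := FinArray.map (MC.map F) b) (fun i s j q => by
          rw [show s.map (RelEmbedding.refl (α := Fin (n + 3)) (· ≤ ·)).toEmbedding = s from
            Finset.map_refl]
          exact hyb i s j q) hij hs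
      rw [show s.map (RelEmbedding.refl (α := Fin (n + 3)) (· ≤ ·)).toEmbedding = s from
            Finset.map_refl] at this
      exact this h hq)
    (fun _ => hF.exactPre (hedge 0 1 Fin.zero_lt_one) _)
    (fun _ => hF.exactPost (hedge _ _ (Fin.castSucc_lt_last _)) _)
  refine ⟨x, hx, ?_⟩
  subst hxX
  refine NerveSimplex.ext_arr (funext fun v => (hobj v).symm) fun i s j q hij hs hq => ?_
  have h1 := hxb i s j q hij hs hq
  rw [Functor.mem_ker, map_sub, sub_eq_zero] at h1
  rw [NerveSimplex.arr_map, h1]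
  exact (Sigma.mk.inj (hby i s j q)).2.symm

/-- Horns of dimension at least two in `NC*` have fillers. -/
theorem HornCompatible.exists_isStar_filler {n : ℕ} {l : Fin (n + 3)}
    {f : ∀ p : Fin (n + 3), p ≠ l → NerveSimplex (MC A) (n + 1)} (hf : HornCompatible f)
    (hs : ∀ p hp, (f p hp).IsStar) :
    ∃ x : NerveSimplex (MC A) (n + 2), (∀ p hp, x.pullback (face p).toOrderHom = f p hp) ∧
      x.IsStar := by
  obtain ⟨X, b, hb⟩ := hf.exists_finArray
  have hedge : ∀ i j, i < j → InHorn l i ∅ j → (MC A).IsEquivalence (b i ∅ j 0) := by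
    intro i j hij h
    obtain ⟨p, hp, i, j, s, rfl, rfl, hs'⟩ := h.exists_face
    obtain rfl : s = ∅ := by simpa using hs'
    have h1 : (MC A).IsEquivalence ((f p hp).tot i ∅ j 0).2 :=
      ((f p hp).isStar_iff_arr.1 (hs p hp)) i j ((face p).lt_iff_lt.1 hij)
    rw [hb, Finset.map_empty] at h1
    exact h1
  -- With the unit ideal the condition on defects is void. The first edge, for `Λ^0`, and the last
  -- edge, for the last horn, belong to the horn and are therefore equivalences.
  obtain ⟨x, hx, -⟩ := exists_filler (DGIdeal.top (MC A)) hb (fun _ _ _ _ _ _ _ _ _ => trivial)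
    (fun h => (hedge 0 1 Fin.zero_lt_one (by
      subst h
      exact ⟨Fin.last _, by simp [Fin.ext_iff], by simp [Fin.ext_iff], by simp [Fin.ext_iff], by simp⟩)).exactPre_top _)
    (fun h => (hedge _ _ (Fin.castSucc_lt_last _) (by
      subst h
      exact ⟨0, by simp [Fin.ext_iff], by simp [Fin.ext_iff], by simp [Fin.ext_iff], by simp⟩)).exactPost_top _)
  refine ⟨x, hx, x.isStar_iff_arr.2 ?_⟩
  have hin : ∀ i j, i < j → InHorn l i ∅ j → (MC A).IsEquivalence (x.arr i ∅ j 0) := by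
    intro i j hij h
    obtain ⟨p, hp, i, j, s, rfl, rfl, -⟩ := h.exists_face
    have h1 := ((f p hp).isStar_iff_arr.1 (hs p hp)) i j ((face p).lt_iff_lt.1 hij)
    have h2 : (MC A).IsEquivalence ((f p hp).tot i ∅ j 0).2 := h1
    rw [← hx p hp, NerveSimplex.tot_pullback, Finset.map_empty] at h2
    exact h2
  have hl : ∀ v w, v ≠ w → InHorn l l ∅ v := fun v w h => by
    obtain ⟨p, h1, h2⟩ := exists_ne_ne l v
    exact ⟨p, h1, h1, h2, by simp⟩
  intro i j hij
  -- An edge outside the horn exists only for a triangle and is then the edge opposite to `l`; the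
  -- two edges through `l` are equivalences, so the third is one as well.
  by_cases h : InHorn l i ∅ j
  · exact hin i j hij h
  have hsymm : ∀ {v w}, InHorn l v ∅ w → InHorn l w ∅ v := by
    rintro v w ⟨p, h1, h2, h3, h4⟩
    exact ⟨p, h1, h3, h2, h4⟩
  have hli : l ≠ i := by
    rintro rfl; exact h (hl j l hij.ne')
  have hlj : l ≠ j := by
    rintro rfl; exact h (hsymm (hl i l hij.ne))
  exact x.isEquivalence_of_triangle hij (fun h => hin _ _ h (hl _ _ h.ne'))
    (fun h => hin _ _ h (hsymm (hl _ _ h.ne))) (fun h => hin _ _ h (hl _ _ h.ne'))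
    (fun h => hin _ _ h (hsymm (hl _ _ h.ne))) hli hlj

end

section Edges

variable {R : Type u} [CommRing R] {A : DGCat R}

/-- A `0`-simplex is an object. -/
lemma NerveSimplex.ext_zero {x y : NerveSimplex A 0} (h : x.obj 0 = y.obj 0) : x = y := by
  refine ext_arr (funext fun i => ?_) fun i s j q hij => ?_
  · rw [Fin.fin_one_eq_zero i, h]
  · exact absurd ((Fin.fin_one_eq_zero i).trans (Fin.fin_one_eq_zero j).symm) hij.ne

/-- A closed morphism of degree zero is an edge. -/
lemma NerveSimplex.exists_edge {X Y : A.Obj} (f : A.Hom X Y 0) (hf : A.d (zero_add 1) f = 0) :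
    ∃ x : NerveSimplex A 1, x.tot 0 ∅ 1 0 = ⟨(X, Y), f⟩ := by
  -- The types depend on `i` and `j`, so the unit and `f` are prescribed by heterogeneous
  -- equalities; all other values are set to `0`.
  have key : ∀ (i : Fin 2) (_ : Finset (Fin 2)) (j : Fin 2) (q : ℤ),
      ∃ b : A.Hom (![X, Y] i) (![X, Y] j) q, (i = j → q = 0 → b ≍ A.one (![X, Y] i)) ∧
        (i = 0 → j = 1 → q = 0 → b ≍ f) := by
    intro i _ j q
    by_cases hq : q = 0
    · subst hq
      by_cases hij : i = j
      · subst hij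
        exact ⟨A.one _, fun _ _ => HEq.rfl, fun h h' => absurd (h.symm.trans h') (by simp)⟩
      · by_cases h : i = 0 ∧ j = 1
        · obtain ⟨rfl, rfl⟩ := h
          exact ⟨f, fun h => absurd h hij, fun _ _ _ => HEq.rfl⟩
        · exact ⟨0, fun h => absurd h hij, fun h1 h2 => absurd ⟨h1, h2⟩ h⟩
    · exact ⟨0, fun _ h => absurd h hq, fun _ _ h => absurd h hq⟩
  choose b hb hb' using key
  have h01 : ∀ i j : Fin 2, i < j → i = 0 ∧ j = 1 := by decide
  have hbf : b 0 ∅ 1 0 = f := eq_of_heq (hb' 0 ∅ 1 0 rfl rfl rfl)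
  have hMC : ∀ i s j, i < j → s ⊆ Finset.Ioo i j → FinArray.IsMC (A := A) b i s j := by
    intro i s j hij hs q q' h hq
    obtain ⟨rfl, rfl⟩ := h01 i j hij
    obtain rfl : s = ∅ := by
      refine Finset.subset_empty.1 (hs.trans ?_)
      decide
    obtain rfl : q = 0 := by simpa using hq
    obtain rfl : q' = 1 := by omega
    rw [FinArray.defect, hbf, FinArray.rhs, Finset.sum_empty, sub_zero]
    exact hf
  refine ⟨.ofFinArray _ b (fun i => eq_of_heq (hb i ∅ i 0 rfl rfl)) hMC, ?_⟩
  rw [tot, arr_ofFinArray _ b _ _ (by decide) (by simp) (by simp), hbf]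
  rfl

lemma NerveSimplex.ext_one {x y : NerveSimplex A 1} (h : x.tot 0 ∅ 1 0 = y.tot 0 ∅ 1 0) :
    x = y := by
  refine ext_arr (funext fun i => ?_) fun i s j q hij hs hq => ?_
  · fin_cases i
    · exact congrArg (fun t => t.1.1) h
    · exact congrArg (fun t => t.1.2) h
  · have h01 : ∀ i j : Fin 2, i < j → i = 0 ∧ j = 1 := by decide
    obtain ⟨rfl, rfl⟩ := h01 i j hij
    obtain rfl : s = ∅ := by
      refine Finset.subset_empty.1 (hs.trans ?_)
      decide
    obtain rfl : q = 0 := by simpa using hq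
    exact (Sigma.mk.inj h).2

variable {S T : Type u} [CommRing S] [CommRing T] {A : DGCat S} {A' : DGCat T} {F : Functor A A'}

/-- Edges lift along square-zero extensions, with a prescribed end point. -/
theorem NerveSimplex.exists_lift_edge (hF : F.IsSquareZero) (v : Fin 2)
    {f : NerveSimplex (MC A) 0} {y : NerveSimplex (MC A') 1} (hy : y.IsStar)
    (hfy : f.map (MC.map F) = y.pullback (face v).toOrderHom) :
    ∃ x : NerveSimplex (MC A) 1, x.pullback (face v).toOrderHom = f ∧ x.map (MC.map F) = y := by
  have hobj : (MC.map F).obj (f.obj 0) = y.obj (face v 0) :=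
    congrArg (fun x => NerveSimplex.obj x 0) hfy
  have hα : (MC A').IsEquivalence (y.arr 0 ∅ 1 0) := y.isStar_iff_arr.1 hy 0 1 (by decide)
  have hyt : y.tot 0 ∅ 1 0 = ⟨(y.obj 0, y.obj 1), y.arr 0 ∅ 1 0⟩ := rfl
  generalize y.arr 0 ∅ 1 0 = α at hα hyt
  suffices H : ∃ (X Y : (MC A).Obj) (a : (MC A).Hom X Y 0), (MC A).d (zero_add 1) a = 0 ∧
      (![X, Y] (face v 0) = f.obj 0) ∧ (MC.map F).mapTot ⟨(X, Y), a⟩ = y.tot 0 ∅ 1 0 by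
    obtain ⟨X, Y, a, ha, h0, hm⟩ := H
    obtain ⟨x, hx⟩ := exists_edge a ha
    refine ⟨x, ext_zero ?_, ext_one ?_⟩
    · rw [← h0]
      change x.obj (face v 0) = _
      have h2 : ∀ i, x.obj i = ![X, Y] i := fun i => by
        fin_cases i
        · exact congrArg (fun t => t.1.1) hx
        · exact congrArg (fun t => t.1.2) hx
      exact h2 _
    · rw [NerveSimplex.tot_map, hx, hm]
  rw [hyt]
  clear hyt
  generalize hY0 : y.obj 0 = Y0 at α hα
  generalize hY1 : y.obj 1 = Y1 at α hα
  generalize f.obj 0 = E at hobj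
  obtain ⟨E, η, hη⟩ := E
  -- The face opposite to the vertex `0` is the vertex `1`, so for `v = 0` the target is given and
  -- the source is lifted; for `v = 1` it is the other way round.
  fin_cases v
  · obtain rfl : (MC.map F).obj ⟨E, η, hη⟩ = Y1 := hobj.trans hY1
    obtain ⟨Y, ζ', hζ'⟩ := Y0
    obtain ⟨Y, rfl⟩ := hF.obj_surjective Y
    obtain ⟨ζ, a, h1, h2, rfl, rfl⟩ := hF.exists_lift_source (E := E) (η := η) hη hζ' hα
    exact ⟨⟨Y, ζ, h1⟩, ⟨E, η, hη⟩, a, h2, rfl, rfl⟩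
  · obtain rfl : (MC.map F).obj ⟨E, η, hη⟩ = Y0 := hobj.trans hY0
    obtain ⟨Y, ζ', hζ'⟩ := Y1
    obtain ⟨Y, rfl⟩ := hF.obj_surjective Y
    obtain ⟨ζ, a, h1, h2, rfl, rfl⟩ := hF.exists_lift_target (E := E) (η := η) hη hζ' hα
    exact ⟨⟨E, η, hη⟩, ⟨Y, ζ, h1⟩, a, h2, rfl, rfl⟩

end Edges

end DGCat

end

/-! ### Linear algebra: exactness at a point of the spectrum spreads out -/

noncomputable section

/-- For a ring homomorphism `φ : B → K` to a field, a retraction of `K` onto the field of fractions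
of the image of `φ`. -/
lemma RingHom.exists_retraction {B K : Type u} [CommRing B] [Field K] (φ : B →+* K) :
    ∃ ρ : K →+ K, (∀ b x, ρ (φ b * x) = φ b * ρ x) ∧ ρ 1 = 1 ∧
      ∀ x, ∃ a d, φ d ≠ 0 ∧ φ d * ρ x = φ a := by
  -- `K` is a vector space over the subfield `κ` generated by the image of `φ`, hence the inclusion
  -- of `κ` has a `κ`-linear left inverse `ρ`.
  let κ : Subfield K := Subfield.closure (Set.range φ)
  obtain ⟨ρ, hρ⟩ := LinearMap.exists_leftInverse_of_injective (Algebra.linearMap κ K)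
    (LinearMap.ker_eq_bot.2 (algebraMap κ K).injective)
  have hφ : ∀ b, φ b ∈ κ := fun b => Subfield.subset_closure ⟨b, rfl⟩
  refine ⟨(κ.subtype : κ →+ K).comp ρ.toAddMonoidHom, fun b x => ?_, ?_, fun x => ?_⟩
  · have := ρ.map_smul (⟨φ b, hφ b⟩ : κ) x
    exact congrArg κ.subtype this
  · have := LinearMap.congr_fun hρ 1
    simp only [LinearMap.comp_apply, Algebra.linearMap_apply, map_one, LinearMap.id_apply] at this
    exact congrArg κ.subtype this
  · obtain ⟨y, hy, z, hz, h⟩ := Subfield.mem_closure_iff.1 (ρ x).2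
    rw [← RingHom.coe_range, Subring.closure_eq] at hy hz
    obtain ⟨a, rfl⟩ := hy
    obtain ⟨d, rfl⟩ := hz
    -- The description of the closure by quotients allows a zero denominator, in which case the
    -- quotient is `0` and is rewritten as `0/1`.
    by_cases hd : φ d = 0
    · refine ⟨0, 1, by simp, ?_⟩
      rw [hd, div_zero] at h
      change φ 1 * ((ρ x : κ) : K) = _
      rw [← h]; simp
    · refine ⟨a, d, hd, ?_⟩
      change φ d * ((ρ x : κ) : K) = _
      rw [← h, mul_div_cancel₀ _ hd]

/-- Common denominators. -/
lemma RingHom.exists_common_denominator {B K : Type u} [CommRing B] [Field K] (φ : B →+* K)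
    {ι : Type*} (s : Finset ι) (y : ι → K) (hy : ∀ i, ∃ a d, φ d ≠ 0 ∧ φ d * y i = φ a) :
    ∃ d, φ d ≠ 0 ∧ ∀ i ∈ s, ∃ a, φ a = φ d * y i := by
  classical
  induction s using Finset.induction_on with
  | empty => exact ⟨1, by simp, by simp⟩
  | insert i s _ ih =>
    obtain ⟨d, hd, h⟩ := ih
    obtain ⟨a, d', hd', h'⟩ := hy i
    refine ⟨d * d', by simp [hd, hd'], fun j hj => ?_⟩
    rcases Finset.mem_insert.1 hj with rfl | hj
    · exact ⟨d * a, by rw [map_mul, map_mul, ← h']; ring⟩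
    · obtain ⟨a', ha'⟩ := h j hj
      exact ⟨d' * a', by rw [map_mul, map_mul, ha']; ring⟩

/-- Exact sequences of vector spaces split. -/
lemma LinearMap.exists_splitting {K V₁ V₂ V₃ : Type*} [Field K] [AddCommGroup V₁] [AddCommGroup V₂]
    [AddCommGroup V₃] [Module K V₁] [Module K V₂] [Module K V₃] (M : V₁ →ₗ[K] V₂) (N : V₂ →ₗ[K] V₃)
    (hex : ∀ v, N v = 0 → ∃ w, M w = v) :
    ∃ (s : V₂ →ₗ[K] V₁) (t : V₃ →ₗ[K] V₂), M ∘ₗ s + t ∘ₗ N = LinearMap.id := by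
  obtain ⟨r, hr⟩ := N.rangeRestrict.exists_rightInverse_of_surjective N.range_rangeRestrict
  obtain ⟨t, ht⟩ := r.exists_extend
  have hN : ∀ v, N (v - t (N v)) = 0 := by
    intro v
    have h1 : t (N v) = r (N.rangeRestrict v) := LinearMap.congr_fun ht (N.rangeRestrict v)
    have h2 := LinearMap.congr_fun hr (N.rangeRestrict v)
    rw [map_sub, sub_eq_zero, h1]
    exact (congrArg Subtype.val h2).symm
  obtain ⟨r', hr'⟩ := M.rangeRestrict.exists_rightInverse_of_surjective M.range_rangeRestrict
  have hm : ∀ v, (LinearMap.id - t ∘ₗ N : V₂ →ₗ[K] V₂) v ∈ LinearMap.range M := fun v => hex _ (hN v)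
  refine ⟨r' ∘ₗ (LinearMap.id - t ∘ₗ N).codRestrict _ hm, t, ?_⟩
  ext v
  have h := LinearMap.congr_fun hr' ((LinearMap.id - t ∘ₗ N).codRestrict _ hm v)
  have h' : M (r' ((LinearMap.id - t ∘ₗ N).codRestrict _ hm v)) = v - t (N v) :=
    congrArg Subtype.val h
  simp [h']

/-- If a complex of free modules of finite rank over `B` becomes exact over a field `K`, then its
cycles become boundaries after multiplication by an element which does not vanish in `K`. -/
lemma Matrix.exists_smul_eq_mulVec {B K : Type u} [CommRing B] [Field K] (φ : B →+* K)
    {ι₁ ι₂ ι₃ : Type*} [Fintype ι₁] [Fintype ι₂] [Fintype ι₃] [DecidableEq ι₁] [DecidableEq ι₂]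
    [DecidableEq ι₃] (M : Matrix ι₂ ι₁ B) (N : Matrix ι₃ ι₂ B) (hNM : N * M = 0)
    (hex : ∀ v, (N.map φ).mulVec v = 0 → ∃ w, (M.map φ).mulVec w = v) (v : ι₂ → B)
    (hv : N.mulVec v = 0) :
    ∃ b, φ b ≠ 0 ∧ ∃ w, M.mulVec w = b • v := by
  -- Over `K` exactness gives a contraction `Ms + tN = 1`.
  obtain ⟨s', t', hst⟩ := LinearMap.exists_splitting (M.map φ).mulVecLin (N.map φ).mulVecLin hex
  obtain ⟨s, rfl⟩ := (Matrix.toLin').surjective s'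
  obtain ⟨t, rfl⟩ := (Matrix.toLin').surjective t'
  rw [← Matrix.toLin'_apply', ← Matrix.toLin'_apply', ← Matrix.toLin'_mul, ← Matrix.toLin'_mul,
    ← map_add, ← Matrix.toLin'_one] at hst
  replace hst := (Matrix.toLin').injective hst
  -- The entries of `s` and `t` are arbitrary elements of `K`. The retraction, being linear over the
  -- image of `B`, preserves the contraction identity and makes the entries fractions from `B`; a
  -- common denominator `d` then gives matrices `S` and `T` over `B`.
  obtain ⟨ρ, hρ, hρ1, hρd⟩ := φ.exists_retraction
  obtain ⟨d, hd, hdd⟩ := φ.exists_common_denominator Finset.univ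
    (fun x : (ι₁ × ι₂) ⊕ (ι₂ × ι₃) => ρ (Sum.elim (fun x => s x.1 x.2) (fun x => t x.1 x.2) x))
    (fun x => hρd _)
  choose a ha using fun x => hdd x (Finset.mem_univ _)
  set S : Matrix ι₁ ι₂ B := fun i j => a (Sum.inl (i, j)) with hS
  set T : Matrix ι₂ ι₃ B := fun i j => a (Sum.inr (i, j)) with hT
  have hSφ : S.map φ = φ d • s.map ρ := by ext i j; exact ha (Sum.inl (i, j))
  have hTφ : T.map φ = φ d • t.map ρ := by ext i j; exact ha (Sum.inr (i, j))
  -- `θ` maps to `φ(d)·1`, but over `B` it need not be scalar. Cayley-Hamilton will replace it by a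
  -- scalar.
  set θ := M * S + T * N with hθ
  have hρ' : ∀ b x, ρ (x * φ b) = ρ x * φ b := fun b x => by rw [mul_comm, hρ, mul_comm]
  have hθφ : θ.map φ = φ d • (1 : Matrix ι₂ ι₂ K) := by
    have h1 : (M.map φ * s + t * N.map φ).map ρ = 1 := by
      rw [hst]
      exact Matrix.map_one ρ (map_zero _) hρ1
    rw [← h1, hθ, Matrix.map_add φ (map_add φ), Matrix.map_mul, Matrix.map_mul, hSφ, hTφ,
      Matrix.mul_smul, Matrix.smul_mul, ← smul_add, Matrix.map_add ρ (map_add ρ)]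
    congr 2
    · ext i j
      simp [Matrix.mul_apply, hρ]
    · ext i j
      simp [Matrix.mul_apply, hρ']
  -- The constant coefficient is the determinant up to sign, and the latter maps to a power of
  -- `φ(d)`.
  have hdet : φ (θ.charpoly.coeff 0) ≠ 0 := by
    have h1 : φ θ.det ≠ 0 := by
      rw [RingHom.map_det, RingHom.mapMatrix_apply, hθφ]
      simp [hd]
    intro h0
    apply h1
    rw [Matrix.det_eq_sign_charpoly_coeff, map_mul, h0, mul_zero]
  -- Because `NM = 0`, one has `θM = M(SM)`; so every polynomial in `θ` preserves the image of `M`.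
  have hint : ∀ p : Polynomial B, Polynomial.aeval θ p * M = M * Polynomial.aeval (S * M) p := by
    have hθM : θ * M = M * (S * M) := by
      rw [hθ, Matrix.add_mul, Matrix.mul_assoc T, hNM, Matrix.mul_zero, add_zero, Matrix.mul_assoc]
    intro p
    induction p using Polynomial.induction_on' with
    | add p q hp hq => rw [map_add, map_add, Matrix.add_mul, Matrix.mul_add, hp, hq]
    | monomial n b =>
      have hpow : θ ^ n * M = M * (S * M) ^ n := by
        induction n with
        | zero => simp
        | succ n ih => rw [pow_succ, Matrix.mul_assoc, hθM, ← Matrix.mul_assoc, ih, pow_succ,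
            Matrix.mul_assoc]
      rw [Polynomial.aeval_monomial, Polynomial.aeval_monomial, ← Algebra.smul_def,
        ← Algebra.smul_def, Matrix.smul_mul, Matrix.mul_smul, hpow]
  -- Write the characteristic polynomial as `pX + c`. As `Nv = 0`, `θv = MSv`, and Cayley-Hamilton
  -- gives `cv = -p(θ)θv = -p(θ)MSv = -M·p(SM)Sv`.
  refine ⟨θ.charpoly.coeff 0, hdet,
    -(Polynomial.aeval (S * M) θ.charpoly.divX).mulVec (S.mulVec v), ?_⟩
  have hch := Matrix.aeval_self_charpoly θ
  rw [← Polynomial.divX_mul_X_add θ.charpoly, map_add, map_mul, Polynomial.aeval_X,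
    Polynomial.aeval_C] at hch
  have hθv : θ.mulVec v = M.mulVec (S.mulVec v) := by
    rw [hθ, Matrix.add_mulVec, ← Matrix.mulVec_mulVec, ← Matrix.mulVec_mulVec, hv,
      Matrix.mulVec_zero, add_zero]
  have h := congrArg (fun A => A.mulVec v) hch
  simp only [Matrix.add_mulVec, Matrix.zero_mulVec, ← Matrix.mulVec_mulVec, hθv] at h
  rw [Matrix.mulVec_mulVec, hint, ← Matrix.mulVec_mulVec] at h
  rw [Matrix.mulVec_neg, neg_eq_iff_add_eq_zero, ← h]
  congr 1
  rw [Algebra.algebraMap_eq_smul_one, Matrix.smul_mulVec, Matrix.one_mulVec]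

/-- The matrix of a linear map after a semilinear extension of scalars. -/
lemma LinearMap.map_toMatrix_of_semilinear {B K : Type u} [CommRing B] [Field K] (φ : B →+* K)
    {ι κ : Type*} [Fintype ι] [Fintype κ] [DecidableEq ι] {V V' W W' : Type*}
    [AddCommGroup V] [AddCommGroup V'] [AddCommGroup W] [AddCommGroup W'] [Module B V]
    [Module B V'] [Module K W] [Module K W'] (b : Module.Basis ι B V) (b' : Module.Basis κ B V')
    (c : Module.Basis ι K W) (c' : Module.Basis κ K W') (σ : V →ₛₗ[φ] W) (σ' : V' →ₛₗ[φ] W')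
    (hb : ∀ i, σ (b i) = c i) (hb' : ∀ i, σ' (b' i) = c' i) (f : V →ₗ[B] V') (g : W →ₗ[K] W')
    (hfg : ∀ x, σ' (f x) = g (σ x)) :
    (LinearMap.toMatrix b b' f).map φ = LinearMap.toMatrix c c' g := by
  classical
  ext i j
  rw [Matrix.map_apply, LinearMap.toMatrix_apply, LinearMap.toMatrix_apply, ← hb, ← hfg]
  conv_rhs => rw [← b'.sum_repr (f (b j))]
  simp only [map_sum, map_smulₛₗ, hb', Finsupp.coe_finsetSum, Finset.sum_apply, Finsupp.smul_apply,
    Module.Basis.repr_self, Finsupp.single_apply, smul_eq_mul, mul_ite, mul_one, mul_zero,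
    RingHom.id_apply]
  simp

/-- If a complex of free modules of finite rank over `B` becomes exact over a field `K`, then its
cycles become boundaries after multiplication by an element which does not vanish in `K`. -/
lemma LinearMap.exists_smul_mem_range {B K : Type u} [CommRing B] [Field K] (φ : B →+* K)
    {ι₁ ι₂ ι₃ : Type*} [Fintype ι₁] [Fintype ι₂] [Fintype ι₃]
    {V₁ V₂ V₃ W₁ W₂ W₃ : Type*} [AddCommGroup V₁] [AddCommGroup V₂] [AddCommGroup V₃]
    [AddCommGroup W₁] [AddCommGroup W₂] [AddCommGroup W₃] [Module B V₁] [Module B V₂] [Module B V₃]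
    [Module K W₁] [Module K W₂] [Module K W₃]
    (b₁ : Module.Basis ι₁ B V₁) (b₂ : Module.Basis ι₂ B V₂) (b₃ : Module.Basis ι₃ B V₃)
    (c₁ : Module.Basis ι₁ K W₁) (c₂ : Module.Basis ι₂ K W₂) (c₃ : Module.Basis ι₃ K W₃)
    (σ₁ : V₁ →ₛₗ[φ] W₁) (σ₂ : V₂ →ₛₗ[φ] W₂) (σ₃ : V₃ →ₛₗ[φ] W₃) (h₁ : ∀ i, σ₁ (b₁ i) = c₁ i)
    (h₂ : ∀ i, σ₂ (b₂ i) = c₂ i) (h₃ : ∀ i, σ₃ (b₃ i) = c₃ i)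
    (M : V₁ →ₗ[B] V₂) (N : V₂ →ₗ[B] V₃) (M' : W₁ →ₗ[K] W₂) (N' : W₂ →ₗ[K] W₃)
    (hM : ∀ x, σ₂ (M x) = M' (σ₁ x)) (hN : ∀ x, σ₃ (N x) = N' (σ₂ x)) (hNM : ∀ x, N (M x) = 0)
    (hex : ∀ y, N' y = 0 → ∃ x, M' x = y) (v : V₂) (hv : N v = 0) :
    ∃ b, φ b ≠ 0 ∧ ∃ w, M w = b • v := by
  classical
  obtain ⟨b, hb, w, hw⟩ := Matrix.exists_smul_eq_mulVec φ (LinearMap.toMatrix b₁ b₂ M)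
    (LinearMap.toMatrix b₂ b₃ N) (by
      rw [← LinearMap.toMatrix_comp, show N ∘ₗ M = 0 from LinearMap.ext hNM, map_zero])
    (fun y hy => by
      rw [LinearMap.map_toMatrix_of_semilinear φ b₂ b₃ c₂ c₃ σ₂ σ₃ h₂ h₃ N N' hN] at hy
      obtain ⟨z, rfl⟩ : ∃ z, y = c₂.repr z := ⟨c₂.equivFun.symm y, by
        rw [← Module.Basis.equivFun_apply, LinearEquiv.apply_symm_apply]⟩
      rw [LinearMap.toMatrix_mulVec_repr] at hy
      have hz : N' z = 0 := c₃.repr.map_eq_zero_iff.1 (DFunLike.coe_injective hy)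
      obtain ⟨x, rfl⟩ := hex z hz
      exact ⟨c₁.repr x, by
        rw [LinearMap.map_toMatrix_of_semilinear φ b₁ b₂ c₁ c₂ σ₁ σ₂ h₁ h₂ M M' hM, LinearMap.toMatrix_mulVec_repr]⟩)
    (b₂.repr v) (by rw [LinearMap.toMatrix_mulVec_repr, hv]; simp)
  refine ⟨b, hb, b₁.equivFun.symm w, ?_⟩
  apply b₂.repr.injective
  apply DFunLike.coe_injective
  rw [← LinearMap.toMatrix_mulVec_repr b₁ b₂, ← Module.Basis.equivFun_apply,
    LinearEquiv.apply_symm_apply, hw, map_smul]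
  rfl

end

/-! ### Openness of invertibility, and extension of scalars along square-zero extensions -/

noncomputable section

namespace DGCat

lemma twistedD_zero {R : Type u} [CommRing R] {A : DGCat R} {X Y : A.Obj} {i j : ℤ} (h : i + 1 = j)
    (f : A.Hom X Y i) : A.twistedD (0 : A.Hom X X 1) (0 : A.Hom Y Y 1) h f = A.d h f := by
  simp [twistedD_apply]

/-- With zero twists the cone lemmas apply to an arbitrary dg-category, not only to one of the form
`MC A`. -/
lemma IsEquivalence.nonempty_htpyInv_zero {R : Type u} [CommRing R] {A : DGCat R} {X Y : A.Obj}
    {f : A.Hom X Y 0} (hf : A.IsEquivalence f) :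
    Nonempty ((DGIdeal.top A).HtpyInv (0 : A.Hom X X 1) (0 : A.Hom Y Y 1) f) := by
  obtain ⟨df, g, dg, ⟨hX, hX'⟩, ⟨hY, hY'⟩⟩ := hf
  exact ⟨.mk' (hX := hX) (hY := hY) _ (by rw [twistedD_zero, df]) (by rw [twistedD_zero, dg])
    (by rw [twistedD_zero, hX']) (by rw [twistedD_zero, hY'])⟩

/-- A semilinear dg-functor which maps bases of the complexes of morphisms to bases. -/
structure Functor.IsFreeBaseChange {B K : Type u} [CommRing B] [CommRing K] {C : DGCat B}
    {C' : DGCat K} (F : Functor C C') (φ : B →+* K) : Prop where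
  map_smul : ∀ {X Y : C.Obj} {i : ℤ} (a : B) (f : C.Hom X Y i), F.map (a • f) = φ a • F.map f
  exists_basis : ∀ (X Y : C.Obj) (i : ℤ), ∃ (n : ℕ) (b : Module.Basis (Fin n) B (C.Hom X Y i))
    (c : Module.Basis (Fin n) K (C'.Hom (F.obj X) (F.obj Y) i)), ∀ j, F.map (b j) = c j

section Open

variable {B K : Type u} [CommRing B] [Field K] {φ : B →+* K} {C : DGCat B} {C' : DGCat K}
  {F : Functor C C'}

/-- The semilinear map on morphisms. -/
def Functor.IsFreeBaseChange.semilinear (hF : F.IsFreeBaseChange φ) (X Y : C.Obj) (i : ℤ) :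
    C.Hom X Y i →ₛₗ[φ] C'.Hom (F.obj X) (F.obj Y) i :=
  { F.map with map_smul' := hF.map_smul }

/-- A product of semilinear maps. -/
def semilinearProd {V V' W W' : Type*} [AddCommGroup V] [AddCommGroup V'] [AddCommGroup W]
    [AddCommGroup W'] [Module B V] [Module B V'] [Module K W] [Module K W'] (σ : V →ₛₗ[φ] W)
    (σ' : V' →ₛₗ[φ] W') : V × V' →ₛₗ[φ] W × W' where
  toFun x := (σ x.1, σ' x.2)
  map_add' x y := by simp
  map_smul' a x := by simp

lemma semilinearProd_basis {V V' W W' : Type*} [AddCommGroup V] [AddCommGroup V'] [AddCommGroup W]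
    [AddCommGroup W'] [Module B V] [Module B V'] [Module K W] [Module K W'] (σ : V →ₛₗ[φ] W)
    (σ' : V' →ₛₗ[φ] W') {ι κ : Type*} (b : Module.Basis ι B V) (b' : Module.Basis κ B V')
    (c : Module.Basis ι K W) (c' : Module.Basis κ K W') (h : ∀ i, σ (b i) = c i)
    (h' : ∀ i, σ' (b' i) = c' i) (i : ι ⊕ κ) :
    semilinearProd σ σ' (b.prod b' i) = c.prod c' i := by
  rcases i with i | i
  · simp [semilinearProd, h]
  · simp [semilinearProd, h']

/-- A left inverse up to homotopy is a pair `(g, h)` with boundary `(1, 0)` in the cone of `f^* :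
Hom(Y, X) → Hom(X, X)`. The element `(1, 0)` is a cycle, and the cone is exact over `K` because the
image of `f` is an equivalence; hence a multiple `b·(1, 0)` with `φ(b) ≠ 0` is a boundary over `B`.
-/
lemma Functor.IsFreeBaseChange.exists_left_inverse (hF : F.IsFreeBaseChange φ) {X Y : C.Obj}
    {f : C.Hom X Y 0} (hf : C.d (zero_add 1) f = 0) (hf' : C'.IsEquivalence (F.map f)) :
    ∃ b, φ b ≠ 0 ∧ ∃ (g : C.Hom Y X 0) (h : C.Hom X X (-1)), C.d (zero_add 1) g = 0 ∧
      C.comp (add_zero 0) g f = b • C.one X + C.d (by norm_num) h := by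
  obtain ⟨H⟩ := hf'.nonempty_htpyInv_zero
  obtain ⟨_, b1, c1, h1⟩ := hF.exists_basis Y X 0
  obtain ⟨_, b2, c2, h2⟩ := hF.exists_basis X X (-1)
  obtain ⟨_, b3, c3, h3⟩ := hF.exists_basis X X 0
  obtain ⟨_, b4, c4, h4⟩ := hF.exists_basis Y X 1
  obtain ⟨_, b5, c5, h5⟩ := hF.exists_basis X X 1
  obtain ⟨_, b6, c6, h6⟩ := hF.exists_basis Y X (1 + 1)
  obtain ⟨b, hb, ⟨g, h⟩, hw⟩ := LinearMap.exists_smul_mem_range φ (b1.prod b2) (b3.prod b4)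
    (b5.prod b6) (c1.prod c2) (c3.prod c4) (c5.prod c6)
    (semilinearProd (hF.semilinear _ _ _) (hF.semilinear _ _ _))
    (semilinearProd (hF.semilinear _ _ _) (hF.semilinear _ _ _))
    (semilinearProd (hF.semilinear _ _ _) (hF.semilinear _ _ _))
    (semilinearProd_basis _ _ _ _ _ _ h1 h2) (semilinearProd_basis _ _ _ _ _ _ h3 h4)
    (semilinearProd_basis _ _ _ _ _ _ h5 h6)
    (LinearMap.prod ((C.comp (add_zero 0)).flip f ∘ₗ LinearMap.fst _ _ _ +
      C.d (by norm_num) ∘ₗ LinearMap.snd _ _ _) (C.d (zero_add 1) ∘ₗ LinearMap.fst _ _ _))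
    (LinearMap.prod (C.d (zero_add 1) ∘ₗ LinearMap.fst _ _ _ -
      (C.comp (add_zero 1)).flip f ∘ₗ LinearMap.snd _ _ _) (C.d rfl ∘ₗ LinearMap.snd _ _ _))
    (LinearMap.prod ((C'.comp (add_zero 0)).flip (F.map f) ∘ₗ LinearMap.fst _ _ _ +
      C'.d (by norm_num) ∘ₗ LinearMap.snd _ _ _) (C'.d (zero_add 1) ∘ₗ LinearMap.fst _ _ _))
    (LinearMap.prod (C'.d (zero_add 1) ∘ₗ LinearMap.fst _ _ _ -
      (C'.comp (add_zero 1)).flip (F.map f) ∘ₗ LinearMap.snd _ _ _) (C'.d rfl ∘ₗ LinearMap.snd _ _ _))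
    (fun x => by
      refine Prod.ext ?_ ?_
      · change F.map (C.comp _ x.1 f + C.d _ x.2) = C'.comp _ (F.map x.1) _ + C'.d _ (F.map x.2)
        rw [map_add, F.map_comp, F.map_d]
      · exact F.map_d _ _)
    (fun x => by
      refine Prod.ext ?_ ?_
      · change F.map (C.d _ x.1 - C.comp _ x.2 f) = C'.d _ (F.map x.1) - C'.comp _ (F.map x.2) _
        rw [map_sub, F.map_comp, F.map_d]
      · exact F.map_d _ _)
    (fun x => by
      refine Prod.ext ?_ (C.d_d _ _ _)
      change C.d _ (C.comp _ x.1 f + C.d _ x.2) - C.comp _ (C.d _ x.1) f = 0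
      rw [map_add, C.d_d, add_zero, C.d_comp (add_zero 0) (zero_add 1) (zero_add 1) (zero_add 1)
        (add_zero 1) (zero_add 1), hf, map_zero, smul_zero, add_zero, sub_self])
    (fun y hy => by
      have e1 : C'.d (zero_add 1) y.1 - C'.comp (add_zero 1) y.2 (F.map f) = 0 := congrArg Prod.fst hy
      have e2 : C'.d rfl y.2 = 0 := congrArg Prod.snd hy
      obtain ⟨v, -, w, -, h1, h2⟩ := H.exact_precomp 0 (r := -1) (by norm_num) (zero_add 1)
        (add_zero 1) (add_zero 0) (b := y.2) (a := y.1) trivial trivial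
        (by rw [twistedD_zero, e2]) (by rw [twistedD_zero]; exact sub_eq_zero.1 e1)
      rw [twistedD_zero] at h1 h2
      exact ⟨(v, w), Prod.ext h2.symm h1⟩)
    (C.one X, 0) (Prod.ext (by
      change C.d _ (C.one X) - C.comp _ 0 f = 0
      rw [C.d_one, map_zero, LinearMap.zero_apply, sub_zero]) (LinearMap.map_zero (C.d rfl)))
  have e1 : C.comp (add_zero 0) g f + C.d _ h = b • C.one X := congrArg Prod.fst hw
  have e2 : C.d (zero_add 1) g = b • 0 := congrArg Prod.snd hw
  exact ⟨b, hb, g, -h, by rw [e2, smul_zero], by rw [← e1, map_neg]; abel⟩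

/-- The same argument for the cone of `f_* : Hom(Y, X) → Hom(Y, Y)`. -/
lemma Functor.IsFreeBaseChange.exists_right_inverse (hF : F.IsFreeBaseChange φ) {X Y : C.Obj}
    {f : C.Hom X Y 0} (hf : C.d (zero_add 1) f = 0) (hf' : C'.IsEquivalence (F.map f)) :
    ∃ b, φ b ≠ 0 ∧ ∃ (g : C.Hom Y X 0) (h : C.Hom Y Y (-1)), C.d (zero_add 1) g = 0 ∧
      C.comp (add_zero 0) f g = b • C.one Y + C.d (by norm_num) h := by
  obtain ⟨H⟩ := hf'.nonempty_htpyInv_zero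
  obtain ⟨_, b1, c1, h1⟩ := hF.exists_basis Y X 0
  obtain ⟨_, b2, c2, h2⟩ := hF.exists_basis Y Y (-1)
  obtain ⟨_, b3, c3, h3⟩ := hF.exists_basis Y Y 0
  obtain ⟨_, b4, c4, h4⟩ := hF.exists_basis Y X 1
  obtain ⟨_, b5, c5, h5⟩ := hF.exists_basis Y Y 1
  obtain ⟨_, b6, c6, h6⟩ := hF.exists_basis Y X (1 + 1)
  obtain ⟨b, hb, ⟨g, h⟩, hw⟩ := LinearMap.exists_smul_mem_range φ (b1.prod b2) (b3.prod b4)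
    (b5.prod b6) (c1.prod c2) (c3.prod c4) (c5.prod c6)
    (semilinearProd (hF.semilinear _ _ _) (hF.semilinear _ _ _))
    (semilinearProd (hF.semilinear _ _ _) (hF.semilinear _ _ _))
    (semilinearProd (hF.semilinear _ _ _) (hF.semilinear _ _ _))
    (semilinearProd_basis _ _ _ _ _ _ h1 h2) (semilinearProd_basis _ _ _ _ _ _ h3 h4)
    (semilinearProd_basis _ _ _ _ _ _ h5 h6)
    (LinearMap.prod (C.comp (add_zero 0) f ∘ₗ LinearMap.fst _ _ _ +
      C.d (by norm_num) ∘ₗ LinearMap.snd _ _ _) (C.d (zero_add 1) ∘ₗ LinearMap.fst _ _ _))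
    (LinearMap.prod (C.d (zero_add 1) ∘ₗ LinearMap.fst _ _ _ -
      C.comp (zero_add 1) f ∘ₗ LinearMap.snd _ _ _) (C.d rfl ∘ₗ LinearMap.snd _ _ _))
    (LinearMap.prod (C'.comp (add_zero 0) (F.map f) ∘ₗ LinearMap.fst _ _ _ +
      C'.d (by norm_num) ∘ₗ LinearMap.snd _ _ _) (C'.d (zero_add 1) ∘ₗ LinearMap.fst _ _ _))
    (LinearMap.prod (C'.d (zero_add 1) ∘ₗ LinearMap.fst _ _ _ -
      C'.comp (zero_add 1) (F.map f) ∘ₗ LinearMap.snd _ _ _) (C'.d rfl ∘ₗ LinearMap.snd _ _ _))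
    (fun x => by
      refine Prod.ext ?_ ?_
      · change F.map (C.comp _ f x.1 + C.d _ x.2) = C'.comp _ _ (F.map x.1) + C'.d _ (F.map x.2)
        rw [map_add, F.map_comp, F.map_d]
      · exact F.map_d _ _)
    (fun x => by
      refine Prod.ext ?_ ?_
      · change F.map (C.d _ x.1 - C.comp _ f x.2) = C'.d _ (F.map x.1) - C'.comp _ _ (F.map x.2)
        rw [map_sub, F.map_comp, F.map_d]
      · exact F.map_d _ _)
    (fun x => by
      refine Prod.ext ?_ (C.d_d _ _ _)
      change C.d _ (C.comp _ f x.1 + C.d _ x.2) - C.comp _ f (C.d _ x.1) = 0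
      rw [map_add, C.d_d, add_zero, C.d_comp (add_zero 0) (zero_add 1) (zero_add 1) (zero_add 1)
        (add_zero 1) (zero_add 1), hf, map_zero, LinearMap.zero_apply, zero_add,
        Int.negOnePow_zero, one_smul, sub_self])
    (fun y hy => by
      have e1 : C'.d (zero_add 1) y.1 - C'.comp (zero_add 1) (F.map f) y.2 = 0 := congrArg Prod.fst hy
      have e2 : C'.d rfl y.2 = 0 := congrArg Prod.snd hy
      obtain ⟨v, -, w, -, h1, h2⟩ := H.exact_postcomp 0 (r := -1) (by norm_num) (zero_add 1)
        (zero_add 1) (add_zero 0) (b := y.2) (a := y.1) trivial trivial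
        (by rw [twistedD_zero, e2]) (by rw [twistedD_zero]; exact sub_eq_zero.1 e1)
      rw [twistedD_zero] at h1 h2
      exact ⟨(v, w), Prod.ext h2.symm h1⟩)
    (C.one Y, 0) (Prod.ext (by
      change C.d _ (C.one Y) - C.comp _ f 0 = 0
      rw [C.d_one, map_zero, sub_zero]) (LinearMap.map_zero (C.d rfl)))
  have e1 : C.comp (add_zero 0) f g + C.d _ h = b • C.one Y := congrArg Prod.fst hw
  have e2 : C.d (zero_add 1) g = b • 0 := congrArg Prod.snd hw
  exact ⟨b, hb, g, -h, by rw [e2, smul_zero], by rw [← e1, map_neg]; abel⟩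

/-- Being an equivalence is an open condition. -/
theorem Functor.IsFreeBaseChange.exists_isEquivalence (hF : F.IsFreeBaseChange φ) {X Y : C.Obj}
    {f : C.Hom X Y 0} (hf : C.d (zero_add 1) f = 0) (hf' : C'.IsEquivalence (F.map f)) :
    ∃ b, φ b ≠ 0 ∧ ∀ {B' : Type u} [CommRing B'] (ψ : B →+* B') {D : DGCat B'} (G : Functor C D)
      (_ : ∀ {X Y : C.Obj} {i : ℤ} (a : B) (f : C.Hom X Y i), G.map (a • f) = ψ a • G.map f),
      IsUnit (ψ b) → D.IsEquivalence (G.map f) := by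
  obtain ⟨b, hb, g, h, hg, hgf⟩ := hF.exists_left_inverse hf hf'
  obtain ⟨b', hb', g', h', hg', hgf'⟩ := hF.exists_right_inverse hf hf'
  refine ⟨b * b', by simp [hb, hb'], fun {B'} _ ψ {D} G hG hu => ?_⟩
  rw [map_mul] at hu
  obtain ⟨c, hc⟩ := (isUnit_of_mul_isUnit_left hu).exists_right_inv
  obtain ⟨c', hc'⟩ := (isUnit_of_mul_isUnit_right hu).exists_right_inv
  -- Wherever `bb'` becomes invertible, dividing by `b` and by `b'` gives a left and a right inverse
  -- up to homotopy.
  refine .of_left_right (g := c • G.map g) (g' := c' • G.map g') (by rw [← G.map_d, hf, map_zero])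
    (by rw [_root_.map_smul, ← G.map_d, hg, map_zero, smul_zero])
    (by rw [_root_.map_smul, ← G.map_d, hg', map_zero, smul_zero]) ⟨c • G.map h, ?_⟩ ⟨c' • G.map h', ?_⟩
  · rw [_root_.map_smul, LinearMap.smul_apply, ← G.map_comp, hgf, map_add, hG, smul_add, smul_smul,
      mul_comm c, hc, one_smul, G.map_one, G.map_d, _root_.map_smul]
  · rw [_root_.map_smul, ← G.map_comp, hgf', map_add, hG, smul_add, smul_smul,
      mul_comm c', hc', one_smul, G.map_one, G.map_d, _root_.map_smul]

end Open

section BaseChange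

variable {k : Type u} [Field k] (P : DGCat k) {B B' : Type u} [CommRing B] [Algebra k B]
  [CommRing B'] [Algebra k B'] (φ : B →ₐ[k] B')

lemma baseChangeMapHom_smul {X Y : P.Obj} {i : ℤ} (a : B) (f : B ⊗[k] P.Hom X Y i) :
    P.baseChangeMapHom φ X Y i (a • f) = φ a • P.baseChangeMapHom φ X Y i f := by
  induction f using TensorProduct.induction_on with
  | zero => rw [smul_zero, map_zero, smul_zero]
  | tmul b x => rw [TensorProduct.smul_tmul', baseChangeMapHom_tmul, baseChangeMapHom_tmul,
      TensorProduct.smul_tmul', smul_eq_mul, smul_eq_mul, map_mul]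
  | add x y hx hy => rw [smul_add, map_add, map_add, smul_add, hx, hy]

lemma exists_basis_baseChangeMapHom (E F : P.Obj) (i : ℤ) [Module.Finite k (P.Hom E F i)] :
    ∃ (n : ℕ) (b : Module.Basis (Fin n) B (B ⊗[k] P.Hom E F i))
      (c : Module.Basis (Fin n) B' (B' ⊗[k] P.Hom E F i)),
      ∀ j, P.baseChangeMapHom φ E F i (b j) = c j := by
  refine ⟨_, Algebra.TensorProduct.basis B (Module.finBasis k (P.Hom E F i)),
    Algebra.TensorProduct.basis B' (Module.finBasis k (P.Hom E F i)), fun j => ?_⟩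
  rw [Algebra.TensorProduct.basis_apply, Algebra.TensorProduct.basis_apply,
    baseChangeMapHom_tmul, map_one]

lemma isFreeBaseChange_baseChangeMap (hfin : ∀ (E F : P.Obj) (i : ℤ), Module.Finite k (P.Hom E F i)) :
    (MC.map (P.baseChangeMap φ)).IsFreeBaseChange φ.toRingHom where
  map_smul a f := P.baseChangeMapHom_smul φ a f
  exists_basis X Y i :=
    have := hfin X.1 Y.1 i
    P.exists_basis_baseChangeMapHom φ X.1 Y.1 i

lemma bilin_eq_zero_of_span {R M N L : Type*} [CommRing R] [AddCommGroup M] [AddCommGroup N]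
    [AddCommGroup L] [Module R M] [Module R N] [Module R L] (β : M →ₗ[R] N →ₗ[R] L) {s : Set M}
    {t : Set N} (h : ∀ x ∈ s, ∀ y ∈ t, β x y = 0) {x : M} {y : N} (hx : x ∈ Submodule.span R s)
    (hy : y ∈ Submodule.span R t) : β x y = 0 := by
  have h1 : ∀ x ∈ s, β x y = 0 := fun x hx =>
    (Submodule.span_le.2 (h x hx) : Submodule.span R t ≤ LinearMap.ker (β x)) hy
  exact (Submodule.span_le.2 h1 : Submodule.span R s ≤ LinearMap.ker (β.flip y)) hx

lemma baseChangeMapHom_surjective (hφ : Function.Surjective φ) (X Y : P.Obj) (i : ℤ) :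
    Function.Surjective (P.baseChangeMapHom φ X Y i) :=
  LinearMap.rTensor_surjective (P.Hom X Y i) (g := φ.toLinearMap) hφ

/-- By right exactness of the tensor product the kernel is spanned by the `a ⊗ e` with `a` in the
kernel of `φ`, and the product of two such `a` is zero. -/
lemma bilinBaseChange_eq_zero (hφ : Function.Surjective φ) (hI : (RingHom.ker φ) ^ 2 = ⊥)
    {X Y Z : P.Obj} {i j n : ℤ} (h : i + j = n) (f : B ⊗[k] P.Hom Y Z i) (g : B ⊗[k] P.Hom X Y j)
    (hf : P.baseChangeMapHom φ Y Z i f = 0) (hg : P.baseChangeMapHom φ X Y j g = 0) :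
    bilinBaseChange B (P.comp h) f g = 0 := by
  have key : ∀ (X Y : P.Obj) (i : ℤ) (f : B ⊗[k] P.Hom X Y i), P.baseChangeMapHom φ X Y i f = 0 →
      f ∈ Submodule.span B {x | ∃ a ∈ RingHom.ker φ, ∃ e : P.Hom X Y i, x = a ⊗ₜ e} := by
    intro X Y i f hf
    have hex : Function.Exact (LinearMap.ker φ.toLinearMap).subtype φ.toLinearMap :=
      LinearMap.exact_subtype_ker_map _
    obtain ⟨t, rfl⟩ := (rTensor_exact (P.Hom X Y i) hex hφ f).1 hf
    induction t using TensorProduct.induction_on with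
    | zero => rw [map_zero]; exact zero_mem _
    | tmul a e => exact Submodule.subset_span ⟨a.1, a.2, e, rfl⟩
    | add x y hx hy =>
      rw [map_add]
      have hz : ∀ x, P.baseChangeMapHom φ X Y i
          ((LinearMap.rTensor (P.Hom X Y i) (LinearMap.ker φ.toLinearMap).subtype) x) = 0 :=
        fun x => (rTensor_exact (P.Hom X Y i) hex hφ _).2 ⟨x, rfl⟩
      exact add_mem (hx (hz x)) (hy (hz y))
  have hf' := key _ _ _ f hf
  have hg' := key _ _ _ g hg
  refine bilin_eq_zero_of_span (bilinBaseChange B (P.comp h)) ?_ hf' hg'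
  rintro _ ⟨a, ha, e, rfl⟩ _ ⟨a', ha', e', rfl⟩
  have : a * a' = 0 := by
    have := Ideal.mul_mem_mul ha ha'
    rwa [← pow_two, hI, Ideal.mem_bot] at this
  rw [bilinBaseChange_tmul, this, TensorProduct.zero_tmul]

lemma isSquareZero_baseChangeMap (hφ : Function.Surjective φ)
    (hI : (RingHom.ker φ) ^ 2 = ⊥) : (P.baseChangeMap φ).IsSquareZero where
  obj_surjective X := ⟨X, rfl⟩
  map_surjective X Y i := P.baseChangeMapHom_surjective φ hφ X Y i
  comp_eq_zero h f g hf hg := P.bilinBaseChange_eq_zero φ hφ hI h f g hf hg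

end BaseChange

end DGCat

end

/-! ### The universal simplex with given underlying objects -/

noncomputable section

namespace DGCat

lemma FinArray.isMC_iff_of_heq {R : Type u} [CommRing R] {A : DGCat R} {ι : Type} [LinearOrder ι]
    {X Y : ι → A.Obj} (h : X = Y) {b : FinArray X} {c : FinArray Y}
    (hbc : ∀ i s j q, b i s j q ≍ c i s j q) (i : ι) (s : Finset ι) (j : ι) :
    b.IsMC i s j ↔ c.IsMC i s j := by
  subst h
  obtain rfl : b = c := by
    funext i s j q
    exact eq_of_heq (hbc i s j q)
  rfl

/-- The places at which the values of a simplex are determined by the normalization. -/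
def IsDegeneratePlace {n : ℕ} (i : Fin (n + 1)) (s : Finset (Fin (n + 1))) (j : Fin (n + 1))
    (q : ℤ) : Prop :=
  ¬ (i < j ∧ s ⊆ Finset.Ioo i j ∧ q + s.card = 0) ∧ ¬ (i = j ∧ s = ∅ ∧ q = 0)

lemma NerveSimplex.arr_eq_zero {R : Type u} [CommRing R] {A : DGCat R} {n : ℕ}
    (x : NerveSimplex A n) {i j : Fin (n + 1)} {s : Finset (Fin (n + 1))} {q : ℤ}
    (h : IsDegeneratePlace i s j q) : x.arr i s j q = 0 := by
  obtain ⟨c, hc, rfl⟩ : ∃ c : List (Fin (n + 1)), c.Pairwise (· < ·) ∧ s = c.toFinset :=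
    ⟨s.sort, s.sortedLT_sort.pairwise, (Finset.sort_toFinset s (· ≤ ·)).symm⟩
  by_cases hq : IsChain i c j ∧ q + c.length = 0
  · rw [arr_toFinset _ hc hq.1 q hq.2]
    have hn : ¬ (i :: (c ++ [j])).Nodup := fun hn => h.1 (by
      obtain ⟨h1, h2, h3⟩ := hq.1.pairwise_lt hn
      exact ⟨h1, h3, by rw [List.toFinset_card_of_nodup (h2.imp fun h => h.ne)]; exact hq.2⟩)
    refine x.degenerate hq.1 q hq.2 ?_ hn
    rintro rfl
    refine h.2 ⟨?_, rfl, by simpa using hq.2⟩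
    by_contra hij
    exact hn (by simpa using hij)
  · rw [arr, dif_neg]
    rwa [List.sort_toFinset_of_pairwise_lt hc]

lemma NerveSimplex.arr_unit {R : Type u} [CommRing R] {A : DGCat R} {n : ℕ}
    (x : NerveSimplex A n) (i : Fin (n + 1)) : x.arr i ∅ i 0 = A.one (x.obj i) := by
  have h : IsChain i [] i := by simp [IsChain]
  rw [x.arr_empty h, x.unit h]

section Coordinates

variable {k : Type u} [Field k] (P : DGCat k) [∀ E F i, Module.Finite k (P.Hom E F i)]
variable {B C : Type u} [CommRing B] [Algebra k B] [CommRing C] [Algebra k C]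

/-- The dimension of a space of morphisms. -/
abbrev homDim (E F : P.Obj) (i : ℤ) : ℕ := Module.finrank k (P.Hom E F i)

/-- Coordinates on the spaces of morphisms. -/
def coordBasis (B : Type u) [CommRing B] [Algebra k B] (E F : P.Obj) (i : ℤ) :
    Module.Basis (Fin (P.homDim E F i)) B (B ⊗[k] P.Hom E F i) :=
  Algebra.TensorProduct.basis B (Module.finBasis k (P.Hom E F i))

lemma baseChangeMapHom_coordBasis (ψ : B →ₐ[k] C) (E F : P.Obj) (i : ℤ) (t) :
    P.baseChangeMapHom ψ E F i (P.coordBasis B E F i t) = P.coordBasis C E F i t := by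
  rw [coordBasis, coordBasis, Algebra.TensorProduct.basis_apply, Algebra.TensorProduct.basis_apply,
    baseChangeMapHom_tmul, map_one]

lemma coordBasis_repr_map (ψ : B →ₐ[k] C) {E F : P.Obj} {i : ℤ} (z : B ⊗[k] P.Hom E F i) (t) :
    (P.coordBasis C E F i).repr (P.baseChangeMapHom ψ E F i z) t =
      ψ ((P.coordBasis B E F i).repr z t) := by
  conv_lhs => rw [← (P.coordBasis B E F i).sum_repr z]
  rw [map_sum]
  simp only [P.baseChangeMapHom_smul, baseChangeMapHom_coordBasis, map_sum, map_smul,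
    Module.Basis.repr_self, Finsupp.coe_finsetSum, Finset.sum_apply, Finsupp.smul_apply,
    Finsupp.single_apply, smul_eq_mul, mul_ite, mul_one, mul_zero]
  simp

/-- The ideal generated by the coordinates of a morphism. -/
def coeffIdeal {E F : P.Obj} {i : ℤ} (z : B ⊗[k] P.Hom E F i) : Ideal B :=
  Ideal.span (Set.range fun t => (P.coordBasis B E F i).repr z t)

/-- Translates an equation between morphisms into a condition on an ideal; this is how the
Maurer-Cartan equations and the normalization become relations of the representing algebra. -/
lemma baseChangeMapHom_eq_zero_iff (ψ : B →ₐ[k] C) {E F : P.Obj} {i : ℤ} (z : B ⊗[k] P.Hom E F i) :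
    P.baseChangeMapHom ψ E F i z = 0 ↔ P.coeffIdeal z ≤ RingHom.ker ψ := by
  rw [coeffIdeal, Ideal.span_le, ← (P.coordBasis C E F i).repr.map_eq_zero_iff]
  constructor
  · rintro h _ ⟨t, rfl⟩
    change ψ _ = 0
    rw [← coordBasis_repr_map, h]; rfl
  · intro h
    ext t
    rw [coordBasis_repr_map]
    exact h ⟨t, rfl⟩

/-- The morphism with given coordinates. -/
def ofCoord {E F : P.Obj} {i : ℤ} (f : Fin (P.homDim E F i) → B) : B ⊗[k] P.Hom E F i :=
  (P.coordBasis B E F i).equivFun.symm f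

lemma repr_ofCoord {E F : P.Obj} {i : ℤ} (f : Fin (P.homDim E F i) → B) (t) :
    (P.coordBasis B E F i).repr (P.ofCoord f) t = f t := by
  rw [ofCoord, ← Module.Basis.equivFun_apply, LinearEquiv.apply_symm_apply]

lemma coord_ext {E F : P.Obj} {i : ℤ} {z w : B ⊗[k] P.Hom E F i}
    (h : ∀ t, (P.coordBasis B E F i).repr z t = (P.coordBasis B E F i).repr w t) : z = w :=
  (P.coordBasis B E F i).repr.injective (Finsupp.ext h)

end Coordinates

section QuotientAlgebra

variable {k : Type u} [CommRing k] {B C : Type u} [CommRing B] [Algebra k B] [CommRing C]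
  [Algebra k C]

/-- The quotient of a commutative algebra by an ideal. -/
def QuotAlg (I : Ideal B) : Type u := B ⧸ I

namespace QuotAlg

variable (I : Ideal B)

instance : CommRing (QuotAlg I) := inferInstanceAs (CommRing (B ⧸ I))

instance : Algebra k (QuotAlg I) := inferInstanceAs (Algebra k (B ⧸ I))

/-- The projection. -/
def mk : B →ₐ[k] QuotAlg I := Ideal.Quotient.mkₐ k I

lemma mk_surjective : Function.Surjective (mk (k := k) I) := Ideal.Quotient.mkₐ_surjective k I

lemma ker_mk : RingHom.ker (mk (k := k) I) = I := Ideal.Quotient.mkₐ_ker k I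

variable {I}

/-- The universal property of the quotient. -/
def desc (ψ : B →ₐ[k] C) (h : I ≤ RingHom.ker ψ) : QuotAlg I →ₐ[k] C :=
  Ideal.Quotient.liftₐ I ψ fun _ hb => h hb

lemma desc_comp_mk (ψ : B →ₐ[k] C) (h : I ≤ RingHom.ker ψ) : (desc ψ h).comp (mk I) = ψ :=
  AlgHom.ext fun _ => rfl

lemma algHom_ext {ψ ψ' : QuotAlg I →ₐ[k] C} (h : ∀ b, ψ (mk (k := k) I b) = ψ' (mk (k := k) I b)) : ψ = ψ' :=
  AlgHom.ext fun x => by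
    obtain ⟨b, rfl⟩ := mk_surjective (k := k) I x
    exact h b

end QuotAlg

end QuotientAlgebra

section Universal

variable {k : Type u} [Field k] (P : DGCat k) [∀ E F i, Module.Finite k (P.Hom E F i)]
variable {n : ℕ} (E : Fin (n + 1) → P.Obj)

/-- The coordinates of a simplex with underlying objects `E`. -/
abbrev Coord : Type :=
  (Σ i : Fin (n + 1), Fin (P.homDim (E i) (E i) 1)) ⊕
    (Σ t : Fin (n + 1) × Finset (Fin (n + 1)) × Fin (n + 1) × ℤ,
      Fin (P.homDim (E t.1) (E t.2.2.1) t.2.2.2))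

/-- The polynomial ring in all coordinates. -/
abbrev CoordRing : Type u := MvPolynomial (P.Coord E) k

/-- The generic elements of degree one. -/
def genericEta (i : Fin (n + 1)) : P.CoordRing E ⊗[k] P.Hom (E i) (E i) 1 :=
  P.ofCoord fun t => MvPolynomial.X (Sum.inl ⟨i, t⟩)

/-- The generic values. -/
def genericArr (i : Fin (n + 1)) (s : Finset (Fin (n + 1))) (j : Fin (n + 1)) (q : ℤ) :
    P.CoordRing E ⊗[k] P.Hom (E i) (E j) q :=
  P.ofCoord fun t => MvPolynomial.X (Sum.inr ⟨(i, s, j, q), t⟩)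

/-- The curvature of the generic elements of degree one. -/
def genericCurv (i : Fin (n + 1)) : P.CoordRing E ⊗[k] P.Hom (E i) (E i) 2 :=
  (P.baseChange (P.CoordRing E)).curv (E := E i) (P.genericEta E i)

/-- The ideal of the Maurer-Cartan equations for the objects. -/
def objIdeal : Ideal (P.CoordRing E) := ⨆ i, P.coeffIdeal (P.genericCurv E i)

/-- The coordinate ring of families of Maurer-Cartan objects and morphisms. -/
abbrev ObjRing : Type u := QuotAlg (P.objIdeal E)

/-- The elements of degree one of the generic Maurer-Cartan objects. -/
def objEta (i : Fin (n + 1)) : P.ObjRing E ⊗[k] P.Hom (E i) (E i) 1 :=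
  P.baseChangeMapHom (QuotAlg.mk (P.objIdeal E)) _ _ _ (P.genericEta E i)

/-- The values between the generic Maurer-Cartan objects. -/
def objVal (i : Fin (n + 1)) (s : Finset (Fin (n + 1))) (j : Fin (n + 1)) (q : ℤ) :
    P.ObjRing E ⊗[k] P.Hom (E i) (E j) q :=
  P.baseChangeMapHom (QuotAlg.mk (P.objIdeal E)) _ _ _ (P.genericArr E i s j q)

/-- The reason for a quotient in two steps: only over `ObjRing` are the generic elements objects of
the category `MC`, in which the twisted equations for the values can be stated. -/
lemma curv_objEta (i : Fin (n + 1)) :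
    (P.baseChange (P.ObjRing E)).curv (E := E i) (P.objEta E i) =
      (0 : P.ObjRing E ⊗[k] P.Hom (E i) (E i) 2) := by
  refine ((P.baseChangeMap (QuotAlg.mk (P.objIdeal E))).map_curv
      (E := E i) (P.genericEta E i)).symm.trans ?_
  refine (P.baseChangeMapHom_eq_zero_iff (QuotAlg.mk (P.objIdeal E)) (P.genericCurv E i)).2 ?_
  rw [QuotAlg.ker_mk]
  exact le_iSup (fun i => P.coeffIdeal (P.genericCurv E i)) i

/-- The generic Maurer-Cartan objects. -/
def genericObj (i : Fin (n + 1)) : (MC (P.baseChange (P.ObjRing E))).Obj :=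
  ⟨E i, P.objEta E i, P.curv_objEta E i⟩

/-- The generic values between the generic objects. -/
def objArr : FinArray (P.genericObj E) := P.objVal E

/-- The defects of the Maurer-Cartan equations of the generic values. -/
def objDefect (i : Fin (n + 1)) (s : Finset (Fin (n + 1))) (j : Fin (n + 1)) {q q' : ℤ}
    (h : q + 1 = q') : P.ObjRing E ⊗[k] P.Hom (E i) (E j) q' :=
  (P.objArr E).defect i s j h

/-- The relations satisfied by the values of a simplex. -/
inductive Relation : ∀ {X Y : P.Obj} {i : ℤ}, P.ObjRing E ⊗[k] P.Hom X Y i → Prop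
  | one (i : Fin (n + 1)) : Relation (P.objVal E i ∅ i 0 - 1 ⊗ₜ P.one (E i))
  | zero (i : Fin (n + 1)) (s : Finset (Fin (n + 1))) (j : Fin (n + 1)) (q : ℤ)
      (h : IsDegeneratePlace i s j q) : Relation (P.objVal E i s j q)
  | mc (i : Fin (n + 1)) (s : Finset (Fin (n + 1))) (j : Fin (n + 1)) (q q' : ℤ) (h : q + 1 = q')
      (hq : q + s.card = 0) (hij : i < j) (hs : s ⊆ Finset.Ioo i j) :
      Relation (P.objDefect E i s j h)

/-- The ideal of the relations. -/
def relIdeal : Ideal (P.ObjRing E) :=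
  sSup {I | ∃ (X Y : P.Obj) (i : ℤ) (z : P.ObjRing E ⊗[k] P.Hom X Y i), P.Relation E z ∧
    I = P.coeffIdeal z}

/-- The algebra representing the simplices with underlying objects `E`. -/
abbrev SimplexRing : Type u := QuotAlg (P.relIdeal E)

variable {P E} in
lemma Relation.map_eq_zero {X Y : P.Obj} {i : ℤ} {z : P.ObjRing E ⊗[k] P.Hom X Y i}
    (h : P.Relation E z) : P.baseChangeMapHom (QuotAlg.mk (P.relIdeal E)) X Y i z = 0 := by
  rw [P.baseChangeMapHom_eq_zero_iff, QuotAlg.ker_mk]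
  exact le_sSup ⟨X, Y, i, z, h, rfl⟩

/-- The dg-functor from the generic objects to the universal ones. -/
abbrev univFunctor : Functor (MC (P.baseChange (P.ObjRing E))) (MC (P.baseChange (P.SimplexRing E))) :=
  MC.map (P.baseChangeMap (QuotAlg.mk (P.relIdeal E)))

/-- The universal values. -/
def univVal (i : Fin (n + 1)) (s : Finset (Fin (n + 1))) (j : Fin (n + 1)) (q : ℤ) :
    P.SimplexRing E ⊗[k] P.Hom (E i) (E j) q :=
  P.baseChangeMapHom (QuotAlg.mk (P.relIdeal E)) _ _ _ (P.objVal E i s j q)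

/-- The elements of degree one of the universal objects. -/
def univEta (i : Fin (n + 1)) : P.SimplexRing E ⊗[k] P.Hom (E i) (E i) 1 :=
  P.baseChangeMapHom (QuotAlg.mk (P.relIdeal E)) _ _ _ (P.objEta E i)

/-- The universal values, as an array. -/
def univArr : FinArray ((P.univFunctor E).obj ∘ P.genericObj E) :=
  FinArray.map (P.univFunctor E) (P.objArr E)

lemma univVal_unit (i : Fin (n + 1)) : P.univVal E i ∅ i 0 = 1 ⊗ₜ P.one (E i) := by
  have h := (Relation.one (P := P) (E := E) i).map_eq_zero
  rwa [map_sub, sub_eq_zero, baseChangeMapHom_tmul, map_one] at h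

lemma univArr_unit (i : Fin (n + 1)) : P.univArr E i ∅ i 0 =
    (MC (P.baseChange (P.SimplexRing E))).one (((P.univFunctor E).obj ∘ P.genericObj E) i) :=
  P.univVal_unit E i

lemma univArr_isMC (i : Fin (n + 1)) (s : Finset (Fin (n + 1))) (j : Fin (n + 1)) (hij : i < j)
    (hs : s ⊆ Finset.Ioo i j) : (P.univArr E).IsMC i s j := by
  intro q q' h hq
  rw [univArr, ← FinArray.defect_map]
  exact (Relation.mc (P := P) (E := E) i s j q q' h hq hij hs).map_eq_zero

/-- The universal simplex with underlying objects `E`. -/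
def univSimplex : NerveSimplex (MC (P.baseChange (P.SimplexRing E))) n :=
  .ofFinArray _ (P.univArr E) (P.univArr_unit E) (P.univArr_isMC E)

lemma univVal_eq_zero {i : Fin (n + 1)} {s : Finset (Fin (n + 1))} {j : Fin (n + 1)} {q : ℤ}
    (h : IsDegeneratePlace i s j q) : P.univVal E i s j q = 0 :=
  (Relation.zero (P := P) (E := E) i s j q h).map_eq_zero

/-- The relations also kill the generic values at places where `arr` takes its default value `0`, so
the equality holds without any condition on the place. -/
lemma arr_univSimplex (i : Fin (n + 1)) (s : Finset (Fin (n + 1))) (j : Fin (n + 1)) (q : ℤ) :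
    (P.univSimplex E).arr i s j q = P.univVal E i s j q := by
  by_cases h : i < j ∧ s ⊆ Finset.Ioo i j ∧ q + s.card = 0
  · exact NerveSimplex.arr_ofFinArray _ _ _ _ h.1 h.2.1 h.2.2
  by_cases h' : i = j ∧ s = ∅ ∧ q = 0
  · obtain ⟨rfl, rfl, rfl⟩ := h'
    exact ((P.univSimplex E).arr_unit i).trans (P.univArr_unit E i).symm
  · exact ((P.univSimplex E).arr_eq_zero ⟨h, h'⟩).trans (P.univVal_eq_zero E ⟨h, h'⟩).symm

/-- The coordinates as elements of the universal ring. -/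
def univCoord (c : P.Coord E) : P.SimplexRing E :=
  QuotAlg.mk (k := k) (P.relIdeal E) (QuotAlg.mk (k := k) (P.objIdeal E) (MvPolynomial.X c))

lemma univCoord_inl (i : Fin (n + 1)) (t : Fin (P.homDim (E i) (E i) 1)) :
    P.univCoord E (Sum.inl ⟨i, t⟩) =
      (P.coordBasis (P.SimplexRing E) (E i) (E i) 1).repr (P.univEta E i) t := by
  rw [univEta, coordBasis_repr_map, objEta, coordBasis_repr_map, genericEta, repr_ofCoord]
  rfl

lemma univCoord_inr (i : Fin (n + 1)) (s : Finset (Fin (n + 1))) (j : Fin (n + 1)) (q : ℤ)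
    (t : Fin (P.homDim (E i) (E j) q)) :
    P.univCoord E (Sum.inr ⟨(i, s, j, q), t⟩) =
      (P.coordBasis (P.SimplexRing E) (E i) (E j) q).repr (P.univVal E i s j q) t := by
  rw [univVal, coordBasis_repr_map, objVal, coordBasis_repr_map, genericArr, repr_ofCoord]
  rfl

variable {B : Type u} [CommRing B] [Algebra k B]

lemma algHom_ext_coord {ψ ψ' : P.SimplexRing E →ₐ[k] B}
    (h : ∀ c, ψ (P.univCoord E c) = ψ' (P.univCoord E c)) : ψ = ψ' := by
  refine QuotAlg.algHom_ext fun b => ?_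
  refine DFunLike.congr_fun (f := ψ.comp (QuotAlg.mk _)) (g := ψ'.comp (QuotAlg.mk _))
    (QuotAlg.algHom_ext fun b => ?_) b
  exact DFunLike.congr_fun (f := (ψ.comp (QuotAlg.mk _)).comp (QuotAlg.mk _))
    (g := (ψ'.comp (QuotAlg.mk _)).comp (QuotAlg.mk _)) (MvPolynomial.algHom_ext h) b

/-- A morphism from the universal ring is determined by the corresponding simplex. -/
lemma simplexRing_algHom_ext {ψ ψ' : P.SimplexRing E →ₐ[k] B}
    (h : (P.univSimplex E).map (MC.map (P.baseChangeMap ψ)) =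
      (P.univSimplex E).map (MC.map (P.baseChangeMap ψ'))) : ψ = ψ' := by
  refine P.algHom_ext_coord E fun c => ?_
  rcases c with ⟨i, t⟩ | ⟨⟨i, s, j, q⟩, t⟩
  · have h1 := congrArg (fun x => NerveSimplex.obj x i) h
    have h2 : P.baseChangeMapHom ψ (E i) (E i) 1 (P.univEta E i) =
        P.baseChangeMapHom ψ' (E i) (E i) 1 (P.univEta E i) :=
      congrArg Subtype.val (eq_of_heq (Sigma.mk.inj h1).2)
    rw [univCoord_inl, ← coordBasis_repr_map, ← coordBasis_repr_map, h2]
  · have h1 := congrArg (fun x => NerveSimplex.tot x i s j q) h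
    have h2 := (Sigma.mk.inj h1).2
    simp only [NerveSimplex.arr_map, arr_univSimplex] at h2
    have h3 : P.baseChangeMapHom ψ (E i) (E j) q (P.univVal E i s j q) =
        P.baseChangeMapHom ψ' (E i) (E j) q (P.univVal E i s j q) := eq_of_heq h2
    rw [univCoord_inr, ← coordBasis_repr_map, ← coordBasis_repr_map, h3]

end Universal

end DGCat

end

/-! ### Classifying homomorphisms of simplices -/

noncomputable section

namespace DGCat

section Classifying

variable {k : Type u} [Field k] (P : DGCat k)
variable {B C : Type u} [CommRing B] [Algebra k B] [CommRing C] [Algebra k C] {n : ℕ}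

lemma baseChangeMapHom_comp_apply {D : Type u} [CommRing D] [Algebra k D] (φ : B →ₐ[k] C)
    (ψ : C →ₐ[k] D) {E F : P.Obj} {i : ℤ} (z : B ⊗[k] P.Hom E F i) :
    P.baseChangeMapHom ψ E F i (P.baseChangeMapHom φ E F i z) =
      P.baseChangeMapHom (ψ.comp φ) E F i z :=
  (LinearMap.rTensor_comp_apply (P.Hom E F i) ψ.toLinearMap φ.toLinearMap z).symm

variable {P}

namespace NerveSimplex

variable (x : NerveSimplex (MC (P.baseChange B)) n)

/-- The objects underlying a simplex. -/
def under (i : Fin (n + 1)) : P.Obj := (x.obj i).1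

/-- The Maurer-Cartan elements of the objects of a simplex. -/
def eta (i : Fin (n + 1)) : B ⊗[k] P.Hom (x.under i) (x.under i) 1 := (x.obj i).2.1

/-- The values of a simplex. -/
def val (i : Fin (n + 1)) (s : Finset (Fin (n + 1))) (j : Fin (n + 1)) (q : ℤ) :
    B ⊗[k] P.Hom (x.under i) (x.under j) q := x.arr i s j q

lemma curv_eta (i : Fin (n + 1)) : (P.baseChange B).curv (E := x.under i) (x.eta i) =
    (0 : B ⊗[k] P.Hom (x.under i) (x.under i) 2) := (x.obj i).2.2

lemma val_eq_zero {i j : Fin (n + 1)} {s : Finset (Fin (n + 1))} {q : ℤ}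
    (h : IsDegeneratePlace i s j q) : x.val i s j q = 0 := x.arr_eq_zero h

lemma val_unit (i : Fin (n + 1)) : x.val i ∅ i 0 = 1 ⊗ₜ P.one (x.under i) := x.arr_unit i

end NerveSimplex

variable [∀ E F i, Module.Finite k (P.Hom E F i)]

namespace NerveSimplex

variable (x : NerveSimplex (MC (P.baseChange B)) n)

/-- The values of the coordinates on a simplex. -/
def coord : P.Coord x.under → B
  | .inl ⟨i, t⟩ => (P.coordBasis B (x.under i) (x.under i) 1).repr (x.eta i) t
  | .inr ⟨(i, s, j, q), t⟩ => (P.coordBasis B (x.under i) (x.under j) q).repr (x.val i s j q) t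

/-- The evaluation of the coordinates on a simplex. -/
def evalCoord : P.CoordRing x.under →ₐ[k] B := MvPolynomial.aeval x.coord

lemma evalCoord_genericEta (i : Fin (n + 1)) :
    P.baseChangeMapHom x.evalCoord _ _ _ (P.genericEta x.under i) = x.eta i :=
  P.coord_ext fun t => by
    rw [coordBasis_repr_map, genericEta, repr_ofCoord, evalCoord, MvPolynomial.aeval_X]; rfl

lemma evalCoord_genericArr (i : Fin (n + 1)) (s : Finset (Fin (n + 1))) (j : Fin (n + 1)) (q : ℤ) :
    P.baseChangeMapHom x.evalCoord _ _ _ (P.genericArr x.under i s j q) = x.val i s j q :=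
  P.coord_ext fun t => by
    rw [coordBasis_repr_map, genericArr, repr_ofCoord, evalCoord, MvPolynomial.aeval_X]; rfl

lemma objIdeal_le_ker : P.objIdeal x.under ≤ RingHom.ker x.evalCoord := by
  refine iSup_le fun i => (P.baseChangeMapHom_eq_zero_iff _ _).1 ?_
  refine ((P.baseChangeMap x.evalCoord).map_curv (E := x.under i)
    (P.genericEta x.under i)).trans ?_
  refine Eq.trans ?_ (x.curv_eta i)
  exact congrArg (fun η => (P.baseChange B).curv (E := x.under i) η) (x.evalCoord_genericEta i)

/-- The evaluation of the functions on families of objects and morphisms at a simplex. -/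
def evalObj : P.ObjRing x.under →ₐ[k] B := QuotAlg.desc x.evalCoord x.objIdeal_le_ker

lemma evalObj_objEta (i : Fin (n + 1)) :
    P.baseChangeMapHom x.evalObj _ _ _ (P.objEta x.under i) = x.eta i := by
  rw [objEta, baseChangeMapHom_comp_apply, evalObj, QuotAlg.desc_comp_mk, evalCoord_genericEta]

lemma evalObj_objVal (i : Fin (n + 1)) (s : Finset (Fin (n + 1))) (j : Fin (n + 1)) (q : ℤ) :
    P.baseChangeMapHom x.evalObj _ _ _ (P.objVal x.under i s j q) = x.val i s j q := by
  rw [objVal, baseChangeMapHom_comp_apply, evalObj, QuotAlg.desc_comp_mk, evalCoord_genericArr]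

lemma map_genericObj :
    (MC.map (P.baseChangeMap x.evalObj)).obj ∘ P.genericObj x.under = x.obj :=
  funext fun i => Sigma.ext rfl (heq_of_eq (Subtype.ext (x.evalObj_objEta i)))

lemma evalObj_objDefect {i j : Fin (n + 1)} {s : Finset (Fin (n + 1))} {q q' : ℤ}
    (h : q + 1 = q') (hq : q + s.card = 0) (hij : i < j) (hs : s ⊆ Finset.Ioo i j) :
    P.baseChangeMapHom x.evalObj _ _ _ (P.objDefect x.under i s j h) = 0 := by
  -- The objects of `x` are only propositionally equal to the images of the generic ones, so the
  -- equations satisfied by `x` are transported.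
  have h1 := (FinArray.isMC_iff_of_heq x.map_genericObj
    (b := FinArray.map (MC.map (P.baseChangeMap x.evalObj)) (P.objArr x.under)) (c := x.arr)
    (fun i s j q => heq_of_eq (x.evalObj_objVal i s j q)) i s j).2 (x.arr_isMC hij hs)
  refine Eq.trans ?_ (h1 h hq)
  exact FinArray.defect_map (MC.map (P.baseChangeMap x.evalObj)) (P.objArr x.under) i s j h

lemma relIdeal_le_ker : P.relIdeal x.under ≤ RingHom.ker x.evalObj := by
  refine sSup_le ?_
  rintro _ ⟨X, Y, i, z, hz, rfl⟩
  rw [← P.baseChangeMapHom_eq_zero_iff]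
  cases hz with
  | one i =>
    rw [map_sub, evalObj_objVal, baseChangeMapHom_tmul, map_one, val_unit, sub_self]
  | zero i s j q h => rw [evalObj_objVal, x.val_eq_zero h]
  | mc i s j q q' h hq hij hs => exact x.evalObj_objDefect h hq hij hs

/-- The homomorphism classifying a simplex. -/
def classify : P.SimplexRing x.under →ₐ[k] B := QuotAlg.desc x.evalObj x.relIdeal_le_ker

lemma classify_univEta (i : Fin (n + 1)) :
    P.baseChangeMapHom x.classify _ _ _ (P.univEta x.under i) = x.eta i := by
  rw [univEta, baseChangeMapHom_comp_apply, classify, QuotAlg.desc_comp_mk, evalObj_objEta]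

lemma classify_univVal (i : Fin (n + 1)) (s : Finset (Fin (n + 1))) (j : Fin (n + 1)) (q : ℤ) :
    P.baseChangeMapHom x.classify _ _ _ (P.univVal x.under i s j q) = x.val i s j q := by
  rw [univVal, baseChangeMapHom_comp_apply, classify, QuotAlg.desc_comp_mk, evalObj_objVal]

/-- A simplex is the image of the universal one under its classifying homomorphism. -/
lemma map_classify : (P.univSimplex x.under).map (MC.map (P.baseChangeMap x.classify)) = x := by
  refine ext_arr (funext fun i => Sigma.ext rfl (heq_of_eq (Subtype.ext (x.classify_univEta i))))
    fun i s j q _ _ _ => heq_of_eq ?_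
  refine Eq.trans ?_ (x.classify_univVal i s j q)
  refine (arr_map (MC.map (P.baseChangeMap x.classify)) (P.univSimplex x.under) i s j q).trans ?_
  exact congrArg (P.baseChangeMapHom x.classify _ _ _) (P.arr_univSimplex x.under i s j q)

end NerveSimplex

variable (P) in
/-- The homomorphism classifying the image of the universal simplex. -/
lemma classify_univSimplex_map {E : Fin (n + 1) → P.Obj} (ψ : P.SimplexRing E →ₐ[k] B) :
    ((P.univSimplex E).map (MC.map (P.baseChangeMap ψ))).classify = ψ :=
  P.simplexRing_algHom_ext E (NerveSimplex.map_classify _)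

end Classifying

end DGCat

end

/-! ### The classifying algebras and the open locus of invertible edges -/

noncomputable section

/-- Generators are the idempotents of the factors and the generators of each factor, placed in their
own component. -/
lemma Algebra.FiniteType.pi_of_finite {R ι : Type*} [CommRing R] [Finite ι] {A : ι → Type*}
    [∀ i, CommRing (A i)] [∀ i, Algebra R (A i)] [h : ∀ i, Algebra.FiniteType R (A i)] :
    Algebra.FiniteType R (∀ i, A i) := by
  classical
  have := Fintype.ofFinite ι
  choose s hs using fun i => (h i).out
  let T : Finset (∀ i, A i) := Finset.univ.biUnion fun i => (insert 1 (s i)).image (Pi.single i)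
  have hT : ∀ i, ∀ a ∈ insert 1 (s i), Pi.single i a ∈ Algebra.adjoin R (T : Set (∀ i, A i)) :=
    fun i a ha => Algebra.subset_adjoin (by
      simp only [T, Finset.coe_biUnion, Set.mem_iUnion]
      exact ⟨i, by simp, Finset.mem_coe.2 (Finset.mem_image_of_mem _ ha)⟩)
  have key : ∀ i (a : A i), Pi.single i a ∈ Algebra.adjoin R (T : Set (∀ i, A i)) := by
    intro i a
    have ha : a ∈ Algebra.adjoin R (s i : Set (A i)) := by rw [hs]; trivial
    induction ha using Algebra.adjoin_induction with
    | mem x hx => exact hT i x (Finset.mem_insert_of_mem hx)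
    | algebraMap r =>
      have := Subalgebra.smul_mem _ (hT i 1 (Finset.mem_insert_self _ _)) r
      rwa [← Pi.single_smul, ← Algebra.algebraMap_eq_smul_one] at this
    | add x y _ _ hx hy => rw [Pi.single_add]; exact add_mem hx hy
    | mul x y _ _ hx hy => rw [Pi.single_mul]; exact mul_mem hx hy
  refine ⟨T, Algebra.eq_top_iff.2 fun x => ?_⟩
  rw [← Finset.univ_sum_single x]
  exact Subalgebra.sum_mem _ fun i _ => key i _

namespace DGCat

section Nerve

variable {k : Type u} [Field k] (P : DGCat k) [∀ E F i, Module.Finite k (P.Hom E F i)]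
variable {B C : Type u} [CommRing B] [Algebra k B] [CommRing C] [Algebra k C] {m n : ℕ}

lemma univCoord_eq_zero (E : Fin (n + 1) → P.Obj) {i j : Fin (n + 1)} {s : Finset (Fin (n + 1))}
    {q : ℤ} (h : IsDegeneratePlace i s j q) (t : Fin (P.homDim (E i) (E j) q)) :
    P.univCoord E (Sum.inr ⟨(i, s, j, q), t⟩) = 0 := by
  rw [univCoord_inr, univVal_eq_zero P E h, map_zero]; rfl

/-- The polynomial ring has a variable for every place and every integer degree, but at a place `(i,
s, j)` the coordinates vanish in the quotient outside the degree `-|s|`. Finitely many generators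
are left. -/
instance (E : Fin (n + 1) → P.Obj) : Algebra.FiniteType k (P.SimplexRing E) := by
  have hfin : (Set.range (P.univCoord E)).Finite := by
    let f : (Σ i : Fin (n + 1), Fin (P.homDim (E i) (E i) 1)) ⊕
        (Σ t : Fin (n + 1) × Finset (Fin (n + 1)) × Fin (n + 1),
          Fin (P.homDim (E t.1) (E t.2.2) (-t.2.1.card))) → P.SimplexRing E :=
      Sum.elim (fun c => P.univCoord E (Sum.inl c))
        fun c => P.univCoord E (Sum.inr ⟨(c.1.1, c.1.2.1, c.1.2.2, -c.1.2.1.card), c.2⟩)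
    refine ((Set.finite_range f).insert 0).subset ?_
    rintro _ ⟨c, rfl⟩
    rcases c with c | ⟨⟨i, s, j, q⟩, t⟩
    · exact .inr ⟨.inl c, rfl⟩
    by_cases hq : q + s.card = 0
    · obtain rfl : q = -s.card := by omega
      exact .inr ⟨.inr ⟨(i, s, j), t⟩, rfl⟩
    · refine .inl (P.univCoord_eq_zero E ⟨fun h => hq h.2.2, ?_⟩ t)
      rintro ⟨-, h1, h2⟩
      have h1 : s = ∅ := h1
      have h2 : q = 0 := h2
      exact hq (by simp [h1, h2])
  refine ⟨hfin.toFinset, ?_⟩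
  let π : P.CoordRing E →ₐ[k] P.SimplexRing E :=
    (QuotAlg.mk (k := k) (P.relIdeal E)).comp (QuotAlg.mk (k := k) (P.objIdeal E))
  have hπ : Function.Surjective π :=
    (QuotAlg.mk_surjective (k := k) _).comp (QuotAlg.mk_surjective (k := k) _)
  rw [Set.Finite.coe_toFinset, show Set.range (P.univCoord E) = π '' Set.range MvPolynomial.X from
    Set.range_comp π MvPolynomial.X, ← AlgHom.map_adjoin, MvPolynomial.adjoin_range_X,
    Algebra.map_top, AlgHom.range_eq_top]
  exact hπ

/-- The algebra whose spectrum classifies the `n`-simplices of the coherent nerves. -/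
abbrev NerveRing (n : ℕ) : Type u := ∀ E : Fin (n + 1) → P.Obj, P.SimplexRing E

lemma finiteType_nerveRing [Finite P.Obj] (n : ℕ) : Algebra.FiniteType k (P.NerveRing n) :=
  .pi_of_finite

/-- The projection to the component of the simplices with underlying objects `E`. -/
def nerveProj (E : Fin (n + 1) → P.Obj) : P.NerveRing n →ₐ[k] P.SimplexRing E :=
  Pi.evalAlgHom k _ E

lemma nerveProj_surjective (E : Fin (n + 1) → P.Obj) : Function.Surjective (P.nerveProj E) :=
  Function.surjective_eval E

open Classical in
/-- The idempotent of the component of the simplices with underlying objects `E`. -/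
def nerveIdem (E : Fin (n + 1) → P.Obj) : P.NerveRing n := Pi.single E 1

lemma isIdempotentElem_nerveIdem (E : Fin (n + 1) → P.Obj) :
    IsIdempotentElem (P.nerveIdem E) := by
  classical
  rw [IsIdempotentElem, nerveIdem, ← Pi.single_mul, one_mul]

lemma nerveProj_nerveIdem (E : Fin (n + 1) → P.Obj) : P.nerveProj E (P.nerveIdem E) = 1 := by
  classical exact Pi.single_eq_same _ _

lemma nerveProj_nerveIdem_of_ne {E E' : Fin (n + 1) → P.Obj} (h : E ≠ E') :
    P.nerveProj E (P.nerveIdem E') = 0 := by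
  classical exact Pi.single_eq_of_ne h _

/-- A homomorphism under which the idempotent of a component is one factors over the component. -/
lemma exists_comp_nerveProj {E : Fin (n + 1) → P.Obj} {y : P.NerveRing n →ₐ[k] B}
    (hy : y (P.nerveIdem E) = 1) : ∃ ψ : P.SimplexRing E →ₐ[k] B, ψ.comp (P.nerveProj E) = y := by
  classical
  have key : ∀ a, y (Pi.single E (P.nerveProj E a)) = y a := fun a => by
    have : Pi.single E (P.nerveProj E a) = P.nerveIdem E * a := by
      ext E'
      by_cases h : E' = E
      · subst h; simp [nerveIdem, nerveProj]
      · simp [nerveIdem, Pi.single_eq_of_ne h]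
    rw [this, map_mul, hy, one_mul]
  refine ⟨AlgHom.ofLinearMap (y.toLinearMap ∘ₗ LinearMap.single k _ E) hy fun a b => ?_,
    AlgHom.ext key⟩
  change y (Pi.single E (a * b)) = y (Pi.single E a) * y (Pi.single E b)
  rw [Pi.single_mul, map_mul]

end Nerve

namespace NerveSimplex

lemma map_pullback {S T : Type u} [CommRing S] [CommRing T] {A : DGCat S} {A' : DGCat T}
    (F : Functor A A') {m n : ℕ} (θ : Fin (m + 1) →o Fin (n + 1)) (x : NerveSimplex A n) :
    (x.pullback θ).map F = (x.map F).pullback θ := rfl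

section

variable {k : Type u} [Field k] {P : DGCat k}
variable {B C : Type u} [CommRing B] [Algebra k B] [CommRing C] [Algebra k C] {m n : ℕ}

/-- Extension of scalars. -/
abbrev mapAlg (x : NerveSimplex (MC (P.baseChange B)) n) (φ : B →ₐ[k] C) :
    NerveSimplex (MC (P.baseChange C)) n := x.map (MC.map (P.baseChangeMap φ))

lemma mapAlg_comp (x : NerveSimplex (MC (P.baseChange B)) n) (φ : B →ₐ[k] C) {D : Type u}
    [CommRing D] [Algebra k D] (ψ : C →ₐ[k] D) : x.mapAlg (ψ.comp φ) = (x.mapAlg φ).mapAlg ψ := by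
  rw [mapAlg, baseChangeMap_comp]; rfl

lemma mapAlg_id (x : NerveSimplex (MC (P.baseChange B)) n) : x.mapAlg (AlgHom.id k B) = x := by
  rw [mapAlg, baseChangeMap_id]; rfl

variable [∀ E F i, Module.Finite k (P.Hom E F i)]

/-- The point of the spectrum of `P.NerveRing n` corresponding to a simplex. -/
def point (x : NerveSimplex (MC (P.baseChange B)) n) : P.NerveRing n →ₐ[k] B :=
  x.classify.comp (P.nerveProj x.under)

lemma point_univSimplex_mapAlg {E : Fin (n + 1) → P.Obj} (ψ : P.SimplexRing E →ₐ[k] B) :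
    ((P.univSimplex E).mapAlg ψ).point = ψ.comp (P.nerveProj E) :=
  congrArg (fun χ : P.SimplexRing E →ₐ[k] B => χ.comp (P.nerveProj E))
    (P.classify_univSimplex_map ψ)

lemma point_univSimplex (E : Fin (n + 1) → P.Obj) : (P.univSimplex E).point = P.nerveProj E := by
  conv_lhs => rw [← mapAlg_id (P.univSimplex E)]
  rw [point_univSimplex_mapAlg, AlgHom.id_comp]

lemma point_mapAlg (x : NerveSimplex (MC (P.baseChange B)) n) (φ : B →ₐ[k] C) :
    (x.mapAlg φ).point = φ.comp x.point := by
  conv_lhs => rw [← x.map_classify]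
  rw [← mapAlg, ← mapAlg_comp, point_univSimplex_mapAlg]; rfl

lemma point_nerveIdem (x : NerveSimplex (MC (P.baseChange B)) n) :
    x.point (P.nerveIdem x.under) = 1 := by
  rw [point, AlgHom.comp_apply, P.nerveProj_nerveIdem, map_one]

lemma under_eq_of_point_nerveIdem [Nontrivial B] (x : NerveSimplex (MC (P.baseChange B)) n)
    {E : Fin (n + 1) → P.Obj} (h : x.point (P.nerveIdem E) = 1) : x.under = E := by
  by_contra hE
  rw [point, AlgHom.comp_apply, P.nerveProj_nerveIdem_of_ne hE, map_zero] at h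
  exact zero_ne_one h

/-- The obstruction to coming from a simplex is that a point may lie on different components over
different parts of `Spec B`; the condition on the idempotent excludes this. -/
lemma exists_point_eq {E : Fin (n + 1) → P.Obj} {y : P.NerveRing n →ₐ[k] B}
    (hy : y (P.nerveIdem E) = 1) :
    ∃ ψ : P.SimplexRing E →ₐ[k] B, ((P.univSimplex E).mapAlg ψ).point = y := by
  obtain ⟨ψ, rfl⟩ := P.exists_comp_nerveProj hy
  exact ⟨ψ, point_univSimplex_mapAlg ψ⟩

lemma univSimplex_mapAlg_congr {E E' : Fin (n + 1) → P.Obj} (h : E = E')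
    {ψ : P.SimplexRing E →ₐ[k] B} {ψ' : P.SimplexRing E' →ₐ[k] B}
    (hψ : ψ.comp (P.nerveProj E) = ψ'.comp (P.nerveProj E')) :
    (P.univSimplex E).mapAlg ψ = (P.univSimplex E').mapAlg ψ' := by
  subst h
  obtain rfl : ψ = ψ' := AlgHom.ext fun a => by
    obtain ⟨b, rfl⟩ := P.nerveProj_surjective E a
    exact DFunLike.congr_fun hψ b
  rfl

lemma ext_point_of_under {x y : NerveSimplex (MC (P.baseChange B)) n} (h : x.under = y.under)
    (hxy : x.point = y.point) : x = y := by
  rw [← x.map_classify, ← y.map_classify]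
  exact univSimplex_mapAlg_congr h hxy

/-- The idempotents detect the underlying objects. Over the zero ring they do not: all points
coincide there, while simplices may have different objects. -/
lemma ext_point [Nontrivial B] {x y : NerveSimplex (MC (P.baseChange B)) n}
    (hxy : x.point = y.point) : x = y :=
  ext_point_of_under (x.under_eq_of_point_nerveIdem (by rw [hxy, y.point_nerveIdem])) hxy

end

end NerveSimplex

section Simplicial

variable {k : Type u} [Field k] (P : DGCat k) [∀ E F i, Module.Finite k (P.Hom E F i)]
variable {B C : Type u} [CommRing B] [Algebra k B] [CommRing C] [Algebra k C] {l m n : ℕ}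

/-- The cosimplicial structure of the classifying algebras. -/
def nerveMap (θ : Fin (m + 1) →o Fin (n + 1)) : P.NerveRing m →ₐ[k] P.NerveRing n :=
  AlgHom.pi fun E => ((P.univSimplex E).pullback θ).point

lemma nerveProj_comp_nerveMap (θ : Fin (m + 1) →o Fin (n + 1)) (E : Fin (n + 1) → P.Obj) :
    (P.nerveProj E).comp (P.nerveMap θ) = ((P.univSimplex E).pullback θ).point := rfl

variable {P} in
-- Every simplex is an image of a universal one, for which the formula is the definition of
-- `nerveMap`.
lemma NerveSimplex.point_pullback (x : NerveSimplex (MC (P.baseChange B)) n)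
    (θ : Fin (m + 1) →o Fin (n + 1)) : (x.pullback θ).point = x.point.comp (P.nerveMap θ) := by
  conv_lhs => rw [← x.map_classify]
  rw [← map_pullback, ← mapAlg, point_mapAlg, ← nerveProj_comp_nerveMap]; rfl

lemma nerveRing_hom_ext {ψ ψ' : B →ₐ[k] P.NerveRing n}
    (h : ∀ E, (P.nerveProj E).comp ψ = (P.nerveProj E).comp ψ') : ψ = ψ' :=
  AlgHom.ext fun b => funext fun E => DFunLike.congr_fun (h E) b

lemma nerveMap_id : P.nerveMap (OrderHom.id : Fin (n + 1) →o Fin (n + 1)) = AlgHom.id k _ :=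
  P.nerveRing_hom_ext fun E => by
    rw [nerveProj_comp_nerveMap, NerveSimplex.pullback_id, NerveSimplex.point_univSimplex,
      AlgHom.comp_id]

lemma nerveMap_comp (θ : Fin (m + 1) →o Fin (n + 1)) (θ' : Fin (l + 1) →o Fin (m + 1)) :
    P.nerveMap (θ.comp θ') = (P.nerveMap θ).comp (P.nerveMap θ') :=
  P.nerveRing_hom_ext fun E => by
    rw [nerveProj_comp_nerveMap, NerveSimplex.pullback_comp, NerveSimplex.point_pullback,
      ← AlgHom.comp_assoc, nerveProj_comp_nerveMap]

end Simplicial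

section Star

variable {k : Type u} [Field k] {P : DGCat k} [∀ E F i, Module.Finite k (P.Hom E F i)]
variable {B C : Type u} [CommRing B] [Algebra k B] [CommRing C] [Algebra k C] {m n : ℕ}

/-- The points given by the simplices all of whose edges are equivalences. -/
def IsStarPoint (y : P.NerveRing n →ₐ[k] B) : Prop :=
  ∃ x : NerveSimplex (MC (P.baseChange B)) n, x.IsStar ∧ x.point = y

lemma IsStarPoint.comp {y : P.NerveRing n →ₐ[k] B} (hy : IsStarPoint y) (φ : B →ₐ[k] C) :
    IsStarPoint (φ.comp y) := by
  obtain ⟨x, hx, rfl⟩ := hy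
  exact ⟨x.mapAlg φ, hx.map _, x.point_mapAlg φ⟩

lemma IsStarPoint.comp_nerveMap {y : P.NerveRing n →ₐ[k] B} (hy : IsStarPoint y)
    (θ : Fin (m + 1) →o Fin (n + 1)) : IsStarPoint (y.comp (P.nerveMap θ)) := by
  obtain ⟨x, hx, rfl⟩ := hy
  exact ⟨x.pullback θ, hx.pullback θ, x.point_pullback θ⟩

variable (P) in
/-- The localization of the classifying algebra. -/
abbrev nerveAway (b : P.NerveRing n) : P.NerveRing n →ₐ[k] Localization.Away b :=
  IsScalarTower.toAlgHom k _ _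

variable (P n) in
/-- The locus of the simplices all of whose edges are equivalences. -/
def starLocus : Set (PrimeSpectrum (P.NerveRing n)) :=
  {p | ∃ b, b ∉ p.asIdeal ∧ IsStarPoint (P.nerveAway b)}

lemma isOpen_starLocus : IsOpen (P.starLocus n) := by
  refine isOpen_iff_forall_mem_open.2 fun p ⟨b, hb, h⟩ =>
    ⟨PrimeSpectrum.basicOpen b, fun q hq => ⟨b, hq, h⟩, (PrimeSpectrum.basicOpen b).2, hb⟩

/-- A point at which `b` is invertible factors over the localization at `b`, and extension of
scalars preserves equivalences. -/
lemma IsStarPoint.of_isUnit {b : P.NerveRing n} (hb : IsStarPoint (P.nerveAway b))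
    {y : P.NerveRing n →ₐ[k] B} (hy : IsUnit (y b)) : IsStarPoint y := by
  let ψ : Localization.Away b →ₐ[k] B :=
    { IsLocalization.Away.lift b (g := (y : P.NerveRing n →+* B)) hy with
      commutes' := fun r => by
        have : algebraMap k (Localization.Away b) r =
          algebraMap (P.NerveRing n) _ (algebraMap k _ r) := rfl
        rw [this]
        refine (IsLocalization.Away.lift_eq b (g := (y : P.NerveRing n →+* B)) hy _).trans ?_
        exact y.commutes r }
  have h : ψ.comp (P.nerveAway b) = y :=
    AlgHom.ext fun a => IsLocalization.Away.lift_eq b (g := (y : P.NerveRing n →+* B)) hy a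
  rw [← h]
  exact hb.comp ψ

/-- Being a point given by a simplex with invertible edges is an open condition. -/
lemma IsStarPoint.comap_mem {y : P.NerveRing n →ₐ[k] B} (hy : IsStarPoint y)
    (q : PrimeSpectrum B) : PrimeSpectrum.comap (y : P.NerveRing n →+* B) q ∈ P.starLocus n := by
  classical
  obtain ⟨x, hx, rfl⟩ := hy
  -- Over the residue field at `q` the edges are equivalences. The openness lemma, applied to each
  -- edge of the universal simplex, then gives functions `b` whose invertibility makes the edges
  -- equivalences.
  let κ : B →ₐ[k] q.asIdeal.ResidueField := IsScalarTower.toAlgHom k _ _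
  let E := x.under
  let φ : P.SimplexRing E →ₐ[k] q.asIdeal.ResidueField := κ.comp x.classify
  have hx' : ((P.univSimplex E).mapAlg φ).IsStar := by
    have h := hx.map (MC.map (P.baseChangeMap κ))
    rw [← x.map_classify, ← NerveSimplex.mapAlg, ← NerveSimplex.mapAlg,
      ← NerveSimplex.mapAlg_comp] at h
    exact h
  have hx2 := (NerveSimplex.isStar_iff_arr _).1 hx'
  have key : ∀ e : {e : Fin (n + 1) × Fin (n + 1) // e.1 < e.2}, ∃ b : P.SimplexRing E,
      φ b ≠ 0 ∧ ∀ {C : Type u} [CommRing C] [Algebra k C] (ψ : P.SimplexRing E →ₐ[k] C),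
        IsUnit (ψ b) → (MC (P.baseChange C)).IsEquivalence
          (((P.univSimplex E).mapAlg ψ).arr e.1.1 ∅ e.1.2 0) := by
    intro e
    have h1 := hx2 e.1.1 e.1.2 e.2
    rw [NerveSimplex.arr_map] at h1
    obtain ⟨b, hb, h2⟩ := (isFreeBaseChange_baseChangeMap P φ inferInstance).exists_isEquivalence
      ((P.univSimplex E).d_arr_empty e.2) h1
    refine ⟨b, hb, fun ψ hψ => ?_⟩
    have h3 := h2 ψ.toRingHom (MC.map (P.baseChangeMap ψ))
      (fun a f => P.baseChangeMapHom_smul ψ a f) hψ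
    rwa [← NerveSimplex.arr_map] at h3
  choose b hb hb' using key
  -- A function supported on the component of `E`; inverting it forces the underlying objects to be
  -- `E` and all edges to be invertible.
  let c : P.NerveRing n := Pi.single E (∏ e, b e)
  have hc1 : P.nerveIdem E * c = c := by
    rw [nerveIdem, ← Pi.single_mul, one_mul]
  have hc2 : P.nerveProj E c = ∏ e, b e := Pi.single_eq_same _ _
  refine ⟨c, fun hc => ?_, ?_⟩
  · have h1 : κ (x.classify (P.nerveProj E c)) = 0 := Ideal.algebraMap_residueField_eq_zero.2 hc
    rw [hc2] at h1
    have h2 : φ (∏ e, b e) = 0 := h1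
    rw [map_prod, Finset.prod_eq_zero_iff] at h2
    obtain ⟨e, _, he⟩ := h2
    exact hb e he
  · have hu : IsUnit (P.nerveAway c c) := IsLocalization.Away.algebraMap_isUnit c
    -- The idempotent fixes `c`, which is a unit in the localization, so it becomes `1`.
    have h1 : P.nerveAway c (P.nerveIdem E) = 1 := by
      refine hu.mul_right_cancel ?_
      rw [← map_mul, hc1, one_mul]
    obtain ⟨ψ, hψ⟩ := NerveSimplex.exists_point_eq h1
    refine ⟨_, (NerveSimplex.isStar_iff_arr _).2 fun i j hij => hb' ⟨(i, j), hij⟩ ψ ?_, hψ⟩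
    have h2 : P.nerveAway c c = ψ (∏ e, b e) := by
      rw [← hψ, NerveSimplex.point_univSimplex_mapAlg, AlgHom.comp_apply, hc2]
    rw [h2, map_prod] at hu
    exact isUnit_of_dvd_unit (Finset.dvd_prod_of_mem (fun e => ψ (b e)) (Finset.mem_univ _)) hu

end Star

end DGCat

end

/-! ### Smoothness from infinitesimal lifting -/

noncomputable section

/-- An ideal of square zero is contained in every prime. -/
lemma PrimeSpectrum.comap_surjective_of_ker_sq_eq_bot {B C : Type*} [CommRing B] [CommRing C]
    {φ : B →+* C} (hφ : Function.Surjective φ) (h : RingHom.ker φ ^ 2 = ⊥) :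
    Function.Surjective (PrimeSpectrum.comap φ) := by
  rw [← Set.range_eq_univ, _root_.range_comap_of_surjective _ φ hφ, Set.eq_univ_iff_forall]
  intro q b hb
  refine q.2.mem_of_pow_mem 2 ?_
  have := Ideal.pow_mem_pow (show b ∈ RingHom.ker φ from hb) 2
  rw [h] at this
  rw [(Ideal.mem_bot).1 this]
  exact zero_mem _

namespace AlgebraicGeometry

/-- A morphism of schemes that are locally of finite type over a field is smooth if it has, locally
on the source, the lifting property with respect to square-zero extensions of algebras. -/
lemma smooth_of_lifting {k : Type u} [Field k] {X Y : Scheme.{u}} (f : X ⟶ Y)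
    (p : Y ⟶ Spec (.of k)) [LocallyOfFiniteType p] [LocallyOfFiniteType (f ≫ p)]
    (H : ∀ x : X, ∃ V : X.Opens, x ∈ V ∧ ∀ {B C : Type u} [CommRing B] [CommRing C] [Algebra k B]
      [Algebra k C] (π : B →ₐ[k] C), Function.Surjective π → RingHom.ker π ^ 2 = ⊥ →
      ∀ (g : Spec (.of C) ⟶ X) (h : Spec (.of B) ⟶ Y), (∀ q, g q ∈ V) →
        h ≫ p = Spec.map (CommRingCat.ofHom (algebraMap k B)) →
        Spec.map (CommRingCat.ofHom (π : B →+* C)) ≫ h = g ≫ f →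
        ∃ g' : Spec (.of B) ⟶ X, Spec.map (CommRingCat.ofHom (π : B →+* C)) ≫ g' = g ∧
          g' ≫ f = h) : Smooth f := by
  -- Over a field the target is locally noetherian, so `f` is even locally of finite presentation
  -- and only formal smoothness on affine charts remains.
  have : LocallyOfFiniteType f := locallyOfFiniteType_of_comp f p
  have : IsLocallyNoetherian (Spec (.of k)) := inferInstance
  have : IsLocallyNoetherian Y := LocallyOfFiniteType.isLocallyNoetherian p
  have : LocallyOfFinitePresentation f := inferInstance
  rw [HasRingHomProperty.iff_exists_appLE (P := @Smooth) (Q := RingHom.Smooth)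
    (RingHom.Smooth.stableUnderComposition.stableUnderCompositionWithLocalizationAway
      RingHom.Smooth.holdsForLocalizationAway).1]
  intro x
  obtain ⟨V₀, hxV₀, H⟩ := H x
  obtain ⟨U, hU, hxU, -⟩ := exists_isAffineOpen_mem_and_subset
    (show f x ∈ (⊤ : Y.Opens) from trivial)
  obtain ⟨V, hV, hxV, hVU⟩ := exists_isAffineOpen_mem_and_subset
    (show x ∈ V₀ ⊓ f ⁻¹ᵁ U from ⟨hxV₀, hxU⟩)
  have e : V ≤ f ⁻¹ᵁ U := fun y hy => (hVU hy).2
  refine ⟨⟨U, hU⟩, ⟨V, hV⟩, hxV, e, ?_⟩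
  let := (f.appLE U V e).hom.toAlgebra
  have hfp : Algebra.FinitePresentation Γ(Y, U) Γ(X, V) := f.finitePresentation_appLE hU hV e
  refine ⟨Algebra.FormallySmooth.iff_comp_surjective.2 fun B _ _ I hI t => ?_, hfp⟩
  let h : Spec (.of B) ⟶ Y := Spec.map (CommRingCat.ofHom (algebraMap Γ(Y, U) B)) ≫ hU.fromSpec
  -- The test algebra `B` is given over a chart of `Y`; its `k`-structure is read off from the
  -- composite `Spec B → Y → Spec k`.
  let ρ : CommRingCat.of k ⟶ CommRingCat.of B := Spec.preimage (h ≫ p)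
  let := ρ.hom.toAlgebra
  let π : B →ₐ[k] B ⧸ I := Ideal.Quotient.mkₐ k I
  have hker : RingHom.ker π ^ 2 = ⊥ := by
    rw [show RingHom.ker π = I from Ideal.Quotient.mkₐ_ker k I, hI]
  let g : Spec (.of (B ⧸ I)) ⟶ X :=
    Spec.map (CommRingCat.ofHom (t : Γ(X, V) →+* B ⧸ I)) ≫ hV.fromSpec
  have hgV : ∀ q, g q ∈ V := fun q => by
    rw [← SetLike.mem_coe, ← hV.range_fromSpec]
    exact ⟨_, rfl⟩
  have hfe := IsAffineOpen.SpecMap_appLE_fromSpec f hU hV e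
  obtain ⟨g', hg', hgf⟩ := H π (Ideal.Quotient.mkₐ_surjective k I)
    hker g h
    (fun q => (hVU (hgV q)).1) (Spec.map_preimage (h ≫ p)).symm (by
      rw [Category.assoc, ← hfe, ← Spec.map_comp_assoc, ← Spec.map_comp_assoc]
      congr 2
      ext r
      exact (t.commutes r).symm)
  -- The lift stays in the chart `V`: every point of `Spec B` comes from `Spec (B ⧸ I)`, where `g'`
  -- is `g`.
  have hrange : Set.range g' ⊆ Set.range hV.fromSpec := by
    rintro _ ⟨q, rfl⟩
    obtain ⟨q', rfl⟩ : ∃ q', Spec.map (CommRingCat.ofHom (π : B →+* B ⧸ I)) q' = q := by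
      exact PrimeSpectrum.comap_surjective_of_ker_sq_eq_bot (φ := (π : B →+* B ⧸ I))
        (Ideal.Quotient.mkₐ_surjective k I) hker q
    rw [← Scheme.Hom.comp_apply, hg', hV.range_fromSpec]
    exact hgV q'
  let ψ := Spec.preimage (IsOpenImmersion.lift hV.fromSpec g' hrange)
  have hψ : Spec.map ψ ≫ hV.fromSpec = g' := by
    rw [Spec.map_preimage, IsOpenImmersion.lift_fac]
  have h1 : f.appLE U V e ≫ ψ = CommRingCat.ofHom (algebraMap Γ(Y, U) B) := by
    apply Spec.map_injective
    rw [← cancel_mono hU.fromSpec, Spec.map_comp, Category.assoc, hfe, reassoc_of% hψ, hgf]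
  have h2 : ψ ≫ CommRingCat.ofHom (π : B →+* B ⧸ I) =
      CommRingCat.ofHom (t : Γ(X, V) →+* B ⧸ I) := by
    apply Spec.map_injective
    rw [← cancel_mono hV.fromSpec, Spec.map_comp, Category.assoc, hψ, hg']
  refine ⟨{ ψ.hom with commutes' := fun r => congr($h1 r) }, AlgHom.ext fun a => congr($h2 a)⟩

end AlgebraicGeometry

end

/-! ### The simplicial scheme of simplices with invertible edges -/

noncomputable section

namespace DGCat

section Scheme

variable {k : Type u} [Field k] (P : DGCat k) [∀ E F i, Module.Finite k (P.Hom E F i)]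
variable {l m n : ℕ}

/-- The structure morphism of the spectrum of an algebra. -/
abbrev specStr (k B : Type u) [CommRing k] [CommRing B] [Algebra k B] :
    Spec (.of B) ⟶ Spec (.of k) :=
  Spec.map (CommRingCat.ofHom (algebraMap k B))

/-- The morphism of spectra given by a morphism of algebras. -/
abbrev specMap {k B C : Type u} [CommRing k] [CommRing B] [Algebra k B] [CommRing C] [Algebra k C]
    (φ : B →ₐ[k] C) : Spec (.of C) ⟶ Spec (.of B) :=
  Spec.map (CommRingCat.ofHom (φ : B →+* C))

lemma specMap_comp {k B C D : Type u} [CommRing k] [CommRing B] [Algebra k B] [CommRing C]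
    [Algebra k C] [CommRing D] [Algebra k D] (φ : B →ₐ[k] C) (ψ : C →ₐ[k] D) :
    specMap (ψ.comp φ) = specMap ψ ≫ specMap φ := by
  rw [← Spec.map_comp]; rfl

lemma specMap_id {k B : Type u} [CommRing k] [CommRing B] [Algebra k B] :
    specMap (AlgHom.id k B) = 𝟙 _ := Spec.map_id _

lemma specMap_str {k B C : Type u} [CommRing k] [CommRing B] [Algebra k B] [CommRing C]
    [Algebra k C] (φ : B →ₐ[k] C) : specMap φ ≫ specStr k B = specStr k C := by
  rw [← Spec.map_comp, ← CommRingCat.ofHom_comp, φ.comp_algebraMap]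

lemma specMap_injective {k B C : Type u} [CommRing k] [CommRing B] [Algebra k B] [CommRing C]
    [Algebra k C] {φ ψ : B →ₐ[k] C} (h : specMap φ = specMap ψ) : φ = ψ := by
  have := Spec.map_injective h
  ext b
  exact congr($this b)

lemma exists_specMap_eq {k B C : Type u} [CommRing k] [CommRing B] [Algebra k B] [CommRing C]
    [Algebra k C] (g : Spec (.of C) ⟶ Spec (.of B)) (h : g ≫ specStr k B = specStr k C) :
    ∃ φ : B →ₐ[k] C, specMap φ = g := by
  obtain ⟨ψ, rfl⟩ := Spec.map_surjective g
  rw [← Spec.map_comp] at h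
  have := Spec.map_injective h
  exact ⟨{ ψ.hom with commutes' := fun r => congr($this r) }, rfl⟩

variable (n) in
/-- The open subscheme of the simplices all of whose edges are equivalences. -/
def starOpen : (Spec (.of (P.NerveRing n))).Opens := ⟨P.starLocus n, isOpen_starLocus⟩

variable (n) in
/-- The scheme of the `n`-simplices of `NC*`. -/
def starScheme : Scheme.{u} := P.starOpen n

variable (n) in
/-- The embedding into the spectrum of `P.NerveRing n`. -/
def starι : P.starScheme n ⟶ Spec (.of (P.NerveRing n)) := (P.starOpen n).ι

instance : IsOpenImmersion (P.starι n) := inferInstanceAs (IsOpenImmersion (P.starOpen n).ι)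

lemma range_starι : Set.range (P.starι n) = P.starLocus n := Scheme.Opens.range_ι _

variable (n) in
/-- The scheme of the `n`-simplices of `NC*`, over the base field. -/
abbrev starOver : Over (Spec (.of k)) := Over.mk (P.starι n ≫ specStr k (P.NerveRing n))

/-- Near `p` the universal point is given by a simplex with invertible edges. Its pullback along `θ`
has invertible edges too, so all its values lie in the open locus. -/
lemma comap_nerveMap_mem (θ : Fin (m + 1) →o Fin (n + 1)) {p : PrimeSpectrum (P.NerveRing n)}
    (hp : p ∈ P.starLocus n) :
    PrimeSpectrum.comap (P.nerveMap θ : P.NerveRing m →+* P.NerveRing n) p ∈ P.starLocus m := by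
  obtain ⟨b, hb, h⟩ := hp
  obtain ⟨p', rfl⟩ : p ∈ Set.range (PrimeSpectrum.comap (algebraMap (P.NerveRing n)
      (Localization.Away b))) := by
    rw [PrimeSpectrum.localization_away_comap_range _ b]; exact hb
  exact (h.comp_nerveMap θ).comap_mem p'

/-- The simplicial structure of the schemes of simplices. -/
def starMap (θ : Fin (m + 1) →o Fin (n + 1)) : P.starScheme n ⟶ P.starScheme m :=
  IsOpenImmersion.lift (P.starι m) (P.starι n ≫ specMap (P.nerveMap θ)) (by
    rw [range_starι]
    rintro _ ⟨q, rfl⟩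
    have hq : P.starι n q ∈ P.starLocus n := by rw [← range_starι]; exact ⟨q, rfl⟩
    exact P.comap_nerveMap_mem θ hq)

lemma starMap_ι (θ : Fin (m + 1) →o Fin (n + 1)) :
    P.starMap θ ≫ P.starι m = P.starι n ≫ specMap (P.nerveMap θ) :=
  IsOpenImmersion.lift_fac _ _ _

lemma starMap_ι_assoc (θ : Fin (m + 1) →o Fin (n + 1)) {Z : Scheme.{u}}
    (h : Spec (.of (P.NerveRing m)) ⟶ Z) :
    P.starMap θ ≫ P.starι m ≫ h = P.starι n ≫ specMap (P.nerveMap θ) ≫ h := by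
  rw [← Category.assoc, starMap_ι, Category.assoc]

lemma starMap_id : P.starMap (OrderHom.id : Fin (n + 1) →o Fin (n + 1)) = 𝟙 _ := by
  rw [← cancel_mono (P.starι n), starMap_ι, nerveMap_id, specMap_id, Category.comp_id,
    Category.id_comp]

lemma starMap_comp (θ : Fin (m + 1) →o Fin (n + 1)) (θ' : Fin (l + 1) →o Fin (m + 1)) :
    P.starMap (θ.comp θ') = P.starMap θ ≫ P.starMap θ' := by
  rw [← cancel_mono (P.starι l), starMap_ι, nerveMap_comp, specMap_comp, Category.assoc, starMap_ι,
    starMap_ι_assoc]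

/-- The simplicial scheme of the simplices of `NC*`. -/
def starSimplicial : SimplicialObject (Over (Spec (.of k))) where
  obj n := P.starOver n.unop.len
  map θ := Over.homMk (P.starMap θ.unop.toOrderHom) (by
    change P.starMap _ ≫ P.starι _ ≫ _ = P.starι _ ≫ _
    rw [starMap_ι_assoc, specMap_str])
  map_id n := Over.OverMorphism.ext P.starMap_id
  map_comp θ θ' := Over.OverMorphism.ext (P.starMap_comp _ _)

variable {B C : Type u} [CommRing B] [Algebra k B] [CommRing C] [Algebra k C]

/-- The morphism to the scheme of simplices given by a point with values in the open locus. -/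
def starHom (y : P.NerveRing n →ₐ[k] B)
    (hy : ∀ q, PrimeSpectrum.comap (y : P.NerveRing n →+* B) q ∈ P.starLocus n) :
    Spec (.of B) ⟶ P.starScheme n :=
  IsOpenImmersion.lift (P.starι n) (specMap y) (by
    rw [range_starι]
    rintro _ ⟨q, rfl⟩
    exact hy q)

lemma starHom_ι (y : P.NerveRing n →ₐ[k] B)
    (hy : ∀ q, PrimeSpectrum.comap (y : P.NerveRing n →+* B) q ∈ P.starLocus n) :
    P.starHom y hy ≫ P.starι n = specMap y := IsOpenImmersion.lift_fac _ _ _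

lemma starHom_ι_assoc (y : P.NerveRing n →ₐ[k] B)
    (hy : ∀ q, PrimeSpectrum.comap (y : P.NerveRing n →+* B) q ∈ P.starLocus n) {Z : Scheme.{u}}
    (h : Spec (.of (P.NerveRing n)) ⟶ Z) : P.starHom y hy ≫ P.starι n ≫ h = specMap y ≫ h := by
  rw [← Category.assoc, starHom_ι]

/-- The morphism to the scheme of simplices given by a simplex with invertible edges. -/
def simplexHom (x : NerveSimplex (MC (P.baseChange B)) n) (hx : x.IsStar) :
    Spec (.of B) ⟶ P.starScheme n :=
  P.starHom x.point (IsStarPoint.comap_mem ⟨x, hx, rfl⟩)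

lemma simplexHom_ι (x : NerveSimplex (MC (P.baseChange B)) n) (hx : x.IsStar) :
    P.simplexHom x hx ≫ P.starι n = specMap x.point := P.starHom_ι _ _

lemma simplexHom_ι_assoc (x : NerveSimplex (MC (P.baseChange B)) n) (hx : x.IsStar)
    {Z : Scheme.{u}} (h : Spec (.of (P.NerveRing n)) ⟶ Z) :
    P.simplexHom x hx ≫ P.starι n ≫ h = specMap x.point ≫ h := P.starHom_ι_assoc _ _ h

lemma simplexHom_str (x : NerveSimplex (MC (P.baseChange B)) n) (hx : x.IsStar) :
    P.simplexHom x hx ≫ P.starι n ≫ specStr k (P.NerveRing n) = specStr k B := by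
  rw [simplexHom_ι_assoc, specMap_str]

lemma simplexHom_starMap (x : NerveSimplex (MC (P.baseChange B)) n) (hx : x.IsStar)
    (θ : Fin (m + 1) →o Fin (n + 1)) :
    P.simplexHom x hx ≫ P.starMap θ = P.simplexHom (x.pullback θ) (hx.pullback θ) := by
  rw [← cancel_mono (P.starι m), Category.assoc, starMap_ι, simplexHom_ι_assoc, simplexHom_ι,
    NerveSimplex.point_pullback, specMap_comp]

lemma specMap_simplexHom (x : NerveSimplex (MC (P.baseChange B)) n) (hx : x.IsStar)
    (φ : B →ₐ[k] C) :
    specMap φ ≫ P.simplexHom x hx = P.simplexHom (x.mapAlg φ) (hx.map _) := by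
  rw [← cancel_mono (P.starι n), Category.assoc, simplexHom_ι, simplexHom_ι,
    NerveSimplex.point_mapAlg, specMap_comp]

lemma simplexHom_injective [Nontrivial B] {x y : NerveSimplex (MC (P.baseChange B)) n}
    {hx : x.IsStar} {hy : y.IsStar} (h : P.simplexHom x hx = P.simplexHom y hy) : x = y := by
  rw [← cancel_mono (P.starι n), simplexHom_ι, simplexHom_ι] at h
  exact NerveSimplex.ext_point (specMap_injective h)

/-- Morphisms to the scheme of simplices are given by points with values in the open locus. -/
lemma exists_point_of_hom (g : Spec (.of B) ⟶ P.starScheme n)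
    (hg : g ≫ P.starι n ≫ specStr k (P.NerveRing n) = specStr k B) :
    ∃ y : P.NerveRing n →ₐ[k] B, g ≫ P.starι n = specMap y ∧
      ∀ q, PrimeSpectrum.comap (y : P.NerveRing n →+* B) q ∈ P.starLocus n := by
  obtain ⟨y, hy⟩ := exists_specMap_eq (g ≫ P.starι n) (by rw [Category.assoc, hg])
  refine ⟨y, hy.symm, fun q => ?_⟩
  have h : specMap y q ∈ P.starLocus n := by
    rw [hy, ← range_starι]; exact ⟨g q, rfl⟩
  exact h

/-- A morphism to the scheme of simplices comes from a simplex if its point does. -/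
lemma exists_simplexHom_eq {g : Spec (.of B) ⟶ P.starScheme n} {y : P.NerveRing n →ₐ[k] B}
    (hg : g ≫ P.starι n = specMap y) (hy : IsStarPoint y) :
    ∃ x hx, P.simplexHom x hx = g := by
  obtain ⟨x, hx, rfl⟩ := hy
  exact ⟨x, hx, by rw [← cancel_mono (P.starι n), simplexHom_ι, hg]⟩

/-- Locally, morphisms to the scheme of simplices come from simplices. -/
lemma exists_away_simplexHom_eq (g : Spec (.of B) ⟶ P.starScheme n)
    (hg : g ≫ P.starι n ≫ specStr k (P.NerveRing n) = specStr k B) :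
    ∃ s : Finset B, Ideal.span (s : Set B) = ⊤ ∧ ∀ b ∈ s,
      ∃ (x : NerveSimplex (MC (P.baseChange (Localization.Away b))) n) (hx : x.IsStar),
        P.simplexHom x hx =
          specMap (IsScalarTower.toAlgHom k B (Localization.Away b)) ≫ g := by
  obtain ⟨y, hy, h⟩ := P.exists_point_of_hom g hg
  choose b hb hb' using h
  -- No maximal ideal contains all `y (b q)`, since `b q` does not vanish at the image of `q`; a
  -- finite subfamily gives the covering.
  have hspan : Ideal.span (Set.range fun q => y (b q)) = ⊤ := by
    by_contra hne
    obtain ⟨M, hM, hle⟩ := Ideal.exists_le_maximal _ hne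
    exact hb ⟨M, hM.isPrime⟩ (hle (Ideal.subset_span ⟨⟨M, hM.isPrime⟩, rfl⟩))
  obtain ⟨s, hs, hs'⟩ := (Ideal.span_eq_top_iff_finite _).1 hspan
  refine ⟨s, hs', fun c hc => ?_⟩
  obtain ⟨q, rfl⟩ := hs hc
  refine P.exists_simplexHom_eq (y := (IsScalarTower.toAlgHom k B _).comp y)
    (by rw [Category.assoc, hy, specMap_comp]) ((hb' q).of_isUnit ?_)
  exact IsLocalization.Away.algebraMap_isUnit (y (b q))

/-- Over a field, morphisms to the scheme of simplices come from simplices. -/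
lemma exists_simplexHom_eq_of_field {K : Type u} [Field K] [Algebra k K]
    (g : Spec (.of K) ⟶ P.starScheme n)
    (hg : g ≫ P.starι n ≫ specStr k (P.NerveRing n) = specStr k K) :
    ∃ x hx, P.simplexHom x hx = g := by
  obtain ⟨y, hy, h⟩ := P.exists_point_of_hom g hg
  -- The spectrum of a field is a single point, so the local statement is already global.
  obtain ⟨b, hb, hb'⟩ := h ⊥
  exact P.exists_simplexHom_eq hy (hb'.of_isUnit (IsUnit.mk0 _ hb))

end Scheme

end DGCat

end

/-! ### Comparison of `NC*` with the functor of points -/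

noncomputable section

namespace DGCat

section Points

variable {k : Type u} [Field k] (P : DGCat k) [∀ E F i, Module.Finite k (P.Hom E F i)]

/-- The point of the simplicial scheme given by a simplex of `NC*`. -/
def simplexPoint (B : CommAlgCat.{u} k) {n : ℕ} (x : NerveSimplex (MC (P.baseChange B)) n)
    (hx : x.IsStar) : (algSpec (CommRingCat.of k)).obj (Opposite.op B) ⟶ P.starOver n :=
  Over.homMk (P.simplexHom x hx) (P.simplexHom_str x hx)

/-- The comparison of `NC*` with the functor of points. -/
def nerveToPoints : P.nerveMC ⟶ simplicialPoints k P.starSimplicial where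
  app B :=
    { app := fun n => ↾fun x => P.simplexPoint B x.1 x.2
      naturality := fun n m θ => by
        refine ConcreteCategory.hom_ext _ _ fun x => ?_
        exact Over.OverMorphism.ext
          (P.simplexHom_starMap x.1 x.2 θ.unop.toOrderHom).symm }
  naturality B C φ := by
    refine NatTrans.ext (funext fun n => ConcreteCategory.hom_ext _ _ fun x => ?_)
    exact Over.OverMorphism.ext (P.specMap_simplexHom x.1 x.2 φ.hom).symm

lemma isZariskiLocalIso_nerveToPoints : IsZariskiLocalIso P.nerveToPoints where
  locally_injective n B x y h := by
    -- Over the zero ring injectivity may fail, but there the empty covering is available; over any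
    -- other ring it holds without localizing.
    rcases subsingleton_or_nontrivial B with hB | hB
    · exact ⟨∅, Subsingleton.elim _ _, by simp⟩
    · obtain rfl : x = y := Subtype.ext (P.simplexHom_injective (hx := x.2) (hy := y.2)
        (congrArg CommaMorphism.left h))
      exact ⟨{1}, by simp, fun _ _ => rfl⟩
  locally_surjective n B z := by
    obtain ⟨s, hs, h⟩ := P.exists_away_simplexHom_eq (n := n.unop.len) (B := B)
      (CommaMorphism.left z) (Over.w z)
    refine ⟨s, hs, fun b hb => ?_⟩
    obtain ⟨x, hx, hxz⟩ := h b hb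
    exact ⟨⟨x, hx⟩, Over.OverMorphism.ext hxz⟩

end Points

end DGCat

end

/-! ### Smoothness and surjectivity in terms of simplices -/

noncomputable section

namespace DGCat

section Lifting

variable {k : Type u} [Field k] {P : DGCat k} [∀ E F i, Module.Finite k (P.Hom E F i)] {n : ℕ}

/-- The idempotent `1 - e` lies in the kernel and equals its own square, which is zero. Thus the
component of a point does not change along a square-zero extension. -/
lemma _root_.IsIdempotentElem.eq_one_of_map_eq_one {B C : Type*} [CommRing B] [CommRing C]
    {φ : B →+* C} (h : RingHom.ker φ ^ 2 = ⊥) {e : B} (he : IsIdempotentElem e) (h1 : φ e = 1) :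
    e = 1 := by
  have h2 : (1 - e) ^ 2 ∈ RingHom.ker φ ^ 2 :=
    Ideal.pow_mem_pow (show φ (1 - e) = 0 by rw [map_sub, map_one, h1, sub_self]) 2
  rw [h, Ideal.mem_bot, pow_two, he.one_sub.eq] at h2
  exact (sub_eq_zero.1 h2).symm

variable {B C : Type u} [CommRing B] [Algebra k B] [CommRing C] [Algebra k C]

namespace NerveSimplex

/-- A point with values in a square-zero extension whose reduction is given by a simplex is itself
given by a simplex. -/
lemma exists_mapAlg_eq_of_point {π : B →ₐ[k] C} (h : RingHom.ker π ^ 2 = ⊥)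
    {y : P.NerveRing n →ₐ[k] B} {x : NerveSimplex (MC (P.baseChange C)) n}
    (hxy : π.comp y = x.point) :
    ∃ z : NerveSimplex (MC (P.baseChange B)) n, z.point = y ∧ z.mapAlg π = x := by
  have h1 : y (P.nerveIdem x.under) = 1 :=
    ((P.isIdempotentElem_nerveIdem x.under).map y).eq_one_of_map_eq_one
      (φ := (π : B →+* C)) h (by
        change (π.comp y) _ = 1
        rw [hxy, x.point_nerveIdem])
  obtain ⟨ψ, hψ⟩ := exists_point_eq h1
  exact ⟨_, hψ, ext_point_of_under rfl (by rw [point_mapAlg, hψ, hxy])⟩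

/-- Extension of scalars keeps the underlying objects, so equality of the reductions replaces the
nontriviality of `B` in `ext_point`. -/
lemma ext_point_of_mapAlg {x y : NerveSimplex (MC (P.baseChange B)) n} {π : B →ₐ[k] C}
    (h : x.mapAlg π = y.mapAlg π) (hxy : x.point = y.point) : x = y := by
  have h' := congrArg under h
  exact ext_point_of_under h' hxy

end NerveSimplex

/-- A simplex reducing to one with invertible edges defines a point of the open locus. -/
lemma comap_point_mem {π : B →ₐ[k] C} (hπ : Function.Surjective π) (h : RingHom.ker π ^ 2 = ⊥)
    {x : NerveSimplex (MC (P.baseChange B)) n} (hx : (x.mapAlg π).IsStar) (q : PrimeSpectrum B) :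
    PrimeSpectrum.comap (x.point : P.NerveRing n →+* B) q ∈ P.starLocus n := by
  obtain ⟨q, rfl⟩ := PrimeSpectrum.comap_surjective_of_ker_sq_eq_bot (φ := (π : B →+* C)) hπ h q
  have := IsStarPoint.comap_mem ⟨_, hx, rfl⟩ q
  rw [NerveSimplex.point_mapAlg] at this
  exact this

end Lifting

section Criterion

variable {k : Type u} [Field k] (P : DGCat k) [∀ E F i, Module.Finite k (P.Hom E F i)] {n : ℕ}

instance [Finite P.Obj] : LocallyOfFiniteType (P.starOver n).hom := by
  have := P.finiteType_nerveRing n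
  have : LocallyOfFiniteType (specStr k (P.NerveRing n)) :=
    (HasRingHomProperty.Spec_iff (P := @LocallyOfFiniteType)).2
      (RingHom.finiteType_algebraMap.2 this)
  exact locallyOfFiniteType_comp (P.starι n) (specStr k (P.NerveRing n))

/-- A morphism from a scheme of simplices is smooth if simplices can be lifted along square-zero
extensions. -/
lemma smooth_of_simplex_lifting [Finite P.Obj] {Y : Over (Spec (.of k))} (f : P.starOver n ⟶ Y)
    [LocallyOfFiniteType Y.hom]
    (H : ∀ {B C : Type u} [CommRing B] [CommRing C] [Algebra k B] [Algebra k C] (π : B →ₐ[k] C),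
      Function.Surjective π → RingHom.ker π ^ 2 = ⊥ →
      ∀ (x : NerveSimplex (MC (P.baseChange C)) n) (hx : x.IsStar)
        (h : Over.mk (specStr k B) ⟶ Y), specMap π ≫ h.left = P.simplexHom x hx ≫ f.left →
        ∃ z : NerveSimplex (MC (P.baseChange B)) n, z.mapAlg π = x ∧
          ∀ hz, P.starHom z.point hz ≫ f.left = h.left) : Smooth f.left := by
  have hf : f.left ≫ Y.hom = (P.starOver n).hom := Over.w f
  have : LocallyOfFiniteType (f.left ≫ Y.hom) := by rw [hf]; infer_instance
  refine smooth_of_lifting f.left Y.hom fun x => ?_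
  have hx : P.starι n x ∈ P.starLocus n := by rw [← range_starι]; exact ⟨x, rfl⟩
  obtain ⟨b, hb, hb'⟩ := hx
  -- Over this neighbourhood of `x` the universal point is given by a simplex with invertible edges,
  -- so every morphism from an affine `k`-scheme into it comes from such a simplex without further
  -- localization.
  refine ⟨P.starι n ⁻¹ᵁ PrimeSpectrum.basicOpen b, hb,
    fun {B C} _ _ _ _ π hπ hker g h hg hh hgh => ?_⟩
  have hgs : g ≫ P.starι n ≫ specStr k (P.NerveRing n) = specStr k C := by
    have h1 := congrArg (· ≫ Y.hom) hgh
    simp only [Category.assoc, hh, hf] at h1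
    rw [← specMap_str π]
    exact h1.symm
  obtain ⟨y, hy, -⟩ := P.exists_point_of_hom g hgs
  have hu : IsUnit (y b) := by
    by_contra hu
    obtain ⟨M, hM, hyM⟩ := exists_max_ideal_of_mem_nonunits hu
    have h1 := hg ⟨M, hM.isPrime⟩
    have h2 : specMap y ⟨M, hM.isPrime⟩ ∈ PrimeSpectrum.basicOpen b := by rw [← hy]; exact h1
    exact h2 hyM
  obtain ⟨x, hx, rfl⟩ := P.exists_simplexHom_eq hy (hb'.of_isUnit hu)
  obtain ⟨z, rfl, hz⟩ := H π hπ hker x hx (Over.homMk h hh) hgh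
  refine ⟨P.starHom z.point (comap_point_mem hπ hker hx), ?_, hz _⟩
  rw [← cancel_mono (P.starι n), Category.assoc, starHom_ι, simplexHom_ι, NerveSimplex.point_mapAlg,
    specMap_comp]

/-- A morphism from a scheme of simplices is surjective if it is so on points with values in
fields. -/
lemma surjective_of_simplex_filling {Y : Over (Spec (.of k))} (f : P.starOver n ⟶ Y)
    (H : ∀ {K : Type u} [Field K] [Algebra k K] (h : Over.mk (specStr k K) ⟶ Y),
        ∃ (x : NerveSimplex (MC (P.baseChange K)) n) (hx : x.IsStar),
          P.simplexHom x hx ≫ f.left = h.left) : Surjective f.left := by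
  refine ⟨fun y => ?_⟩
  -- A point `y` is the image of the canonical point with values in its residue field, viewed as an
  -- extension of `k` through `Y`; lifting that point is enough.
  let ρ := Spec.preimage (Y.left.fromSpecResidueField y ≫ Y.hom)
  let : Algebra k (Y.left.residueField y) := ρ.hom.toAlgebra
  obtain ⟨x, hx, h⟩ := H (K := Y.left.residueField y)
    (Over.homMk (Y.left.fromSpecResidueField y) (Spec.map_preimage _).symm)
  have pt : Spec (.of (Y.left.residueField y)) := (⊥ : PrimeSpectrum (Y.left.residueField y))
  refine ⟨P.simplexHom x hx pt, ?_⟩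
  rw [← Scheme.Hom.comp_apply, h]
  exact Y.left.fromSpecResidueField_apply y pt

end Criterion

end DGCat

end

/-! ### Matching objects of horns -/

noncomputable section

section HornMatching

variable {C : Type*} [Category C] [HasFiniteLimits C] (X : SimplicialObject C) {n : ℕ}
  {l : Fin (n + 3)}

/-- The faces of the universal horn. -/
def hornProj (p : Fin (n + 3)) (hp : p ≠ l) : hornMatch X (n + 1) l ⟶ level X (n + 1) :=
  equalizer.ι (hornLeft X n l) (hornRight X n l) ≫
    Pi.π (fun _ : {i : Fin (n + 3) // i ≠ l} => level X (n + 1)) ⟨p, hp⟩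

lemma hornProj_compatible (r s : Fin (n + 2)) (h : r ≤ s) (hr : r.castSucc ≠ l) (hs : s.succ ≠ l) :
    hornProj X s.succ hs ≫ X.δ r = hornProj X r.castSucc hr ≫ X.δ s := by
  have := congrArg (· ≫ Pi.π (fun _ : HornPair n l => level X n) ⟨(r, s), h, hr, hs⟩)
    (equalizer.condition (hornLeft X n l) (hornRight X n l))
  refine (Category.assoc _ _ _).trans (Eq.trans ?_ (Category.assoc _ _ _).symm)
  simp only [hornLeft, hornRight, Category.assoc, Pi.lift_π] at this
  exact this

lemma hornMatchMap_hornProj (p : Fin (n + 3)) (hp : p ≠ l) :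
    hornMatchMap X (n + 1) l ≫ hornProj X p hp = X.δ p := by
  refine (equalizer.lift_ι_assoc _ _ _).trans ?_
  rw [Pi.lift_π]

variable {X}

lemma hornMatch_hom_ext {T : C} {a b : T ⟶ hornMatch X (n + 1) l}
    (h : ∀ p hp, a ≫ hornProj X p hp = b ≫ hornProj X p hp) : a = b := by
  refine equalizer.hom_ext (Pi.hom_ext _ _ fun p => ?_)
  exact (Category.assoc _ _ _).trans ((h p.1 p.2).trans (Category.assoc _ _ _).symm)

end HornMatching

/-- The full subcategory has a terminal object and pullbacks, both preserved by the inclusion; these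
generate all finite limits. -/
lemma CategoryTheory.ObjectProperty.isClosedUnderFiniteLimits {C : Type*} [Category C]
    [HasFiniteLimits C] (Q : ObjectProperty C)
    [Q.IsClosedUnderIsomorphisms] [Q.IsClosedUnderLimitsOfShape (Discrete PEmpty.{1})]
    [Q.IsClosedUnderLimitsOfShape WalkingCospan] (J : Type) [SmallCategory J] [FinCategory J] :
    Q.IsClosedUnderLimitsOfShape J := by
  have : HasTerminal Q.FullSubcategory := inferInstance
  have : HasPullbacks Q.FullSubcategory := inferInstance
  have : HasFiniteLimits Q.FullSubcategory := hasFiniteLimits_of_hasTerminal_and_pullbacks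
  have : PreservesFiniteLimits Q.ι := preservesFiniteLimits_of_preservesTerminal_and_pullbacks _
  exact Q.isClosedUnderLimitsOfShape_of_preservesLimitsOfShape_ι J

instance : MorphismProperty.HasOfPostcompProperty @LocallyOfFiniteType @LocallyOfFiniteType where
  of_postcomp f g _ _ := locallyOfFiniteType_of_comp f g

/-- Schemes locally of finite type over `S` are stable under fibre products, because morphisms
between them are again locally of finite type, and hence under the products and the equalizer
defining the matching object. -/
lemma AlgebraicGeometry.locallyOfFiniteType_hornMatch {S : Scheme.{u}}
    (X : SimplicialObject (Over S)) (hX : ∀ n, LocallyOfFiniteType (X.obj n).hom) (n : ℕ)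
    (l : Fin (n + 2)) : LocallyOfFiniteType (hornMatch X n l).hom := by
  match n, l with
  | 0, l => exact hX _
  | n + 1, l =>
    let L : MorphismProperty Scheme.{u} := @LocallyOfFiniteType
    have : L.IsMultiplicative := inferInstanceAs (MorphismProperty.IsMultiplicative @LocallyOfFiniteType)
    let Q : ObjectProperty (Over S) := L.overObj
    have : Q.IsClosedUnderLimitsOfShape (Discrete PEmpty.{1}) :=
      Over.closedUnderLimitsOfShape_discrete_empty L
    have : Q.IsClosedUnderLimitsOfShape WalkingCospan := Over.closedUnderLimitsOfShape_pullback L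
    have := Q.isClosedUnderFiniteLimits WalkingParallelPair
    have : Q.IsClosedUnderFiniteProducts :=
      ⟨fun J _ => by
        have := Fintype.ofFinite J
        exact Q.isClosedUnderFiniteLimits (Discrete J)⟩
    have h : Q (equalizer (hornLeft X n l) (hornRight X n l)) :=
      Q.prop_of_isLimit (limit.isLimit _) fun j => by
        cases j
        · exact Q.prop_product fun _ => hX _
        · exact Q.prop_product fun _ => hX _
    exact h

/-! ### The Grothendieck-Pridham condition -/

noncomputable section

namespace DGCat

section Pridham

variable {k : Type u} [Field k] (P : DGCat k) [∀ E F i, Module.Finite k (P.Hom E F i)] {m n : ℕ}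
variable {B C : Type u} [CommRing B] [Algebra k B] [CommRing C] [Algebra k C]

lemma starHom_starMap_ι (y : P.NerveRing n →ₐ[k] B)
    (hy : ∀ q, PrimeSpectrum.comap (y : P.NerveRing n →+* B) q ∈ P.starLocus n)
    (θ : Fin (m + 1) →o Fin (n + 1)) :
    (P.starHom y hy ≫ P.starMap θ) ≫ P.starι m = specMap (y.comp (P.nerveMap θ)) := by
  rw [Category.assoc, starMap_ι, starHom_ι_assoc, specMap_comp]

/-- The lift of a face of a simplex to a square-zero extension. -/
lemma exists_face_lift {π : B →ₐ[k] C} (hker : RingHom.ker π ^ 2 = ⊥)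
    {x : NerveSimplex (MC (P.baseChange C)) (n + 1)} {hx : x.IsStar} {p : Fin (n + 2)}
    {h : Spec (.of B) ⟶ P.starScheme n}
    (hstr : h ≫ P.starι n ≫ specStr k (P.NerveRing n) = specStr k B)
    (hh : specMap π ≫ h = P.simplexHom x hx ≫ P.starMap (face p).toOrderHom) :
    ∃ f : NerveSimplex (MC (P.baseChange B)) n, h ≫ P.starι n = specMap f.point ∧
      f.mapAlg π = x.pullback (face p).toOrderHom := by
  obtain ⟨y, hy, -⟩ := P.exists_point_of_hom h hstr
  have h1 : π.comp y = (x.pullback (face p).toOrderHom).point := by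
    apply specMap_injective
    rw [specMap_comp, ← hy, ← Category.assoc, hh, simplexHom_starMap, simplexHom_ι]
  obtain ⟨f, rfl, hf⟩ := NerveSimplex.exists_mapAlg_eq_of_point hker h1
  exact ⟨f, hy, hf⟩

lemma grothendieckPridham_zero [Finite P.Obj] (l : Fin 2) :
    GrothendieckPridham P.starSimplicial 0 l := by
  constructor
  · refine P.smooth_of_simplex_lifting (n := 1) (Y := P.starOver 0) (P.starSimplicial.δ l.rev) ?_
    intro B C _ _ _ _ π hπ hker x hx h hh
    obtain ⟨f, hf, hfx⟩ := P.exists_face_lift hker (hx := hx) (p := l.rev) (Over.w h) hh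
    obtain ⟨z, hz, hzx⟩ := NerveSimplex.exists_lift_edge (P.isSquareZero_baseChangeMap π hπ hker)
      l.rev hx hfx
    refine ⟨z, hzx, fun hz' => ?_⟩
    rw [← cancel_mono (P.starι 0), hf, ← hz, NerveSimplex.point_pullback]
    exact P.starHom_starMap_ι _ _ _
  · refine P.surjective_of_simplex_filling (n := 1) (Y := P.starOver 0)
      (P.starSimplicial.δ l.rev) ?_
    intro K _ _ h
    obtain ⟨x, hx, hxh⟩ := P.exists_simplexHom_eq_of_field h.left (Over.w h)
    -- The degenerate edge at the given object, whose two end points are that object.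
    let θ : Fin 2 →o Fin 1 := ⟨fun _ => 0, fun _ _ _ => le_rfl⟩
    refine ⟨x.pullback θ, hx.pullback θ, ?_⟩
    have h1 : (x.pullback θ).pullback (face l.rev).toOrderHom = x := by
      rw [← NerveSimplex.pullback_comp]
      convert x.pullback_id
      exact OrderHom.ext _ _ (funext fun i => Subsingleton.elim (α := Fin 1) _ _)
    refine (P.simplexHom_starMap _ _ (face l.rev).toOrderHom).trans ?_
    rw [← hxh]
    congr 1

section Horn

variable {P} {l : Fin (n + 3)}

/-- The faces of a family of horns. -/
def hornFace (h : Over.mk (specStr k B) ⟶ hornMatch P.starSimplicial (n + 1) l) (p : Fin (n + 3))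
    (hp : p ≠ l) : Spec (.of B) ⟶ P.starScheme (n + 1) :=
  (h ≫ hornProj P.starSimplicial p hp).left

variable (h : Over.mk (specStr k B) ⟶ hornMatch P.starSimplicial (n + 1) l)

lemma hornFace_str (p : Fin (n + 3)) (hp : p ≠ l) :
    hornFace h p hp ≫ P.starι (n + 1) ≫ specStr k (P.NerveRing (n + 1)) = specStr k B :=
  Over.w (h ≫ hornProj P.starSimplicial p hp)

lemma hornFace_compatible {r s : Fin (n + 2)} (hrs : r ≤ s) (hr : r.castSucc ≠ l)
    (hs : s.succ ≠ l) : hornFace h s.succ hs ≫ P.starMap (face r).toOrderHom =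
      hornFace h r.castSucc hr ≫ P.starMap (face s).toOrderHom :=
  congrArg CommaMorphism.left ((Category.assoc _ _ _).trans
    ((congrArg (h ≫ ·) (hornProj_compatible P.starSimplicial r s hrs hr hs)).trans
      (Category.assoc _ _ _).symm))

variable {h}

lemma specMap_hornFace {π : B →ₐ[k] C} {g : Spec (.of C) ⟶ P.starScheme (n + 2)}
    (hg : specMap π ≫ h.left = g ≫ (hornMatchMap P.starSimplicial (n + 1) l).left)
    (p : Fin (n + 3)) (hp : p ≠ l) :
    specMap π ≫ hornFace h p hp = g ≫ P.starMap (face p).toOrderHom := by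
  have h1 := congrArg CommaMorphism.left (hornMatchMap_hornProj P.starSimplicial p hp)
  have h2 := congrArg (· ≫ (hornProj P.starSimplicial p hp).left) hg
  exact (Category.assoc _ _ _).symm.trans (h2.trans ((Category.assoc _ _ _).trans
    (congrArg (g ≫ ·) h1)))

lemma comp_hornMatchMap_eq {g : Spec (.of B) ⟶ P.starScheme (n + 2)}
    (hg : g ≫ P.starι (n + 2) ≫ specStr k (P.NerveRing (n + 2)) = specStr k B)
    (hgh : ∀ p hp, g ≫ P.starMap (face p).toOrderHom = hornFace h p hp) :
    g ≫ (hornMatchMap P.starSimplicial (n + 1) l).left = h.left := by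
  let g' : Over.mk (specStr k B) ⟶ P.starOver (n + 2) := Over.homMk g hg
  have : g' ≫ hornMatchMap P.starSimplicial (n + 1) l = h :=
    hornMatch_hom_ext fun p hp => Over.OverMorphism.ext (by
      have h1 := congrArg CommaMorphism.left (hornMatchMap_hornProj P.starSimplicial p hp)
      exact (Category.assoc _ _ _).trans ((congrArg (g ≫ ·) h1).trans (hgh p hp)))
  exact congrArg CommaMorphism.left this

end Horn

lemma grothendieckPridham_succ [Finite P.Obj] (n : ℕ) (l : Fin (n + 3)) :
    GrothendieckPridham P.starSimplicial (n + 1) l := by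
  constructor
  · have : LocallyOfFiniteType (hornMatch P.starSimplicial (n + 1) l).hom :=
      locallyOfFiniteType_hornMatch _
        (fun i => inferInstanceAs (LocallyOfFiniteType (P.starOver i.unop.len).hom)) _ _
    refine P.smooth_of_simplex_lifting (n := n + 2) (hornMatchMap P.starSimplicial (n + 1) l) ?_
    intro B C _ _ _ _ π hπ hker x hx h hh
    choose f hf hfx using fun p hp =>
      P.exists_face_lift hker (hx := hx) (hornFace_str h p hp) (specMap_hornFace hh p hp)
    -- The common faces of the lifted faces reduce to the same face of `x` and have the same point
    -- by the compatibility of the horn, so they coincide.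
    have hfc : HornCompatible f := by
      intro r s hrs hr hs
      refine NerveSimplex.ext_point_of_mapAlg (π := π) ?_ ?_
      · have e1 := congrArg (NerveSimplex.pullback (face r).toOrderHom) (hfx s.succ hs)
        have e2 := congrArg (NerveSimplex.pullback (face s).toOrderHom) (hfx r.castSucc hr)
        refine e1.trans (Eq.trans ?_ e2.symm)
        rw [← NerveSimplex.pullback_comp, ← NerveSimplex.pullback_comp]
        congr 1
        ext i : 2
        exact (face_face hrs i).symm
      · rw [NerveSimplex.point_pullback, NerveSimplex.point_pullback]
        apply specMap_injective
        rw [specMap_comp, specMap_comp, ← hf, ← hf, Category.assoc, Category.assoc, ← starMap_ι,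
          ← starMap_ι, ← Category.assoc, ← Category.assoc, hornFace_compatible h hrs hr hs]
    obtain ⟨z, hz, hzx⟩ := hfc.exists_lift (P.isSquareZero_baseChangeMap π hπ hker) hx hfx
    refine ⟨z, hzx, fun hz' => comp_hornMatchMap_eq (by rw [starHom_ι_assoc, specMap_str])
      fun p hp => ?_⟩
    rw [← cancel_mono (P.starι (n + 1)), hf, ← hz p hp, NerveSimplex.point_pullback]
    exact P.starHom_starMap_ι _ _ _
  · refine P.surjective_of_simplex_filling (n := n + 2) (hornMatchMap P.starSimplicial (n + 1) l) ?_
    intro K _ _ h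
    choose f hfs hf using fun p hp => P.exists_simplexHom_eq_of_field _ (hornFace_str h p hp)
    -- A field is nontrivial, so simplices over it are determined by their points and compatibility
    -- can be read off from the schemes.
    have hfc : HornCompatible f := by
      intro r s hrs hr hs
      refine P.simplexHom_injective (hx := (hfs _ hs).pullback _) (hy := (hfs _ hr).pullback _) ?_
      rw [← simplexHom_starMap, ← simplexHom_starMap, hf, hf, hornFace_compatible h hrs hr hs]
      exacts [hfs _ hr, hfs _ hs]
    obtain ⟨x, hx, hxs⟩ := hfc.exists_isStar_filler hfs
    refine ⟨x, hxs, comp_hornMatchMap_eq (P.simplexHom_str x hxs) fun p hp => ?_⟩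
    rw [simplexHom_starMap, ← hf p hp]
    congr 1
    exact hx p hp

end Pridham

end DGCat

end

theorem mainTheorem1 {k : Type u} [Field k] (P : DGCat k) [Finite P.Obj]
    (hfin : ∀ (E F : P.Obj) (i : ℤ), Module.Finite k (P.Hom E F i))
    (hbdd : ∃ m : ℤ, 0 < m ∧ ∀ (E F : P.Obj) (i : ℤ), i < -m → Subsingleton (P.Hom E F i)) :
    ∃ (X : SimplicialObject (Over (Spec (CommRingCat.of k))))
      (φ : P.nerveMC ⟶ simplicialPoints k X),
      IsZariskiLocalIso φ ∧ ∀ (n : ℕ) (l : Fin (n + 2)), GrothendieckPridham X n l := by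
  have := hfin
  refine ⟨P.starSimplicial, P.nerveToPoints, P.isZariskiLocalIso_nerveToPoints, fun n l => ?_⟩
  match n, l with
  | 0, l => exact P.grothendieckPridham_zero l
  | n + 1, l => exact P.grothendieckPridham_succ n l
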